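/- All graphs are finite and simple. For a graph $G=(V,E)$ its density is $d_G=2|E|/|V|^2$, and for nonempty $A,B\subseteq V$ let $d_G(A,B)=e_G(A,B)/(|A||B|)$, where $e_G(A,B)$ is the number of ordered pairs $(u,v)\in A\times B$ with $u$ adjacent to $v$. The pair $(A,B)$ is $\epsilon$-regular if $|d_G(A,B)-d_G(A',B')|\le\epsilon$ for all $A'\subseteq A$, $B'\subseteq B$ with $|A'|\ge\epsilon|A|$ and $|B'|\ge\epsilon|B|$. An equipartition of $V$ is a partition into nonempty parts whose sizes differ by at most $1$; its order is its number $k$ of parts; it is $\epsilon$-regular if all but at most $\epsilon k^2$ of the $k^2$ ordered pairs of parts are $\epsilon$-regular. For $\epsilon,\delta,p>0$ let $S(\epsilon,\delta,p)$ be the smallest integer $S$ such that for every graph $G$ of density at least $p$ and every equipartition $\mathcal P_0$ of $V(G)$ of order at most $1/\epsilon$, one can add/remove at most $\delta|E(G)|$ edges and thus turn $G$ into a graph that has an $\epsilon$-regular equipartition that refines $\mathcal P_0$ and has order at most $S$. Let $\mathrm{twr}(x)$ be the tower of twos of height $\lfloor x\rfloor$, so that $\mathrm{twr}(0)=1$ and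 $\mathrm{twr}(x+1)=2^{\mathrm{twr}(x)}$ for $x\ge 0$. **Corollary.** There is an absolute constant $\delta_0>0$ such that for every fixed $0<\delta\le\delta_0$ and every fixed real $C\ge 5$ we have $S(p^C,\delta,p)=\mathrm{twr}(\Theta(\log(1/p)))$; that is, there are constants $c_1,c_2>0$, depending only on $\delta$ and $C$, such that for every $0<p\le 1/2$ the integer $S(p^C,\delta,p)$ is well defined and $$\mathrm{twr}\big(c_1\log(1/p)\big)\;\le\; S(p^C,\delta,p)\;\le\;\mathrm{twr}\big(c_2\log(1/p)\big).$$ -/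

import Mathlib

noncomputable section

namespace SRAL

/-- `tower h` is a tower of `h` twos: `tower 0 = 1`, `tower (h + 1) = 2 ^ tower h`. -/
def tower : ℕ → ℕ
  | 0 => 1
  | h + 1 => 2 ^ tower h

/-- The tower function at a real height `x`, rounded down to an integer height. -/
def twr (x : ℝ) : ℕ := tower ⌊x⌋₊

/-- The density `2|E| / |V|²` of a finite graph. -/
def density {V : Type} [Fintype V] (G : SimpleGraph V) : ℝ :=
  2 * (G.edgeSet.ncard : ℝ) / (Fintype.card V : ℝ) ^ 2

/-- `G'` is obtained from `G` by adding and/or removing at most `δ |E(G)|` edges. -/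
def IsClose {V : Type} [Fintype V] (δ : ℝ) (G G' : SimpleGraph V) : Prop :=
  ((symmDiff G.edgeSet G'.edgeSet).ncard : ℝ) ≤ δ * (G.edgeSet.ncard : ℝ)

open Classical in
/-- The pair `(A, B)` is `ε`-regular: `|d(A, B) - d(A', B')| ≤ ε` for all `A' ⊆ A`, `B' ⊆ B`
with `|A'| ≥ ε|A|` and `|B'| ≥ ε|B|`. Here `G.edgeDensity A B` is the number of adjacent
pairs in `A × B`, divided by `|A||B|`. -/
def IsRegularPair {V : Type} (G : SimpleGraph V) (ε : ℝ) (A B : Finset V) : Prop :=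
  ∀ A' ⊆ A, ∀ B' ⊆ B, ε * (A.card : ℝ) ≤ (A'.card : ℝ) → ε * (B.card : ℝ) ≤ (B'.card : ℝ) →
    |(G.edgeDensity A B : ℝ) - (G.edgeDensity A' B' : ℝ)| ≤ ε

open Classical in
/-- A vertex partition of order `k` is `ε`-regular if all but at most `ε k²` of the `k²` ordered
pairs of its parts are `ε`-regular. -/
def IsRegularPartition {V : Type} [Fintype V] [DecidableEq V] (G : SimpleGraph V) (ε : ℝ)
    (P : Finpartition (Finset.univ : Finset V)) : Prop :=
  (((P.parts ×ˢ P.parts).filter (fun q => ¬ IsRegularPair G ε q.1 q.2)).card : ℝ) ≤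
    ε * (P.parts.card : ℝ) ^ 2

/-- The number `s` is good for `(ε, δ, p)`: for every finite graph `G` of density at least `p` and
every equipartition `P₀` of its vertex set of order at most `1/ε`, one can add/remove at most
`δ |E(G)|` edges and obtain a graph with an `ε`-regular equipartition that refines `P₀`
(in Mathlib's order on partitions, `P ≤ P₀` says that `P` refines `P₀`) and has order at
most `s`. -/
def IsGood (ε δ p : ℝ) (s : ℕ) : Prop :=
  ∀ (V : Type) [Fintype V] [DecidableEq V] (G : SimpleGraph V), p ≤ density G →
    ∀ P₀ : Finpartition (Finset.univ : Finset V), P₀.IsEquipartition →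
      (P₀.parts.card : ℝ) ≤ 1 / ε →
        ∃ G' : SimpleGraph V, IsClose δ G G' ∧
          ∃ P : Finpartition (Finset.univ : Finset V),
            P.IsEquipartition ∧ P ≤ P₀ ∧ IsRegularPartition G' ε P ∧ P.parts.card ≤ s

/-- `S(ε, δ, p)`, the smallest good integer. It takes values in `ℕ∞`, with value `⊤` if there is
no good integer, so that a finite upper bound on it includes that a good integer exists. -/
def S (ε δ p : ℝ) : ℕ∞ := sInf ((fun s : ℕ => (s : ℕ∞)) '' {s : ℕ | IsGood ε δ p s})

end SRAL

end

/-! Upper bound. The potential of a partition is the sum of t log t over its block densities, one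
term per pair of vertices. With F = 2|E| it lies between F log p and 0 (`sum_ent_fiberAvg_ge`,
`ent_nonpos`), and a refinement that moves the block densities by more than (δ/2)F in L1 raises it
by a constant times δ²F, a Pinsker-type inequality (`sum_ent_fiberAvg_sub_ge`). Hence only
O(log(1/p)/δ²) such refinements can occur, whatever ε is. Given an equipartition P, refine it to a
Frieze–Kannan weakly regular labelling φ of bounded exponential size (`exists_weakRegular`). If the
densities on φ are L1-close to those on P, then adding or deleting a suitable proportion of edges in
every block of φ gives all blocks inside one pair of P the same density. A Chernoff-type rounding
realises this by an actual graph, for which every pair of P is regular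
(`exists_regular_modification`). Otherwise the potential grows, and φ is replaced by an
equipartition at small loss (`exists_equitable_refinement`, `sum_ent_ge_of_almost_finer`). One round
costs three exponentials, so the tower has height O(log(1/p)); the dependence on ε enters only
through the starting size.

Lower bound. Vertices are words in a product of alphabets M 0, ..., M s whose sizes grow like a
tower, and x is related to y when s codes accept every (x_{l+1}, y_l). Each code halves the degree,
so the density is about 2^{-s} and s can be of order log(1/p). Place this relation cyclically
between three copies of the vertex set and let the initial partition reveal the first letter.
Suppose that, after few edits, some refinement is regular. If most parts in one copy nearly
determine the letters up to i, then most parts in the preceding copy nearly determine the letters up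
to i+1. Otherwise many edges lie in pairs of parts with a large empty sub-pair, which regularity and
closeness forbid (`sum_split_le`, `card_badSet_le`). The second-moment estimate
`card_overrepresented_le` keeps the exceptional proportion from growing, so the induction runs
through all s letters (`card_badSet_agree_le`). Then most parts are singletons and there are at
least tower s parts (`tower_le_of_isGood`). -/

namespace SRAL

open Finset

/-! ### Edge counts and densities as sums of adjacency indicators. -/

section Adjacency

variable {V : Type}

open Classical in
/-- The indicator of adjacency, with real values. -/
noncomputable def adj (G : SimpleGraph V) (x y : V) : ℝ := if G.Adj x y then 1 else 0

theorem adj_nonneg (G : SimpleGraph V) (x y : V) : 0 ≤ adj G x y := by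
  unfold adj; split_ifs <;> norm_num

theorem adj_le_one (G : SimpleGraph V) (x y : V) : adj G x y ≤ 1 := by
  unfold adj; split_ifs <;> norm_num

theorem adj_comm (G : SimpleGraph V) (x y : V) : adj G x y = adj G y x := by
  by_cases h : G.Adj x y
  · simp [adj, h, h.symm]
  · have h' : ¬ G.Adj y x := fun c => h c.symm
    simp [adj, h, h']

theorem adj_self (G : SimpleGraph V) (x : V) : adj G x x = 0 := by simp [adj]

open Classical in
theorem edgeDensity_eq_sum (G : SimpleGraph V) (A B : Finset V) :
    (G.edgeDensity A B : ℝ) = (∑ x ∈ A, ∑ y ∈ B, adj G x y) / (#A * #B) := by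
  rw [SimpleGraph.edgeDensity_def, SimpleGraph.interedges_def, Finset.card_filter]
  push_cast
  rw [← Finset.sum_product']
  congr 1
  exact Finset.sum_congr rfl fun p _ => by
    unfold adj; split_ifs <;> simp_all

variable [Fintype V]

theorem two_mul_ncard_edgeSet (G : SimpleGraph V) :
    2 * (G.edgeSet.ncard : ℝ) = ∑ x, ∑ y, adj G x y := by
  classical
  have h := G.two_mul_card_edgeFinset
  have h2 : G.edgeSet.ncard = #G.edgeFinset := by
    rw [← SimpleGraph.coe_edgeFinset, Set.ncard_coe_finset]
  rw [h2]
  have h3 : ((2 * #G.edgeFinset : ℕ) : ℝ)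
      = ((#(univ.filter fun (p : V × V) ↦ G.Adj p.1 p.2) : ℕ) : ℝ) := by exact_mod_cast h
  push_cast at h3
  rw [h3, Finset.card_filter, ← Fintype.sum_prod_type']
  push_cast
  exact Finset.sum_congr rfl fun p _ => by unfold adj; congr

theorem two_mul_ncard_symmDiff (G G' : SimpleGraph V) :
    2 * ((symmDiff G.edgeSet G'.edgeSet).ncard : ℝ) = ∑ x, ∑ y, |adj G' x y - adj G x y| := by
  have h : symmDiff G.edgeSet G'.edgeSet = (symmDiff G G').edgeSet := by
    simp [symmDiff, SimpleGraph.edgeSet_sup, SimpleGraph.edgeSet_sdiff]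
  rw [h, two_mul_ncard_edgeSet]
  refine Finset.sum_congr rfl fun x _ => Finset.sum_congr rfl fun y _ => ?_
  unfold adj
  by_cases h1 : G.Adj x y <;> by_cases h2 : G'.Adj x y <;>
    simp [symmDiff, SimpleGraph.sup_adj, SimpleGraph.sdiff_adj, h1, h2]

theorem density_eq (G : SimpleGraph V) :
    density G = (∑ x, ∑ y, adj G x y) / (Fintype.card V : ℝ) ^ 2 := by
  rw [density, two_mul_ncard_edgeSet]

end Adjacency

/-! ### Conditional averages, and the energy and entropy of a labelling. -/

section CondExp

variable {Ω ι κ : Type*} [Fintype Ω] [DecidableEq ι] [DecidableEq κ]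

/-- The average of `f` over the fibre of the labelling `Φ` through `ω`. -/
noncomputable def fiberAvg (Φ : Ω → ι) (f : Ω → ℝ) (ω : Ω) : ℝ :=
  (∑ ω' with Φ ω' = Φ ω, f ω') / #{ω' | Φ ω' = Φ ω}

theorem fiberAvg_congr (Φ : Ω → ι) (f : Ω → ℝ) {ω ω' : Ω} (h : Φ ω = Φ ω') :
    fiberAvg Φ f ω = fiberAvg Φ f ω' := by
  simp [fiberAvg, h]

theorem fiber_card_pos (Φ : Ω → ι) (ω : Ω) : 0 < (#{ω' | Φ ω' = Φ ω} : ℝ) := by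
  have : 0 < #{ω' | Φ ω' = Φ ω} := Finset.card_pos.2 ⟨ω, by simp⟩
  exact_mod_cast this

theorem fiberAvg_nonneg (Φ : Ω → ι) {f : Ω → ℝ} (hf : ∀ ω, 0 ≤ f ω) (ω : Ω) :
    0 ≤ fiberAvg Φ f ω :=
  div_nonneg (Finset.sum_nonneg fun _ _ => hf _) (Nat.cast_nonneg _)

theorem fiberAvg_le_one (Φ : Ω → ι) {f : Ω → ℝ} (hf : ∀ ω, f ω ≤ 1) (ω : Ω) :
    fiberAvg Φ f ω ≤ 1 := by
  rw [fiberAvg, div_le_one (fiber_card_pos Φ ω)]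
  calc _ ≤ ∑ ω' with Φ ω' = Φ ω, (1 : ℝ) := Finset.sum_le_sum fun _ _ => hf _
    _ = _ := by simp

theorem sum_fiberAvg_mul (Φ : Ω → ι) (f k : Ω → ℝ) (hk : ∀ ω ω', Φ ω = Φ ω' → k ω = k ω') :
    ∑ ω, fiberAvg Φ f ω * k ω = ∑ ω, f ω * k ω := by
  have h1 : ∀ ω, fiberAvg Φ f ω * k ω
      = ∑ ω', if Φ ω' = Φ ω then f ω' * k ω' / #{ω'' | Φ ω'' = Φ ω'} else 0 := by
    intro ω
    rw [fiberAvg, ← Finset.sum_filter, div_mul_eq_mul_div, Finset.sum_mul, Finset.sum_div]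
    refine Finset.sum_congr rfl fun ω' hω' => ?_
    have h := (Finset.mem_filter.1 hω').2
    rw [hk ω' ω h, h]
  rw [Finset.sum_congr rfl fun ω _ => h1 ω, Finset.sum_comm]
  refine Finset.sum_congr rfl fun ω' _ => ?_
  rw [← Finset.sum_filter, Finset.sum_const, nsmul_eq_mul]
  have h2 : #{ω | Φ ω' = Φ ω} = #{ω'' | Φ ω'' = Φ ω'} := by
    congr 1; ext; simp [eq_comm]
  rw [h2, mul_div_cancel₀ _ (fiber_card_pos Φ ω').ne']

theorem sum_fiberAvg (Φ : Ω → ι) (f : Ω → ℝ) : ∑ ω, fiberAvg Φ f ω = ∑ ω, f ω := by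
  simpa using sum_fiberAvg_mul Φ f (fun _ => 1) (fun _ _ _ => rfl)

/-- The labelling `Ψ` is finer than `Φ`. -/
def Finer (Ψ : Ω → κ) (Φ : Ω → ι) : Prop := ∀ ω ω', Ψ ω = Ψ ω' → Φ ω = Φ ω'

/-- Averages along successive refinements form a martingale, whose increments are orthogonal to
every function that is constant on coarse fibres. -/
theorem sum_fiberAvg_sub_mul {Ψ : Ω → κ} {Φ : Ω → ι} (h : Finer Ψ Φ) (f k : Ω → ℝ)
    (hk : ∀ ω ω', Φ ω = Φ ω' → k ω = k ω') :
    ∑ ω, (fiberAvg Ψ f ω - fiberAvg Φ f ω) * k ω = 0 := by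
  simp_rw [sub_mul, Finset.sum_sub_distrib]
  rw [sum_fiberAvg_mul Φ f k hk, sum_fiberAvg_mul Ψ f k fun ω ω' e => hk _ _ (h _ _ e), sub_self]

theorem sum_sq_fiberAvg_sub {Ψ : Ω → κ} {Φ : Ω → ι} (h : Finer Ψ Φ) (f : Ω → ℝ) :
    ∑ ω, (fiberAvg Ψ f ω - fiberAvg Φ f ω) ^ 2
      = ∑ ω, fiberAvg Ψ f ω ^ 2 - ∑ ω, fiberAvg Φ f ω ^ 2 := by
  have h0 := sum_fiberAvg_sub_mul h f (fiberAvg Φ f) fun ω ω' e => fiberAvg_congr Φ f e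
  rw [← Finset.sum_sub_distrib]
  have : ∀ ω, (fiberAvg Ψ f ω - fiberAvg Φ f ω) ^ 2
      = (fiberAvg Ψ f ω ^ 2 - fiberAvg Φ f ω ^ 2)
        - 2 * ((fiberAvg Ψ f ω - fiberAvg Φ f ω) * fiberAvg Φ f ω) := fun ω => by ring
  rw [Finset.sum_congr rfl fun ω _ => this ω, Finset.sum_sub_distrib, ← Finset.mul_sum, h0]
  ring

theorem fiberAvg_eq_zero_of_finer {Ψ : Ω → κ} {Φ : Ω → ι} (h : Finer Ψ Φ) {f : Ω → ℝ}
    (hf : ∀ ω, 0 ≤ f ω) {ω : Ω} (h0 : fiberAvg Φ f ω = 0) : fiberAvg Ψ f ω = 0 := by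
  rw [fiberAvg, div_eq_zero_iff, or_iff_left (fiber_card_pos Φ ω).ne',
    Finset.sum_eq_zero_iff_of_nonneg fun _ _ => hf _] at h0
  rw [fiberAvg, Finset.sum_eq_zero, zero_div]
  intro ω' hω'
  exact h0 ω' (by simpa using h _ _ (Finset.mem_filter.1 hω').2)

/-- The function `t log t`. -/
noncomputable def ent (t : ℝ) : ℝ := t * Real.log t

theorem ent_nonpos {t : ℝ} (h0 : 0 ≤ t) (h1 : t ≤ 1) : ent t ≤ 0 :=
  mul_nonpos_of_nonneg_of_nonpos h0 (Real.log_nonpos h0 h1)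

theorem neg_one_le_ent {t : ℝ} (h0 : 0 ≤ t) : -1 ≤ ent t := by
  rcases h0.eq_or_lt with rfl | h
  · simp [ent]
  have h1 := Real.one_sub_inv_le_log_of_pos h
  have : t * (1 - t⁻¹) ≤ t * Real.log t := mul_le_mul_of_nonneg_left h1 h.le
  rw [mul_sub, mul_inv_cancel₀ h.ne'] at this
  unfold ent; linarith

/-- Legendre duality: log z ≤ z - 1 at z = π exp(a)/q bounds the Bregman divergence of t log t from
below. The factor log π + 1 is the derivative at π; the parameter a is free. -/
theorem ent_sub_ge {q π a : ℝ} (hq : 0 ≤ q) (hπ : 0 ≤ π) (h : π = 0 → q = 0) :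
    a * (q - π) - π * (Real.exp a - 1 - a) + (Real.log π + 1) * (q - π) ≤ ent q - ent π := by
  rcases hπ.eq_or_lt with rfl | hπ
  · simp [h rfl, ent]
  rcases hq.eq_or_lt with rfl | hq
  · have := mul_pos hπ (Real.exp_pos a)
    simp only [ent, Real.log_zero]; nlinarith
  have h1 : Real.log (π * Real.exp a / q) ≤ π * Real.exp a / q - 1 :=
    Real.log_le_sub_one_of_pos (by positivity)
  rw [Real.log_div (by positivity) hq.ne', Real.log_mul hπ.ne' (Real.exp_pos a).ne',
    Real.log_exp] at h1
  have h2 := mul_le_mul_of_nonneg_left h1 hq.le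
  have h3 : q * (π * Real.exp a / q - 1) = π * Real.exp a - q := by field_simp
  rw [h3] at h2
  unfold ent; nlinarith

theorem exp_sub_le_sq {a : ℝ} (h : |a| ≤ 1) : Real.exp a - 1 - a ≤ a ^ 2 :=
  (le_abs_self _).trans (Real.abs_exp_sub_one_sub_id_le h)

/-- Pinsker's inequality with a free parameter. The duality bound is applied pointwise with a = ±l,
the sign being that of the increment; the derivative term is constant on coarse fibres and sums to
0. -/
theorem sum_ent_fiberAvg_sub_ge {Ψ : Ω → κ} {Φ : Ω → ι} (h : Finer Ψ Φ) {f : Ω → ℝ}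
    (hf : ∀ ω, 0 ≤ f ω) {l : ℝ} (hl : 0 ≤ l) (hl1 : l ≤ 1) :
    l * ∑ ω, |fiberAvg Ψ f ω - fiberAvg Φ f ω| - l ^ 2 * ∑ ω, f ω
      ≤ ∑ ω, ent (fiberAvg Ψ f ω) - ∑ ω, ent (fiberAvg Φ f ω) := by
  have h0 := sum_fiberAvg_sub_mul h f (fun ω => Real.log (fiberAvg Φ f ω) + 1)
    fun ω ω' e => by simp only [fiberAvg_congr Φ f e]
  rw [← sum_fiberAvg Φ f, ← Finset.sum_sub_distrib, Finset.mul_sum, Finset.mul_sum,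
    ← Finset.sum_sub_distrib, ← add_zero (∑ ω, _), ← h0, ← Finset.sum_add_distrib]
  refine Finset.sum_le_sum fun ω _ => ?_
  set q := fiberAvg Ψ f ω
  set π := fiberAvg Φ f ω
  have hq : 0 ≤ q := fiberAvg_nonneg Ψ hf ω
  have hπ : 0 ≤ π := fiberAvg_nonneg Φ hf ω
  have hz : π = 0 → q = 0 := fiberAvg_eq_zero_of_finer h hf
  obtain ⟨a, ha, ha2, hal⟩ : ∃ a : ℝ, a * (q - π) = l * |q - π| ∧ a ^ 2 = l ^ 2 ∧ |a| ≤ 1 := by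
    rcases le_total 0 (q - π) with hs | hs
    · exact ⟨l, by rw [abs_of_nonneg hs], rfl, by rwa [abs_of_nonneg hl]⟩
    · exact ⟨-l, by rw [abs_of_nonpos hs]; ring, by ring, by rwa [abs_neg, abs_of_nonneg hl]⟩
  have h1 := ent_sub_ge (a := a) hq hπ hz
  have h2 := mul_le_mul_of_nonneg_left (exp_sub_le_sq hal) hπ
  rw [ha2] at h2
  rw [ha] at h1
  linarith

theorem sum_ent_fiberAvg_mono {Ψ : Ω → κ} {Φ : Ω → ι} (h : Finer Ψ Φ) {f : Ω → ℝ}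
    (hf : ∀ ω, 0 ≤ f ω) : ∑ ω, ent (fiberAvg Φ f ω) ≤ ∑ ω, ent (fiberAvg Ψ f ω) := by
  have := sum_ent_fiberAvg_sub_ge h hf le_rfl zero_le_one
  simp at this; exact this

/-- Jensen's inequality, through the tangent line of t log t at d. It bounds the potential of the
initial partition from below. -/
theorem sum_ent_fiberAvg_ge (Φ : Ω → ι) {f : Ω → ℝ} (hf : ∀ ω, 0 ≤ f ω) {d : ℝ} (hd : 0 < d)
    (hdf : d * Fintype.card Ω ≤ ∑ ω, f ω) :
    (∑ ω, f ω) * Real.log d ≤ ∑ ω, ent (fiberAvg Φ f ω) := by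
  have h1 : ∀ ω, fiberAvg Φ f ω * Real.log d + (fiberAvg Φ f ω - d) ≤ ent (fiberAvg Φ f ω) := by
    intro ω
    have := ent_sub_ge (a := 0) (fiberAvg_nonneg Φ hf ω) hd.le (fun h => absurd h hd.ne')
    simp [ent] at this ⊢; linarith
  have h2 := Finset.sum_le_sum fun ω (_ : ω ∈ univ) => h1 ω
  rw [Finset.sum_add_distrib, ← Finset.sum_mul, Finset.sum_sub_distrib, sum_fiberAvg] at h2
  simp at h2
  linarith

end CondExp

/-! ### Derandomised rounding of edge weights. -/

section Rounding

theorem exp_le_one_add_add_sq {t : ℝ} (h : |t| ≤ 1) : Real.exp t ≤ 1 + t + t ^ 2 := by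
  have := exp_sub_le_sq h; linarith

theorem two_point_mgf_le {w b : ℝ} (h0 : 0 ≤ w) (h1 : w ≤ 1) (hb : |b| ≤ 1) :
    w * Real.exp (b * (1 - w)) + (1 - w) * Real.exp (b * (0 - w)) ≤ Real.exp (b ^ 2) := by
  have hb' := abs_le.1 hb
  have e1 : Real.exp (b * (1 - w)) ≤ 1 + b * (1 - w) + (b * (1 - w)) ^ 2 := by
    apply exp_le_one_add_add_sq
    rw [abs_mul, abs_of_nonneg (by linarith : 0 ≤ 1 - w)]
    exact mul_le_one₀ hb (by linarith) (by linarith)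
  have e2 : Real.exp (b * (0 - w)) ≤ 1 + b * (0 - w) + (b * (0 - w)) ^ 2 := by
    apply exp_le_one_add_add_sq
    rw [abs_mul, abs_of_nonpos (by linarith : 0 - w ≤ 0)]
    exact mul_le_one₀ hb (by linarith) (by linarith)
  have e3 := Real.add_one_le_exp (b ^ 2)
  have e4 := mul_le_mul_of_nonneg_left e1 h0
  have e5 := mul_le_mul_of_nonneg_left e2 (by linarith : 0 ≤ 1 - w)
  have e6 : b ^ 2 * (w * (1 - w)) ≤ b ^ 2 * 1 :=
    mul_le_mul_of_nonneg_left (by nlinarith) (sq_nonneg b)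
  nlinarith

/-- Chernoff bound by the method of conditional expectations: the coordinates are rounded one at a
time, controlling the sum over all tests of the exponential of l times the deviation so far. -/
theorem exists_rounding {E I : Type*} [Fintype E] [DecidableEq E] [Fintype I] [Nonempty I]
    (w : E → ℝ) (h0 : ∀ e, 0 ≤ w e) (h1 : ∀ e, w e ≤ 1) (a : I → E → ℝ)
    (ha : ∀ i e, |a i e| ≤ 1) {l : ℝ} (hl : 0 < l) (hl1 : l ≤ 1) :
    ∃ f : E → ℝ, (∀ e, f e = 0 ∨ f e = 1) ∧ (∀ e, w e = 0 → f e = 0) ∧ (∀ e, w e = 1 → f e = 1) ∧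
      ∀ i, ∑ e, a i e * (f e - w e)
        ≤ (Real.log (Fintype.card I) + l ^ 2 * Fintype.card E) / l := by
  have key : ∀ F : Finset E, ∃ f : E → ℝ, (∀ e, f e = 0 ∨ f e = 1) ∧ (∀ e, w e = 0 → f e = 0) ∧
      (∀ e, w e = 1 → f e = 1) ∧
      ∑ i, Real.exp (l * ∑ e ∈ F, a i e * (f e - w e))
        ≤ Fintype.card I * Real.exp (l ^ 2 * #F) := by
    intro F
    induction F using Finset.induction_on with
    | empty =>
      refine ⟨fun e => if w e = 1 then 1 else 0, fun e => ?_, fun e he => ?_, fun e he => ?_, ?_⟩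
      · dsimp only; split_ifs <;> simp
      · simp [he]
      · simp [he]
      · simp
    | insert e F he ih =>
      obtain ⟨f, hf, hf0, hf1, hs⟩ := ih
      set X : I → ℝ := fun i => Real.exp (l * ∑ e ∈ F, a i e * (f e - w e)) with hX
      have hstep : ∀ v : ℝ, ∀ i, Real.exp (l * ∑ e' ∈ insert e F,
          a i e' * (Function.update f e v e' - w e')) = X i * Real.exp (l * a i e * (v - w e)) := by
        intro v i
        rw [Finset.sum_insert he, Function.update_self, ← Real.exp_add]
        have : ∑ e' ∈ F, a i e' * (Function.update f e v e' - w e')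
            = ∑ e' ∈ F, a i e' * (f e' - w e') := by
          refine Finset.sum_congr rfl fun e' he' => ?_
          rw [Function.update_of_ne]
          rintro rfl; exact he he'
        rw [this]; congr 1; ring
      -- Rounding `e` to 1 with probability `w e` multiplies the sum by at most exp(l²) on average,
      -- so one of the values 0 and 1 achieves this factor.
      have havg : w e * ∑ i, X i * Real.exp (l * a i e * (1 - w e))
          + (1 - w e) * ∑ i, X i * Real.exp (l * a i e * (0 - w e))
          ≤ Real.exp (l ^ 2) * ∑ i, X i := by
        rw [Finset.mul_sum, Finset.mul_sum, Finset.mul_sum, ← Finset.sum_add_distrib]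
        refine Finset.sum_le_sum fun i _ => ?_
        have hb : |l * a i e| ≤ 1 := by
          rw [abs_mul, abs_of_pos hl]
          exact mul_le_one₀ hl1 (abs_nonneg _) (ha i e)
        have h2 := two_point_mgf_le (h0 e) (h1 e) hb
        have h3 : Real.exp ((l * a i e) ^ 2) ≤ Real.exp (l ^ 2) := by
          apply Real.exp_le_exp.2
          rw [mul_pow]
          exact mul_le_of_le_one_right (sq_nonneg _) ((sq_le_one_iff_abs_le_one _).2 (ha i e))
        have h4 := mul_le_mul_of_nonneg_left (h2.trans h3) (Real.exp_pos
          (l * ∑ e ∈ F, a i e * (f e - w e))).le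
        simp only [hX]
        linarith
      have hfin : Real.exp (l ^ 2) * ∑ i, X i
          ≤ Fintype.card I * Real.exp (l ^ 2 * #(insert e F)) := by
        rw [Finset.card_insert_of_notMem he]
        push_cast
        rw [mul_add, mul_one, Real.exp_add]
        calc _ ≤ Real.exp (l ^ 2) * (Fintype.card I * Real.exp (l ^ 2 * #F)) :=
              mul_le_mul_of_nonneg_left hs (Real.exp_pos _).le
          _ = _ := by ring
      obtain ⟨v, hv, hv0, hv1, hvs⟩ : ∃ v : ℝ, (v = 0 ∨ v = 1) ∧ (w e = 0 → v = 0) ∧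
          (w e = 1 → v = 1) ∧ ∑ i, X i * Real.exp (l * a i e * (v - w e))
            ≤ Real.exp (l ^ 2) * ∑ i, X i := by
        set S1 := ∑ i, X i * Real.exp (l * a i e * (1 - w e)) with hS1
        set S0 := ∑ i, X i * Real.exp (l * a i e * (0 - w e)) with hS0
        by_cases c0 : w e = 0
        · refine ⟨0, Or.inl rfl, fun _ => rfl, fun h => by rw [c0] at h; norm_num at h, ?_⟩
          rw [← hS0]; rw [c0] at havg; linarith
        by_cases c1 : w e = 1
        · refine ⟨1, Or.inr rfl, fun h => absurd h c0, fun _ => rfl, ?_⟩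
          rw [← hS1]; rw [c1] at havg; linarith
        rcases le_total S0 S1 with h | h
        · refine ⟨0, Or.inl rfl, fun _ => rfl, fun h => absurd h c1, ?_⟩
          rw [← hS0]
          have := mul_le_mul_of_nonneg_left h (h0 e)
          linarith
        · refine ⟨1, Or.inr rfl, fun h => absurd h c0, fun _ => rfl, ?_⟩
          rw [← hS1]
          have := mul_le_mul_of_nonneg_left h (sub_nonneg.2 (h1 e))
          linarith
      refine ⟨Function.update f e v, fun e' => ?_, fun e' h' => ?_, fun e' h' => ?_, ?_⟩
      · by_cases h : e' = e
        · subst h; simpa using hv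
        · simpa [h] using hf e'
      · by_cases h : e' = e
        · subst h; simpa using hv0 h'
        · simpa [h] using hf0 e' h'
      · by_cases h : e' = e
        · subst h; simpa using hv1 h'
        · simpa [h] using hf1 e' h'
      · rw [Finset.sum_congr rfl fun i _ => hstep v i]
        exact hvs.trans hfin
  obtain ⟨f, hf, hf0, hf1, hs⟩ := key univ
  refine ⟨f, hf, hf0, hf1, fun i => ?_⟩
  have h2 : Real.exp (l * ∑ e, a i e * (f e - w e))
      ≤ Fintype.card I * Real.exp (l ^ 2 * Fintype.card E) :=
    (Finset.single_le_sum (f := fun i => Real.exp (l * ∑ e, a i e * (f e - w e)))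
      (fun _ _ => (Real.exp_pos _).le) (Finset.mem_univ i)).trans hs
  have hc : (0 : ℝ) < Fintype.card I := by exact_mod_cast Fintype.card_pos
  rw [← Real.exp_log hc, ← Real.exp_add, Real.exp_le_exp] at h2
  rw [le_div_iff₀ hl, mul_comm]
  exact h2

theorem sum_mul_sym2 {V : Type*} [Fintype V] [DecidableEq V] (k : V → V → ℝ) (F : Sym2 V → ℝ) :
    ∑ x, ∑ y, k x y * F s(x, y)
      = 2 * ∑ e, (∑ q : V × V with s(q.1, q.2) = e, k q.1 q.2) / 2 * F e := by
  rw [Finset.mul_sum, ← Fintype.sum_prod_type' (f := fun x y => k x y * F s(x, y)),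
    ← Finset.sum_fiberwise (s := univ) (g := fun q : V × V => s(q.1, q.2))]
  refine Finset.sum_congr rfl fun e _ => ?_
  rw [← mul_assoc, mul_div_cancel₀ _ two_ne_zero, Finset.sum_mul]
  refine Finset.sum_congr rfl fun q hq => ?_
  rw [(Finset.mem_filter.1 hq).2]

theorem card_sym2_fiber_le {V : Type*} [Fintype V] [DecidableEq V] (e : Sym2 V) :
    #{q : V × V | s(q.1, q.2) = e} ≤ 2 := by
  induction e with | _ x y =>
  calc _ ≤ #{(x, y), (y, x)} := Finset.card_le_card fun q hq => by
        have := (Finset.mem_filter.1 hq).2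
        rw [Sym2.eq_iff] at this
        rcases q with ⟨a, b⟩
        simpa using this
    _ ≤ 2 := Finset.card_le_two

/-- Simultaneous rounding of symmetric weights to a graph, against a finite family of kernels. -/
theorem exists_graph_rounding {V : Type} {I : Type*} [Fintype V] [DecidableEq V] [Fintype I]
    [Nonempty I] (w : V → V → ℝ) (hsymm : ∀ x y, w x y = w y x) (h0 : ∀ x y, 0 ≤ w x y)
    (h1 : ∀ x y, w x y ≤ 1) (hd : ∀ x, w x x = 0) (k : I → V → V → ℝ)
    (hk : ∀ i x y, |k i x y| ≤ 1) {l : ℝ} (hl : 0 < l) (hl1 : l ≤ 1) :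
    ∃ G : SimpleGraph V, ∀ i, ∑ x, ∑ y, k i x y * (adj G x y - w x y)
        ≤ 2 * ((Real.log (Fintype.card I) + l ^ 2 * (Fintype.card V : ℝ) ^ 2) / l) := by
  classical
  let w' : Sym2 V → ℝ := Sym2.lift ⟨w, hsymm⟩
  have hw' : ∀ x y, w' s(x, y) = w x y := fun x y => rfl
  obtain ⟨f, hf, hf0, -, hs⟩ := exists_rounding (E := Sym2 V) w'
    (fun e => by induction e with | _ x y => exact h0 x y)
    (fun e => by induction e with | _ x y => exact h1 x y)
    -- An unordered pair has at most two orderings, so halving the summed kernel keeps it in [-1,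
    -- 1]; this accounts for the factor 2 in the conclusion.
    (fun i e => (∑ q : V × V with s(q.1, q.2) = e, k i q.1 q.2) / 2)
    (fun i e => by
      rw [abs_div, abs_two, div_le_one two_pos]
      calc _ ≤ ∑ q : V × V with s(q.1, q.2) = e, |k i q.1 q.2| := Finset.abs_sum_le_sum_abs _ _
        _ ≤ ∑ q : V × V with s(q.1, q.2) = e, (1 : ℝ) := Finset.sum_le_sum fun _ _ => hk _ _ _
        _ ≤ 2 := by
          rw [Finset.sum_const, nsmul_eq_mul, mul_one]
          exact_mod_cast card_sym2_fiber_le e) hl hl1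
  let G : SimpleGraph V :=
    { Adj := fun x y => f s(x, y) = 1
      symm := ⟨fun x y h => by rwa [Sym2.eq_swap]⟩
      loopless := ⟨fun x h => by
        rw [hf0 _ ((hw' x x).trans (hd x))] at h; norm_num at h⟩ }
  have hG : ∀ x y, adj G x y = f s(x, y) := by
    intro x y
    unfold adj
    split_ifs with h
    · exact (show f s(x, y) = 1 from h).symm
    · exact ((hf s(x, y)).resolve_right h).symm
  refine ⟨G, fun i => ?_⟩
  have h2 := sum_mul_sym2 (k i) (fun e => f e - w' e)
  simp only [hw', ← hG] at h2
  rw [h2]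
  refine mul_le_mul_of_nonneg_left ((hs i).trans ?_) two_pos.le
  refine div_le_div_of_nonneg_right ?_ hl.le
  have hcard : (Fintype.card (Sym2 V) : ℝ) ≤ (Fintype.card V : ℝ) ^ 2 := by
    have : Fintype.card (Sym2 V) ≤ Fintype.card (V × V) :=
      Fintype.card_le_of_surjective (fun q : V × V => s(q.1, q.2)) fun e => by
        induction e with | _ x y => exact ⟨(x, y), rfl⟩
    rw [Fintype.card_prod] at this
    rw [sq]; exact_mod_cast this
  have := mul_le_mul_of_nonneg_left hcard (sq_nonneg l)
  linarith

end Rounding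

/-! ### Frieze–Kannan weak regularity with block-constant multipliers. -/

section WeakRegularity

variable {V : Type}

/-- The labelling of pairs induced by a labelling of vertices. -/
def pairLabel {ι : Type*} (φ : V → ι) (q : V × V) : ι × ι := (φ q.1, φ q.2)

theorem finer_pairLabel {ι κ : Type*} {ψ : V → κ} {φ : V → ι} (h : Finer ψ φ) :
    Finer (pairLabel ψ) (pairLabel φ) := by
  intro q q' e
  simp only [pairLabel, Prod.mk.injEq] at e ⊢
  exact ⟨h _ _ e.1, h _ _ e.2⟩

variable [Fintype V]

/-- Every block-constant multiple of `f` has, on every combinatorial rectangle, almost the same sum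
as that multiple of the block averages of `f`. -/
def WeakRegular (φ : V → ℕ) (f : V × V → ℝ) (η : ℝ) : Prop :=
  ∀ (S T : Finset V) (c : V × V → ℝ),
    (∀ q q', pairLabel φ q = pairLabel φ q' → c q = c q') → (∀ q, |c q| ≤ 1) →
      |∑ q ∈ S ×ˢ T, c q * (f q - fiberAvg (pairLabel φ) f q)| ≤ η * (Fintype.card V : ℝ) ^ 2

/-- Splitting the classes along the witnesses S and T makes the test function constant on blocks. By
Cauchy–Schwarz, its correlation with the density increment then forces the energy up. -/
theorem exists_energy_increment [Nonempty V] {φ : V → ℕ} {L : ℕ} (hφ : ∀ x, φ x < L)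
    {f : V × V → ℝ} {η : ℝ} (hη : 0 < η) (h : ¬ WeakRegular φ f η) :
    ∃ φ' : V → ℕ, (∀ x, φ' x < L * 4) ∧ Finer φ' φ ∧
      ∑ q, fiberAvg (pairLabel φ) f q ^ 2 + η ^ 2 * (Fintype.card V : ℝ) ^ 2
        ≤ ∑ q, fiberAvg (pairLabel φ') f q ^ 2 := by
  classical
  simp only [WeakRegular, not_forall, not_le] at h
  obtain ⟨S, T, c, hc, hc1, hlt⟩ := h
  -- The last two binary digits record membership in S and in T.
  let φ' : V → ℕ := fun x => φ x * 4 + ((if x ∈ S then 2 else 0) + (if x ∈ T then 1 else 0))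
  have hb : ∀ x, (if x ∈ S then 2 else 0) + (if x ∈ T then 1 else 0) < 4 := by
    intro x; split_ifs <;> norm_num
  have hφ' : ∀ x y, φ' x = φ' y → φ x = φ y ∧ (x ∈ S ↔ y ∈ S) ∧ (x ∈ T ↔ y ∈ T) := by
    intro x y e
    simp only [φ'] at e
    by_cases h1 : x ∈ S <;> by_cases h2 : x ∈ T <;> by_cases h3 : y ∈ S <;> by_cases h4 : y ∈ T <;>
      simp only [h1, h2, h3, h4, if_true, if_false] at e <;>
      first
      | (exfalso; omega)
      | exact ⟨by omega, by simp [*], by simp [*]⟩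
  have hfin : Finer φ' φ := fun x y e => (hφ' x y e).1
  refine ⟨φ', fun x => ?_, hfin, ?_⟩
  · have := hb x; have := hφ x
    simp only [φ']; omega
  set k : V × V → ℝ := fun q => if q ∈ S ×ˢ T then c q else 0 with hk
  have hk1 : ∀ q, |k q| ≤ 1 := by
    intro q; simp only [hk]; split_ifs
    · exact hc1 q
    · simp
  have hkm : ∀ q q', pairLabel φ' q = pairLabel φ' q' → k q = k q' := by
    intro q q' e
    have e2 := hc q q' (finer_pairLabel hfin q q' e)
    simp only [pairLabel, Prod.mk.injEq] at e
    have a1 := hφ' _ _ e.1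
    have a2 := hφ' _ _ e.2
    simp only [hk, Finset.mem_product, a1.2.1, a2.2.2, e2]
  have e1 : ∑ q ∈ S ×ˢ T, c q * (f q - fiberAvg (pairLabel φ) f q)
      = ∑ q, k q * (fiberAvg (pairLabel φ') f q - fiberAvg (pairLabel φ) f q) := by
    have h1 : ∑ q ∈ S ×ˢ T, c q * (f q - fiberAvg (pairLabel φ) f q)
        = ∑ q, (f q * k q - fiberAvg (pairLabel φ) f q * k q) := by
      refine (Finset.sum_congr rfl fun q hq => ?_).trans
        (Finset.sum_subset (Finset.subset_univ (S ×ˢ T)) fun q _ hq => ?_)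
      · simp only [hk, if_pos hq]; ring
      · simp only [hk, if_neg hq]; ring
    rw [h1, Finset.sum_sub_distrib, ← sum_fiberAvg_mul (pairLabel φ') f k hkm,
      ← Finset.sum_sub_distrib]
    exact Finset.sum_congr rfl fun q _ => by ring
  rw [e1] at hlt
  have hcs := Finset.sum_mul_sq_le_sq_mul_sq univ k
    (fun q => fiberAvg (pairLabel φ') f q - fiberAvg (pairLabel φ) f q)
  rw [sum_sq_fiberAvg_sub (finer_pairLabel hfin)] at hcs
  have hk2 : ∑ q, k q ^ 2 ≤ (Fintype.card V : ℝ) ^ 2 := by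
    calc _ ≤ ∑ q : V × V, (1 : ℝ) :=
          Finset.sum_le_sum fun q _ => (sq_le_one_iff_abs_le_one _).2 (hk1 q)
      _ = _ := by simp [sq]
  have hn : (0 : ℝ) < Fintype.card V := by exact_mod_cast Fintype.card_pos
  have hpos : 0 ≤ ∑ q, fiberAvg (pairLabel φ') f q ^ 2 - ∑ q, fiberAvg (pairLabel φ) f q ^ 2 := by
    rw [← sum_sq_fiberAvg_sub (finer_pairLabel hfin)]
    exact Finset.sum_nonneg fun _ _ => sq_nonneg _
  have h3 : (η * (Fintype.card V : ℝ) ^ 2) ^ 2 ≤ (Fintype.card V : ℝ) ^ 2 *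
      (∑ q, fiberAvg (pairLabel φ') f q ^ 2 - ∑ q, fiberAvg (pairLabel φ) f q ^ 2) := by
    calc _ ≤ |∑ q, k q * (fiberAvg (pairLabel φ') f q - fiberAvg (pairLabel φ) f q)| ^ 2 :=
          pow_le_pow_left₀ (by positivity) hlt.le 2
      _ = (∑ q, k q * (fiberAvg (pairLabel φ') f q - fiberAvg (pairLabel φ) f q)) ^ 2 := sq_abs _
      _ ≤ _ := hcs
      _ ≤ _ := mul_le_mul_of_nonneg_right hk2 hpos
  have h4 : (Fintype.card V : ℝ) ^ 2 * (η ^ 2 * (Fintype.card V : ℝ) ^ 2) ≤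
      (Fintype.card V : ℝ) ^ 2 *
      (∑ q, fiberAvg (pairLabel φ') f q ^ 2 - ∑ q, fiberAvg (pairLabel φ) f q ^ 2) := by
    refine le_trans (le_of_eq ?_) h3; ring
  have := le_of_mul_le_mul_left h4 (by positivity)
  linarith

/-- The energy never exceeds n², so T + 1 increments of η²n² are impossible. -/
theorem exists_weakRegular [Nonempty V] {ψ : V → ℕ} {L : ℕ} (hψ : ∀ x, ψ x < L)
    {f : V × V → ℝ} (hf0 : ∀ q, 0 ≤ f q) (hf1 : ∀ q, f q ≤ 1) {η : ℝ} (hη : 0 < η) {T : ℕ}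
    (hT : 1 ≤ T * η ^ 2) :
    ∃ φ : V → ℕ, (∀ x, φ x < L * 4 ^ T) ∧ Finer φ ψ ∧ WeakRegular φ f η := by
  by_contra H
  push Not at H
  have key : ∀ j ≤ T + 1, ∃ φ : V → ℕ, (∀ x, φ x < L * 4 ^ j) ∧ Finer φ ψ ∧
      j * (η ^ 2 * (Fintype.card V : ℝ) ^ 2) ≤ ∑ q, fiberAvg (pairLabel φ) f q ^ 2 := by
    intro j
    induction j with
    | zero =>
      intro _
      exact ⟨ψ, by simpa using hψ, fun _ _ e => e, by
        simpa using Finset.sum_nonneg fun _ _ => sq_nonneg _⟩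
    | succ j ih =>
      intro hj
      obtain ⟨φ, h1, h2, h3⟩ := ih (by omega)
      have h4 : ∀ x, φ x < L * 4 ^ T := fun x => (h1 x).trans_le
        (Nat.mul_le_mul_left _ (Nat.pow_le_pow_right (by norm_num) (by omega)))
      obtain ⟨φ', g1, g2, g3⟩ := exists_energy_increment h1 hη (H φ h4 h2)
      refine ⟨φ', fun x => ?_, fun x y e => h2 _ _ (g2 _ _ e), ?_⟩
      · rw [pow_succ, ← mul_assoc]; exact g1 x
      · push_cast; linarith
  obtain ⟨φ, -, -, h⟩ := key (T + 1) le_rfl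
  have hn : (0 : ℝ) < Fintype.card V := by exact_mod_cast Fintype.card_pos
  have h2 : ∑ q, fiberAvg (pairLabel φ) f q ^ 2 ≤ (Fintype.card V : ℝ) ^ 2 := by
    calc _ ≤ ∑ q : V × V, (1 : ℝ) := Finset.sum_le_sum fun q _ =>
          pow_le_one₀ (fiberAvg_nonneg _ hf0 q) (fiberAvg_le_one _ hf1 q)
      _ = _ := by simp [sq]
  push_cast at h
  have h3 : 0 < η ^ 2 * (Fintype.card V : ℝ) ^ 2 := by positivity
  have h4 := mul_le_mul_of_nonneg_right hT (sq_nonneg (Fintype.card V : ℝ))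
  nlinarith

end WeakRegularity

/-! ### Replacing a labelling by an equipartition. -/

section Equitable

variable {V : Type} [Fintype V] [DecidableEq V]

theorem exists_label_part (P : Finpartition (univ : Finset V)) :
    ∃ ψ : V → ℕ, (∀ x, ψ x < #P.parts) ∧ ∀ x y, ψ x = ψ y ↔ P.part x = P.part y := by
  refine ⟨fun x => P.parts.equivFin ⟨P.part x, P.part_mem.2 (mem_univ x)⟩, fun x => Fin.is_lt _,
    fun x y => ?_⟩
  rw [← Fin.ext_iff, P.parts.equivFin.apply_eq_iff_eq, Subtype.mk.injEq]

theorem finer_part_of_le {P P₀ : Finpartition (univ : Finset V)} (h : P ≤ P₀) :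
    Finer P.part P₀.part := by
  intro x y e
  obtain ⟨A, hA, hPA⟩ := h (P.part_mem.2 (mem_univ x))
  have hx : x ∈ A := hPA (P.mem_part_self.2 (mem_univ x))
  have hy : y ∈ A := hPA (by rw [e]; exact P.mem_part_self.2 (mem_univ y))
  rw [P₀.part_eq_of_mem hA hx, P₀.part_eq_of_mem hA hy]

/-- Each part of P₀ is cut into exactly r pieces of size m or m+1, as far as possible inside the
classes of φ. A class leaves at most m vertices in mixed pieces, which gives the last bound. -/
theorem exists_equitable_refinement [Nonempty V] (P₀ : Finpartition (univ : Finset V))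
    (hP₀ : P₀.IsEquipartition) {φ : V → ℕ} {L : ℕ} (hφ : ∀ x, φ x < L) {r : ℕ} (hr : 0 < r)
    (hrn : r * #P₀.parts ≤ Fintype.card V) :
    ∃ P : Finpartition (univ : Finset V), P.IsEquipartition ∧ P ≤ P₀ ∧
      #P.parts = #P₀.parts * r ∧
      #{x | ∃ x' ∈ P.part x, φ x' ≠ φ x} * r ≤ L * Fintype.card V := by
  classical
  have hk : 0 < #P₀.parts := Finset.card_pos.2 (P₀.parts_nonempty Finset.univ_nonempty.ne_empty)
  set M := Fintype.card V / #P₀.parts with hM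
  set m := M / r with hm
  have hrM : r ≤ M := (Nat.le_div_iff_mul_le hk).2 hrn
  have hm0 : m ≠ 0 := (Nat.div_pos hrM hr).ne'
  have hmr : m * r ≤ M := Nat.div_mul_le_self M r
  have hmr2 : M < m * r + r := by
    have := Nat.lt_div_mul_add hr (a := M); simpa [hm] using this
  -- Since #A ≤ M + 1 ≤ m * r + r, the excess #A - m * r is at most r. The same m thus serves every
  -- part, and the pieces together form an equipartition.
  have hcard : ∀ A ∈ P₀.parts, (r - (#A - m * r)) * m + (#A - m * r) * (m + 1) = #A := by
    intro A hA
    have h1 := hP₀.average_le_card_part hA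
    have h2 := hP₀.card_part_le_average_add_one hA
    rw [Finset.card_univ, ← hM] at h1 h2
    obtain ⟨b, hb⟩ : ∃ b, #A = m * r + b := ⟨#A - m * r, by omega⟩
    obtain ⟨a, ha⟩ : ∃ a, r = a + b := ⟨r - b, by omega⟩
    have e1 : #A - m * r = b := by omega
    have e2 : r - b = a := by omega
    rw [e1, e2, hb, ha]; ring
  let R : ∀ A : Finset V, Finpartition A := fun A => Finpartition.ofSetSetoid (Setoid.ker φ) A
  have hR1 : ∀ A, #(R A).parts ≤ L := by
    intro A
    have : (R A).parts ⊆ (Finset.range L).image fun i => {b ∈ A | i = φ b} := by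
      intro u hu
      simp only [R, Finpartition.ofSetSetoid, Finset.mem_image] at hu
      obtain ⟨a, -, rfl⟩ := hu
      exact Finset.mem_image.2 ⟨φ a, Finset.mem_range.2 (hφ a),
        Finset.filter_congr fun b _ => Iff.rfl⟩
    exact (Finset.card_le_card this).trans (Finset.card_image_le.trans (by simp))
  have hR2 : ∀ A, ∀ u ∈ (R A).parts, ∀ x ∈ u, ∀ y ∈ u, φ x = φ y := by
    intro A u hu x hx y hy
    simp only [R, Finpartition.ofSetSetoid, Finset.mem_image] at hu
    obtain ⟨a, -, rfl⟩ := hu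
    exact ((Finset.mem_filter.1 hx).2.symm.trans (Finset.mem_filter.1 hy).2 : φ x = φ y)
  let Q : ∀ A ∈ P₀.parts, Finpartition A := fun A hA => (R A).equitabilise (hcard A hA)
  refine ⟨P₀.bind Q, ?_, ?_, ?_, ?_⟩
  · refine Set.equitableOn_iff_exists_eq_eq_add_one.2 ⟨m, fun t ht => ?_⟩
    obtain ⟨A, hA, htA⟩ := Finpartition.mem_bind.1 ht
    exact Finpartition.card_eq_of_mem_parts_equitabilise htA
  · intro t ht
    obtain ⟨A, hA, htA⟩ := Finpartition.mem_bind.1 ht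
    exact ⟨A, hA, (Q A hA).le htA⟩
  · rw [Finpartition.card_bind]
    calc _ = ∑ A ∈ P₀.parts.attach, r := by
          refine Finset.sum_congr rfl fun A _ => ?_
          rw [Finpartition.card_parts_equitabilise _ _ hm0]
          have h1 := hP₀.average_le_card_part A.2
          have h2 := hP₀.card_part_le_average_add_one A.2
          rw [Finset.card_univ, ← hM] at h1 h2
          omega
      _ = _ := by simp
  · have hsub : ({x | ∃ x' ∈ (P₀.bind Q).part x, φ x' ≠ φ x} : Finset V) ⊆
        P₀.parts.attach.biUnion fun A => (R A.1).parts.biUnion fun u =>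
          u \ ({y ∈ (Q A.1 A.2).parts | y ⊆ u}.biUnion id) := by
      intro x hx
      obtain ⟨x', hx', hne⟩ := (Finset.mem_filter.1 hx).2
      obtain ⟨A, hA, hxA⟩ := P₀.exists_mem (mem_univ x)
      obtain ⟨u, hu, hxu⟩ := (R A).exists_mem hxA
      refine Finset.mem_biUnion.2 ⟨⟨A, hA⟩, Finset.mem_attach _ _, Finset.mem_biUnion.2 ⟨u, hu, ?_⟩⟩
      refine Finset.mem_sdiff.2 ⟨hxu, fun hc => ?_⟩
      obtain ⟨t, ht, hxt⟩ := Finset.mem_biUnion.1 hc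
      obtain ⟨htQ, htu⟩ := Finset.mem_filter.1 ht
      have htP : t ∈ (P₀.bind Q).parts := Finpartition.mem_bind.2 ⟨A, hA, htQ⟩
      rw [Finpartition.part_eq_of_mem _ htP hxt] at hx'
      exact hne (hR2 A u hu _ (htu hx') _ hxu)
    have h1 : #{x | ∃ x' ∈ (P₀.bind Q).part x, φ x' ≠ φ x} ≤ #P₀.parts * (L * m) := by
      refine (Finset.card_le_card hsub).trans ?_
      refine (Finset.card_biUnion_le_card_mul _ _ (L * m) fun A _ => ?_).trans
        (by rw [Finset.card_attach])
      refine (Finset.card_biUnion_le_card_mul _ _ m fun u hu => ?_).trans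
        (Nat.mul_le_mul_right _ (hR1 A))
      exact Finpartition.card_parts_equitabilise_subset_le _ _ hu
    calc _ ≤ #P₀.parts * (L * m) * r := Nat.mul_le_mul_right _ h1
      _ = L * (m * r * #P₀.parts) := by ring
      _ ≤ L * (M * #P₀.parts) := Nat.mul_le_mul_left _ (Nat.mul_le_mul_right _ hmr)
      _ ≤ _ := Nat.mul_le_mul_left _ (Nat.div_mul_le_self _ _)

end Equitable

/-! ### Making a partition regular by few edits. -/

section Modification

theorem fiberAvg_equiv {Ω ι : Type*} [Fintype Ω] [DecidableEq ι] {Φ : Ω → ι} {f : Ω → ℝ}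
    (σ : Ω ≃ Ω) (hΦ : ∀ ω ω', Φ (σ ω) = Φ (σ ω') ↔ Φ ω = Φ ω') (hf : ∀ ω, f (σ ω) = f ω) (ω : Ω) :
    fiberAvg Φ f (σ ω) = fiberAvg Φ f ω := by
  unfold fiberAvg
  have h1 : ∀ g : Ω → ℝ, (∀ ω, g (σ ω) = g ω) →
      ∑ ω' with Φ ω' = Φ (σ ω), g ω' = ∑ ω' with Φ ω' = Φ ω, g ω' := fun g hg => by
    symm
    refine Finset.sum_equiv σ (fun ω' => ?_) fun ω' _ => (hg ω').symm
    simp [hΦ]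
  have h2 := h1 (fun _ => 1) fun _ => rfl
  simp only [Finset.sum_const, nsmul_eq_mul, mul_one] at h2
  rw [h1 f hf, h2]

/-- The proportion of non-edges to be added in order to raise a density `q` to `π`. -/
noncomputable def rise (q π : ℝ) : ℝ := if q < π then (π - q) / (1 - q) else 0

/-- The proportion of edges to be removed in order to lower a density `q` to `π`. -/
noncomputable def fall (q π : ℝ) : ℝ := if q < π then 0 else 1 - π / q

theorem rise_nonneg {q π : ℝ} (hπ1 : π ≤ 1) : 0 ≤ rise q π := by
  unfold rise; split_ifs with h
  · exact div_nonneg (by linarith) (by linarith)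
  · exact le_rfl

theorem fall_nonneg {q π : ℝ} (hπ : 0 ≤ π) : 0 ≤ fall q π := by
  unfold fall; split_ifs with h
  · exact le_rfl
  · have := div_le_one_of_le₀ (not_lt.1 h) (hπ.trans (not_lt.1 h)); linarith

theorem rise_add_fall_le_one {q π : ℝ} (hq : 0 ≤ q) (hπ : 0 ≤ π) (hπ1 : π ≤ 1) :
    rise q π + fall q π ≤ 1 := by
  unfold rise fall; split_ifs with h
  · rw [add_zero]; exact div_le_one_of_le₀ (by linarith) (by linarith)
  · have := div_nonneg hπ hq; linarith

theorem mul_rise_sub_mul_fall {q π : ℝ} (hπ : 0 ≤ π) (hπ1 : π ≤ 1) :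
    (1 - q) * rise q π - q * fall q π = π - q := by
  unfold rise fall; split_ifs with h
  · have : 1 - q ≠ 0 := by linarith
    field_simp; ring
  · rcases eq_or_ne q 0 with rfl | h0
    · have : π = 0 := le_antisymm (not_lt.1 h) hπ
      simp [this]
    · field_simp; ring

theorem mul_rise_add_mul_fall {q π : ℝ} (hπ : 0 ≤ π) (hπ1 : π ≤ 1) :
    (1 - q) * rise q π + q * fall q π = |q - π| := by
  have h1 := mul_rise_sub_mul_fall (q := q) hπ hπ1
  rcases lt_or_ge q π with h | h
  · have h2 : fall q π = 0 := if_pos h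
    rw [h2] at h1 ⊢
    rw [abs_of_neg (by linarith)]; linarith
  · have h2 : rise q π = 0 := if_neg (not_lt.2 h)
    rw [h2] at h1 ⊢
    rw [abs_of_nonneg (by linarith)]; linarith

variable {V : Type}

theorem adj_eq_zero_or_one (G : SimpleGraph V) (x y : V) : adj G x y = 0 ∨ adj G x y = 1 := by
  unfold adj; split_ifs <;> simp

/-- The adjacency indicator as a function of pairs. -/
noncomputable def adjPair (G : SimpleGraph V) (q : V × V) : ℝ := adj G q.1 q.2

variable [Fintype V]

theorem fiberAvg_pairLabel_swap {ι : Type*} [DecidableEq ι] (φ : V → ι) {f : V × V → ℝ}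
    (hf : ∀ x y, f (x, y) = f (y, x)) (x y : V) :
    fiberAvg (pairLabel φ) f (x, y) = fiberAvg (pairLabel φ) f (y, x) :=
  fiberAvg_equiv (Equiv.prodComm V V) (fun q q' => by simp [pairLabel, and_comm])
    (fun q => hf q.2 q.1) (y, x)

variable [DecidableEq V]

theorem log_card_tests_le (n : ℕ) (hn : 1 ≤ n) :
    Real.log ((2 ^ n * (2 ^ n * 2) + 1 : ℕ) : ℝ) ≤ 4 * n := by
  have h0 : 2 ^ n * (2 ^ n * 2) + 1 ≤ 16 ^ n := by
    have h1 : 4 ≤ 4 ^ n := by simpa using Nat.pow_le_pow_right (n := 4) (by norm_num) hn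
    have h2 : 2 ^ n * (2 ^ n * 2) = 2 * 4 ^ n := by
      rw [← mul_assoc, ← mul_pow]; ring
    have h3 : 16 ^ n = 4 ^ n * 4 ^ n := by rw [← mul_pow]; norm_num
    rw [h2, h3]; nlinarith
  -- The number counts the rounding tests: a set S, a set T and a sign, plus one test for the edit
  -- distance.
  have h1 : ((2 ^ n * (2 ^ n * 2) + 1 : ℕ) : ℝ) ≤ Real.exp 4 ^ n := by
    calc _ ≤ ((16 ^ n : ℕ) : ℝ) := by exact_mod_cast h0
      _ = (16 : ℝ) ^ n := by push_cast; rfl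
      _ ≤ _ := by
        apply pow_le_pow_left₀ (by norm_num)
        have h2 : (2 : ℝ) ≤ Real.exp 1 := by
          have := Real.add_one_le_exp 1; linarith
        calc (16 : ℝ) = 2 ^ 4 := by norm_num
          _ ≤ Real.exp 1 ^ 4 := pow_le_pow_left₀ (by norm_num) h2 4
          _ = Real.exp 4 := by rw [← Real.exp_nat_mul]; norm_num
  rw [← Real.exp_nat_mul] at h1
  have := Real.log_le_log (by positivity) h1
  rw [Real.log_exp] at this
  linarith

theorem card_part_mul_ge {P : Finpartition (univ : Finset V)} (hP : P.IsEquipartition)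
    (hK : 2 * #P.parts ≤ Fintype.card V) {A : Finset V} (hA : A ∈ P.parts) :
    (Fintype.card V : ℝ) ≤ 2 * #P.parts * #A := by
  have h1 := hP.average_le_card_part hA
  rw [Finset.card_univ] at h1
  have hk : 0 < #P.parts := Finset.card_pos.2 ⟨A, hA⟩
  have h2 : 1 ≤ Fintype.card V / #P.parts := (Nat.le_div_iff_mul_le hk).2 (by omega)
  have h3 := Nat.lt_div_mul_add hk (a := Fintype.card V)
  have : Fintype.card V ≤ 2 * #P.parts * #A := by
    calc _ ≤ Fintype.card V / #P.parts * #P.parts + #P.parts := h3.le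
      _ ≤ 2 * #P.parts * (Fintype.card V / #P.parts) := by nlinarith
      _ ≤ _ := Nat.mul_le_mul_left _ h1
  exact_mod_cast this

/-- Parts have at least n/(2k) vertices, where k is the order of P, so on sub-pairs of relative size
ε an error 3ηn² changes the density by at most 12ηk²/ε² ≤ ε/2. The three units of η come from
rounding, the diagonal and weak regularity. -/
theorem isRegularPair_of_sum_close {G : SimpleGraph V} {P : Finpartition (univ : Finset V)}
    (hP : P.IsEquipartition) (hK : 2 * #P.parts ≤ Fintype.card V) {A B : Finset V}
    (hA : A ∈ P.parts) (hB : B ∈ P.parts) {ε η π : ℝ} (hε : 0 < ε) (hε1 : ε ≤ 1)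
    (hη : 24 * η * (#P.parts : ℝ) ^ 2 ≤ ε ^ 3)
    (h : ∀ S ⊆ A, ∀ T ⊆ B, |∑ x ∈ S, ∑ y ∈ T, (adj G x y - π)| ≤
      3 * η * (Fintype.card V : ℝ) ^ 2) : IsRegularPair G ε A B := by
  classical
  have hA0 : (0 : ℝ) < #A := by exact_mod_cast Finset.card_pos.2 (P.nonempty_of_mem_parts hA)
  have hB0 : (0 : ℝ) < #B := by exact_mod_cast Finset.card_pos.2 (P.nonempty_of_mem_parts hB)
  have hAn := card_part_mul_ge hP hK hA
  have hBn := card_part_mul_ge hP hK hB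
  have key : ∀ S ⊆ A, ∀ T ⊆ B, ε * (#A : ℝ) ≤ #S → ε * (#B : ℝ) ≤ #T →
      |(G.edgeDensity S T : ℝ) - π| ≤ ε / 2 := by
    intro S hS T hT hcS hcT
    have hS0 : (0 : ℝ) < #S := (mul_pos hε hA0).trans_le hcS
    have hT0 : (0 : ℝ) < #T := (mul_pos hε hB0).trans_le hcT
    have e1 : (G.edgeDensity S T : ℝ) - π = (∑ x ∈ S, ∑ y ∈ T, (adj G x y - π)) / (#S * #T) := by
      rw [edgeDensity_eq_sum]
      simp only [Finset.sum_sub_distrib, Finset.sum_const, nsmul_eq_mul]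
      field_simp
    rw [e1, abs_div, abs_of_pos (mul_pos hS0 hT0), div_le_iff₀ (mul_pos hS0 hT0)]
    refine (h S hS T hT).trans ?_
    have hn2 : (Fintype.card V : ℝ) ^ 2 ≤ 4 * (#P.parts : ℝ) ^ 2 * (#A * #B) := by
      calc _ = (Fintype.card V : ℝ) * (Fintype.card V : ℝ) := sq _
        _ ≤ (2 * #P.parts * #A) * (2 * #P.parts * #B) :=
          mul_le_mul hAn hBn (Nat.cast_nonneg _) (by positivity)
        _ = _ := by ring
    have hη0 : 0 ≤ η := by
      have := (abs_nonneg _).trans (h ∅ (Finset.empty_subset _) ∅ (Finset.empty_subset _))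
      by_contra hc
      have hn0 : (0 : ℝ) < (Fintype.card V : ℝ) ^ 2 := by
        have : 0 < Fintype.card V := by
          have := Finset.card_pos.2 ⟨A, hA⟩; omega
        positivity
      nlinarith
    have hST : ε ^ 2 * (#A * #B) ≤ #S * #T := by
      calc _ = (ε * #A) * (ε * #B) := by ring
        _ ≤ _ := mul_le_mul hcS hcT (by positivity) hS0.le
    calc 3 * η * (Fintype.card V : ℝ) ^ 2
        ≤ 3 * η * (4 * (#P.parts : ℝ) ^ 2 * (#A * #B)) :=
          mul_le_mul_of_nonneg_left hn2 (by positivity)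
      _ = (24 * η * (#P.parts : ℝ) ^ 2) / 2 * (#A * #B) := by ring
      _ ≤ ε ^ 3 / 2 * (#A * #B) := by gcongr
      _ = ε / 2 * (ε ^ 2 * (#A * #B)) := by ring
      _ ≤ _ := mul_le_mul_of_nonneg_left hST (by positivity)
  intro A' hA' B' hB' hcA hcB
  have k1 := abs_le.1 (key A' hA' B' hB' hcA hcB)
  have k2 := abs_le.1 (key A Finset.Subset.rfl B Finset.Subset.rfl
    (mul_le_of_le_one_left hA0.le hε1) (mul_le_of_le_one_left hB0.le hε1))
  rw [abs_le]
  constructor <;> linarith [k1.1, k1.2, k2.1, k2.2]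

/-- Thinning or filling each block of φ by a fixed proportion shifts its density to that of P and
scales the deviation of the graph from its block average by a factor in [0, 1]. Weak regularity with
block-constant multipliers therefore survives and becomes regularity of P. -/
theorem exists_regular_modification [Nonempty V] (G : SimpleGraph V)
    {P : Finpartition (univ : Finset V)} (hP : P.IsEquipartition)
    (hK : 2 * #P.parts ≤ Fintype.card V) {φ : V → ℕ} (hφ : Finer φ P.part) {ε δ η : ℝ}
    (hε : 0 < ε) (hε1 : ε ≤ 1) (hη : 0 < η) (hη1 : η ≤ 1)
    (hηK : 24 * η * (#P.parts : ℝ) ^ 2 ≤ ε ^ 3)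
    (hηn : 64 ≤ η ^ 2 * Fintype.card V)
    (hηδ : 4 * η * (Fintype.card V : ℝ) ^ 2 ≤ δ * ∑ q, adjPair G q)
    (hw : WeakRegular φ (adjPair G) η)
    (hclose : ∑ q, |fiberAvg (pairLabel φ) (adjPair G) q
      - fiberAvg (pairLabel P.part) (adjPair G) q| ≤ δ / 2 * ∑ q, adjPair G q) :
    ∃ G' : SimpleGraph V, IsClose δ G G' ∧
      ∀ A ∈ P.parts, ∀ B ∈ P.parts, IsRegularPair G' ε A B := by
  set n : ℝ := (Fintype.card V : ℝ) with hn
  have hn0 : 0 < n := by rw [hn]; exact_mod_cast Fintype.card_pos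
  set f := adjPair G with hf
  have hf0 : ∀ q, 0 ≤ f q := fun q => adj_nonneg _ _ _
  have hf1 : ∀ q, f q ≤ 1 := fun q => adj_le_one _ _ _
  have hf01 : ∀ q, f q = 0 ∨ f q = 1 := fun q => adj_eq_zero_or_one _ _ _
  have hfs : ∀ x y, f (x, y) = f (y, x) := fun x y => adj_comm _ _ _
  set u := fiberAvg (pairLabel φ) f with hu
  set π := fiberAvg (pairLabel P.part) f with hπ
  have hu0 : ∀ q, 0 ≤ u q := fun q => fiberAvg_nonneg _ hf0 q
  have hπ0 : ∀ q, 0 ≤ π q := fun q => fiberAvg_nonneg _ hf0 q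
  have hπ1 : ∀ q, π q ≤ 1 := fun q => fiberAvg_le_one _ hf1 q
  set a : V × V → ℝ := fun q => rise (u q) (π q) with ha
  set b : V × V → ℝ := fun q => fall (u q) (π q) with hb
  have ha0 : ∀ q, 0 ≤ a q := fun q => rise_nonneg (hπ1 q)
  have hb0 : ∀ q, 0 ≤ b q := fun q => fall_nonneg (hπ0 q)
  have hab : ∀ q, a q + b q ≤ 1 := fun q => rise_add_fall_le_one (hu0 q) (hπ0 q) (hπ1 q)
  have hblock : ∀ q q', pairLabel φ q = pairLabel φ q' → u q = u q' ∧ π q = π q' := fun q q' e =>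
    ⟨fiberAvg_congr _ _ e, fiberAvg_congr _ _ (finer_pairLabel hφ _ _ e)⟩
  have hba : ∀ q q', pairLabel φ q = pairLabel φ q' → a q = a q' := fun q q' e => by
    simp only [ha, (hblock q q' e).1, (hblock q q' e).2]
  have hbb : ∀ q q', pairLabel φ q = pairLabel φ q' → b q = b q' := fun q q' e => by
    simp only [hb, (hblock q q' e).1, (hblock q q' e).2]
  set w₀ : V × V → ℝ := fun q => f q + (1 - f q) * a q - f q * b q with hw₀
  have hw₀0 : ∀ q, 0 ≤ w₀ q := fun q => by
    simp only [hw₀]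
    rcases hf01 q with h | h <;> rw [h] <;> linarith [ha0 q, hb0 q, hab q]
  have hw₀1 : ∀ q, w₀ q ≤ 1 := fun q => by
    simp only [hw₀]
    rcases hf01 q with h | h <;> rw [h] <;> linarith [ha0 q, hb0 q, hab q]
  -- Here `a` is the chance that a non-edge is added and `b` the chance that an edge is deleted; at
  -- most one of them is nonzero.
  have hw₀f : ∀ q, |w₀ q - f q| = (1 - f q) * a q + f q * b q := fun q => by
    simp only [hw₀]
    rcases hf01 q with h | h
    · rw [h, abs_of_nonneg] <;> linarith [ha0 q]
    · rw [h, abs_of_nonpos] <;> linarith [hb0 q]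
  have hw₀π : ∀ q, w₀ q - π q = (1 - a q - b q) * (f q - u q) := fun q => by
    have := mul_rise_sub_mul_fall (q := u q) (hπ0 q) (hπ1 q)
    simp only [hw₀]
    simp only [ha, hb]
    linear_combination this
  have hws : ∀ x y, w₀ (x, y) = w₀ (y, x) := fun x y => by
    have e1 : u (x, y) = u (y, x) := fiberAvg_pairLabel_swap φ hfs x y
    have e2 : π (x, y) = π (y, x) := fiberAvg_pairLabel_swap P.part hfs x y
    simp only [hw₀, ha, hb, e1, e2, hfs x y]
  have hl1sum : ∑ q, |w₀ q - f q| ≤ δ / 2 * ∑ q, f q := by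
    refine le_trans (le_of_eq ?_) hclose
    have e1 : ∑ q, |w₀ q - f q| = ∑ q, a q - ∑ q, f q * a q + ∑ q, f q * b q := by
      rw [← Finset.sum_sub_distrib, ← Finset.sum_add_distrib]
      exact Finset.sum_congr rfl fun q _ => by rw [hw₀f]; ring
    rw [e1, ← sum_fiberAvg_mul (pairLabel φ) f a hba, ← sum_fiberAvg_mul (pairLabel φ) f b hbb,
      ← Finset.sum_sub_distrib, ← Finset.sum_add_distrib]
    refine Finset.sum_congr rfl fun q _ => ?_
    rw [← mul_rise_add_mul_fall (q := u q) (hπ0 q) (hπ1 q)]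
    simp only [ha, hb, hu]; ring
  let w : V → V → ℝ := fun x y => if x = y then 0 else w₀ (x, y)
  -- Since f is 0 or 1, the kernel 1 - 2f turns |g - f| into the linear expression (1 - 2f)(g - f)
  -- for g in [0, 1], so one test controls the edit distance. The other tests control all
  -- rectangles, with both signs.
  let k : Option (Finset V × Finset V × Bool) → V → V → ℝ := fun i x y =>
    i.elim (1 - 2 * f (x, y)) fun t =>
      if x ∈ t.1 ∧ y ∈ t.2.1 then (if t.2.2 then 1 else -1) else 0
  obtain ⟨G', hG'⟩ := exists_graph_rounding w
    (fun x y => by simp only [w, eq_comm (a := x), hws x y])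
    (fun x y => by simp only [w]; split_ifs; exacts [le_rfl, hw₀0 _])
    (fun x y => by simp only [w]; split_ifs; exacts [zero_le_one, hw₀1 _])
    (fun x => by simp [w]) k
    (fun i x y => by
      cases i with
      | none =>
        simp only [k, Option.elim]
        rcases hf01 (x, y) with h | h <;> rw [h] <;> norm_num
      | some t =>
        simp only [k, Option.elim]; split_ifs <;> norm_num)
    (l := η / 4) (by positivity) (by linarith)
  -- With l = η/4 the bound is at most 32n/η + ηn²/2, and `hηn` makes the first term at most ηn²/2.
  have hdev : 2 * ((Real.log (Fintype.card (Option (Finset V × Finset V × Bool)))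
      + (η / 4) ^ 2 * (Fintype.card V : ℝ) ^ 2) / (η / 4)) ≤ η * n ^ 2 := by
    have h1 : Real.log (Fintype.card (Option (Finset V × Finset V × Bool))) ≤ 4 * n := by
      simp only [Fintype.card_option, Fintype.card_prod, Fintype.card_finset, Fintype.card_bool]
      exact log_card_tests_le _ Fintype.card_pos
    rw [← hn, ← mul_div_assoc, div_le_iff₀ (by positivity)]
    have h2 : 64 * n ≤ η ^ 2 * n * n := mul_le_mul_of_nonneg_right hηn hn0.le
    nlinarith
  refine ⟨G', ?_, fun A hA B hB => ?_⟩
  · have h1 := (hG' none).trans hdev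
    have e1 : ∑ x, ∑ y, |adj G' x y - adj G x y|
        ≤ ∑ x, ∑ y, k none x y * (adj G' x y - w x y) + ∑ x, ∑ y, |w₀ (x, y) - f (x, y)| := by
      rw [← Finset.sum_add_distrib]
      refine Finset.sum_le_sum fun x _ => ?_
      rw [← Finset.sum_add_distrib]
      refine Finset.sum_le_sum fun y _ => ?_
      have h2 : |w x y - f (x, y)| ≤ |w₀ (x, y) - f (x, y)| := by
        by_cases hxy : x = y
        · subst hxy
          have : f (x, x) = 0 := adj_self _ _
          simp only [w, if_true, this, sub_zero, abs_zero]
          exact abs_nonneg _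
        · simp [w, hxy]
      have h3 := abs_le.1 h2
      simp only [k, Option.elim]
      change |adj G' x y - f (x, y)| ≤ _
      rcases hf01 (x, y) with h | h <;> rw [h] at h3 ⊢
      · rw [sub_zero, abs_of_nonneg (adj_nonneg _ _ _)]; linarith [h3.1, h3.2]
      · rw [abs_of_nonpos (by linarith [adj_le_one G' x y])]; linarith [h3.1, h3.2]
    rw [Fintype.sum_prod_type] at hl1sum
    have e2 : ∑ q, f q = 2 * (G.edgeSet.ncard : ℝ) := by
      rw [two_mul_ncard_edgeSet, Fintype.sum_prod_type]; rfl
    rw [← two_mul_ncard_symmDiff] at e1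
    rw [e2] at hl1sum hηδ
    unfold IsClose
    nlinarith
  · obtain ⟨x₀, hx₀⟩ := P.nonempty_of_mem_parts hA
    obtain ⟨y₀, hy₀⟩ := P.nonempty_of_mem_parts hB
    refine isRegularPair_of_sum_close (π := π (x₀, y₀)) hP hK hA hB hε hε1 hηK ?_
    intro S hS T hT
    have hconst : ∀ x ∈ S, ∀ y ∈ T, π (x, y) = π (x₀, y₀) := by
      intro x hx y hy
      apply fiberAvg_congr
      simp only [pairLabel, P.part_eq_of_mem hA (hS hx), P.part_eq_of_mem hB (hT hy),
        P.part_eq_of_mem hA hx₀, P.part_eq_of_mem hB hy₀]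
    have e1 : ∑ x ∈ S, ∑ y ∈ T, (adj G' x y - π (x₀, y₀))
        = ∑ x ∈ S, ∑ y ∈ T, (adj G' x y - w x y) + (∑ x ∈ S, ∑ y ∈ T, (w x y - w₀ (x, y))
          + ∑ x ∈ S, ∑ y ∈ T, (w₀ (x, y) - π (x, y))) := by
      simp only [← Finset.sum_add_distrib]
      refine Finset.sum_congr rfl fun x hx => Finset.sum_congr rfl fun y hy => ?_
      rw [hconst x hx y hy]; ring
    have hsum : ∀ F : V → V → ℝ, ∑ x, ∑ y, (if x ∈ S ∧ y ∈ T then F x y else 0)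
        = ∑ x ∈ S, ∑ y ∈ T, F x y := by
      intro F
      simp only [ite_and]
      have : ∀ x, ∑ y, (if x ∈ S then if y ∈ T then F x y else 0 else 0)
          = if x ∈ S then ∑ y ∈ T, F x y else 0 := by
        intro x
        split_ifs
        · simp
        · simp
      simp [this]
    have b1 : |∑ x ∈ S, ∑ y ∈ T, (adj G' x y - w x y)| ≤ η * n ^ 2 := by
      have p1 := (hG' (some (S, T, true))).trans hdev
      have p2 := (hG' (some (S, T, false))).trans hdev
      simp only [k, Option.elim, if_true, Bool.false_eq_true, if_false, ite_mul, zero_mul, one_mul,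
        neg_mul] at p1 p2
      rw [hsum] at p1 p2
      simp only [Finset.sum_neg_distrib] at p2
      rw [abs_le]; constructor <;> linarith
    have b2 : |∑ x ∈ S, ∑ y ∈ T, (w x y - w₀ (x, y))| ≤ η * n ^ 2 := by
      have q1 : |∑ x ∈ S, ∑ y ∈ T, (w x y - w₀ (x, y))| ≤ n := by
        calc _ ≤ ∑ x ∈ S, |∑ y ∈ T, (w x y - w₀ (x, y))| := Finset.abs_sum_le_sum_abs _ _
          _ ≤ ∑ x ∈ S, (1 : ℝ) := by
            refine Finset.sum_le_sum fun x _ => ?_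
            calc _ ≤ ∑ y ∈ T, |w x y - w₀ (x, y)| := Finset.abs_sum_le_sum_abs _ _
              _ ≤ ∑ y ∈ T, (if x = y then (1 : ℝ) else 0) := by
                refine Finset.sum_le_sum fun y _ => ?_
                simp only [w]; split_ifs
                · rw [zero_sub, abs_neg, abs_of_nonneg (hw₀0 _)]; exact hw₀1 _
                · simp
              _ ≤ 1 := by rw [Finset.sum_ite_eq]; split_ifs <;> norm_num
          _ ≤ n := by
            rw [Finset.sum_const, nsmul_eq_mul, mul_one, hn]
            exact_mod_cast Finset.card_le_univ S
      have q2 : 1 ≤ η * n := by nlinarith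
      nlinarith
    have b3 : |∑ x ∈ S, ∑ y ∈ T, (w₀ (x, y) - π (x, y))| ≤ η * n ^ 2 := by
      have := hw S T (fun q => 1 - a q - b q)
        (fun q q' e => by simp only [hba q q' e, hbb q q' e])
        (fun q => by rw [abs_le]; constructor <;> linarith [ha0 q, hb0 q, hab q])
      rw [Finset.sum_product] at this
      simpa only [hw₀π] using this
    rw [e1]
    calc _ ≤ _ := abs_add_le _ _
      _ ≤ η * n ^ 2 + (η * n ^ 2 + η * n ^ 2) :=
        add_le_add b1 ((abs_add_le _ _).trans (add_le_add b2 b3))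
      _ = _ := by ring

end Modification

/-! ### Iterating the entropy increment. -/

section Iteration

/-- The growth of the order of the partition in one refinement step. -/
def growth (N : ℕ) : ℕ := N ^ 3 * 4 ^ N ^ 12

theorem le_growth {N : ℕ} (hN : 1 ≤ N) : N ≤ growth N := by
  calc N = N ^ 1 * 1 := by ring
    _ ≤ _ := Nat.mul_le_mul (Nat.pow_le_pow_right hN (by norm_num))
        (Nat.one_le_pow _ _ (by norm_num))

theorem le_growth_iterate {N : ℕ} (hN : 1 ≤ N) (j : ℕ) : N ≤ growth^[j] N := by
  induction j generalizing N with
  | zero => simp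
  | succ j ih =>
    rw [Function.iterate_succ_apply]
    exact (le_growth hN).trans (ih (hN.trans (le_growth hN)))

theorem fiberAvg_eq_of_fiber_eq {Ω ι κ : Type*} [Fintype Ω] [DecidableEq ι] [DecidableEq κ]
    {Φ : Ω → ι} {Ψ : Ω → κ} {ω : Ω} (h : ∀ ω', Φ ω' = Φ ω ↔ Ψ ω' = Ψ ω) (f : Ω → ℝ) :
    fiberAvg Φ f ω = fiberAvg Ψ f ω := by
  simp only [fiberAvg, h]

variable {V : Type}

theorem isRegularPair_singleton {G : SimpleGraph V} {ε : ℝ} (hε : 0 < ε) (x y : V) :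
    IsRegularPair G ε {x} {y} := by
  intro A hA B hB h1 h2
  have hA' : A = {x} := by
    rcases Finset.subset_singleton_iff.1 hA with rfl | h
    · simp at h1; linarith
    · exact h
  have hB' : B = {y} := by
    rcases Finset.subset_singleton_iff.1 hB with rfl | h
    · simp at h2; linarith
    · exact h
  subst hA' hB'
  simpa using hε.le

variable [Fintype V] [DecidableEq V]

/-- Compare Φ with the common refinement of Φ and φ. Their blocks agree at pairs avoiding the
exceptional vertices; at the remaining pairs t log t lies in [-1, 0], so each costs at most 1. -/
theorem sum_ent_ge_of_almost_finer {ι κ : Type*} [DecidableEq ι] [DecidableEq κ] {Φ : V → ι}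
    {φ : V → κ} {f : V × V → ℝ} (hf0 : ∀ q, 0 ≤ f q) (hf1 : ∀ q, f q ≤ 1) :
    ∑ q, ent (fiberAvg (pairLabel φ) f q)
        - 2 * (#{x | ∃ x', Φ x' = Φ x ∧ φ x' ≠ φ x} : ℝ) * Fintype.card V
      ≤ ∑ q, ent (fiberAvg (pairLabel Φ) f q) := by
  classical
  set B : Finset V := {x | ∃ x', Φ x' = Φ x ∧ φ x' ≠ φ x} with hB
  let Ψ : V → ι × κ := fun x => (Φ x, φ x)
  have h1 : ∑ q, ent (fiberAvg (pairLabel φ) f q) ≤ ∑ q, ent (fiberAvg (pairLabel Ψ) f q) :=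
    sum_ent_fiberAvg_mono (finer_pairLabel fun x y e => (Prod.mk.inj e).2) hf0
  have hgood : ∀ x ∉ B, ∀ x', Φ x' = Φ x ↔ Ψ x' = Ψ x := by
    intro x hx x'
    simp only [hB, Finset.mem_filter, Finset.mem_univ, true_and, not_exists, not_and, not_not] at hx
    simp only [Ψ, Prod.mk.injEq]
    exact ⟨fun e => ⟨e, hx x' e⟩, fun e => e.1⟩
  have h2 : ∀ q : V × V, ent (fiberAvg (pairLabel Ψ) f q)
      ≤ ent (fiberAvg (pairLabel Φ) f q)
        + ((if q.1 ∈ B then 1 else 0) + (if q.2 ∈ B then 1 else 0)) := by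
    intro q
    have hle : ent (fiberAvg (pairLabel Ψ) f q) ≤ ent (fiberAvg (pairLabel Φ) f q) + 1 := by
      have a1 := ent_nonpos (fiberAvg_nonneg (pairLabel Ψ) hf0 q)
        (fiberAvg_le_one (pairLabel Ψ) hf1 q)
      have a2 := neg_one_le_ent (fiberAvg_nonneg (pairLabel Φ) hf0 q)
      linarith
    by_cases c1 : q.1 ∈ B <;> by_cases c2 : q.2 ∈ B <;> simp only [c1, c2, if_true, if_false]
    · linarith
    · linarith
    · linarith
    · rw [fiberAvg_eq_of_fiber_eq (Φ := pairLabel Φ) (Ψ := pairLabel Ψ)]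
      · linarith
      · intro q'
        simp only [pairLabel, Prod.mk.injEq, hgood _ c1, hgood _ c2]
  have h3 := Finset.sum_le_sum fun q (_ : q ∈ univ) => h2 q
  rw [Finset.sum_add_distrib, Finset.sum_add_distrib] at h3
  have h4 : ∑ q : V × V, (if q.1 ∈ B then (1 : ℝ) else 0) = #B * Fintype.card V := by
    rw [Fintype.sum_prod_type, Finset.sum_comm]; simp [mul_comm]
  have h5 : ∑ q : V × V, (if q.2 ∈ B then (1 : ℝ) else 0) = #B * Fintype.card V := by
    rw [Fintype.sum_prod_type]; simp [mul_comm]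
  rw [h4, h5] at h3
  linarith

/-- There are an equipartition refining `P₀` of order at most `s`, and a graph close to `G` for
which all pairs of parts are regular. -/
def HasApproximation (G : SimpleGraph V) (P₀ : Finpartition (univ : Finset V)) (ε δ : ℝ)
    (s : ℕ) : Prop :=
  ∃ G' : SimpleGraph V, IsClose δ G G' ∧ ∃ P : Finpartition (univ : Finset V),
    P.IsEquipartition ∧ P ≤ P₀ ∧ (∀ A ∈ P.parts, ∀ B ∈ P.parts, IsRegularPair G' ε A B) ∧
      #P.parts ≤ s

theorem approximation_or_increment [Nonempty V] (G : SimpleGraph V)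
    {P₀ P : Finpartition (univ : Finset V)} (hP₀ : P₀.IsEquipartition) (hP : P.IsEquipartition)
    (hle : P ≤ P₀) {ε δ p : ℝ} (hε : 0 < ε) (hε1 : ε ≤ 1) (hδ : 0 < δ) (hδ1 : δ ≤ 1)
    (hp : 0 < p) {N : ℕ} (hN : 24 ≤ N) (hPN : #P.parts ≤ N) (hεN : 1 ≤ ε * N)
    (hδN : 64 ≤ δ ^ 2 * p * N) (hnN : growth N ≤ Fintype.card V)
    (hG : p * (Fintype.card V : ℝ) ^ 2 ≤ ∑ q, adjPair G q) :
    HasApproximation G P₀ ε δ N ∨ ∃ P' : Finpartition (univ : Finset V), P'.IsEquipartition ∧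
      P' ≤ P₀ ∧ #P'.parts ≤ growth N ∧
      ∑ q, ent (fiberAvg (pairLabel P.part) (adjPair G) q) + δ ^ 2 / 32 * ∑ q, adjPair G q
        ≤ ∑ q, ent (fiberAvg (pairLabel P'.part) (adjPair G) q) := by
  set f := adjPair G with hf
  have hf0 : ∀ q, 0 ≤ f q := fun q => adj_nonneg _ _ _
  have hf1 : ∀ q, f q ≤ 1 := fun q => adj_le_one _ _ _
  have hNr : (24 : ℝ) ≤ N := by exact_mod_cast hN
  have hN0 : (0 : ℝ) < N := by linarith
  set n : ℝ := (Fintype.card V : ℝ) with hn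
  have hn0 : 0 < n := by rw [hn]; exact_mod_cast Fintype.card_pos
  obtain ⟨ψ, hψ, hψP⟩ := exists_label_part P
  -- The precision N⁻⁶ beats ε³/k², where k ≤ N is the order of P, because ε ≥ 1/N. It costs N¹²
  -- energy increments, whence the factor 4 ^ N ^ 12 in `growth`.
  obtain ⟨φ, hφ, hφψ, hw⟩ := exists_weakRegular hψ hf0 hf1 (η := 1 / (N : ℝ) ^ 6) (by positivity)
    (T := N ^ 12) (by push_cast; rw [div_pow, ← pow_mul]; field_simp; norm_num)
  have hφP : Finer φ P.part := fun x y e => (hψP x y).1 (hφψ x y e)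
  have hK0 : 0 < #P.parts := Finset.card_pos.2 (P.parts_nonempty Finset.univ_nonempty.ne_empty)
  by_cases hclose : ∑ q, |fiberAvg (pairLabel φ) f q - fiberAvg (pairLabel P.part) f q|
      ≤ δ / 2 * ∑ q, f q
  · left
    have hbig : 64 * N ^ 12 ≤ Fintype.card V := by
      refine le_trans (Nat.mul_le_mul ?_ ?_) hnN
      · calc 64 ≤ 24 ^ 3 := by norm_num
          _ ≤ N ^ 3 := Nat.pow_le_pow_left hN 3
      · exact (Nat.lt_pow_self (by norm_num)).le
    obtain ⟨G', h1, h2⟩ := exists_regular_modification G hP (by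
        have : N ≤ N ^ 12 := Nat.le_self_pow (by norm_num) N
        omega) hφP hε hε1 (δ := δ) (η := 1 / (N : ℝ) ^ 6) (by positivity)
        (by rw [div_le_one (by positivity)]; exact one_le_pow₀ (by linarith))
        (by
          have e1 : (#P.parts : ℝ) ^ 2 ≤ (N : ℝ) ^ 2 :=
            pow_le_pow_left₀ (Nat.cast_nonneg _) (by exact_mod_cast hPN) 2
          have e2 : 1 ≤ (ε * N) ^ 3 := one_le_pow₀ hεN
          calc 24 * (1 / (N : ℝ) ^ 6) * (#P.parts : ℝ) ^ 2
              ≤ 24 * (1 / (N : ℝ) ^ 6) * (N : ℝ) ^ 2 :=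
                mul_le_mul_of_nonneg_left e1 (by positivity)
            _ = 24 / (N : ℝ) ^ 4 := by field_simp
            _ ≤ N / (N : ℝ) ^ 4 := div_le_div_of_nonneg_right hNr (by positivity)
            _ = 1 / (N : ℝ) ^ 3 := by field_simp
            _ ≤ (ε * N) ^ 3 / (N : ℝ) ^ 3 := div_le_div_of_nonneg_right e2 (by positivity)
            _ = ε ^ 3 := by field_simp)
        (by
          have : (64 * (N : ℝ) ^ 12) ≤ Fintype.card V := by exact_mod_cast hbig
          calc (64 : ℝ) = (1 / (N : ℝ) ^ 6) ^ 2 * (64 * (N : ℝ) ^ 12) := by field_simp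
            _ ≤ _ := mul_le_mul_of_nonneg_left this (by positivity))
        (by
          have e1 : 4 * (1 / (N : ℝ) ^ 6) ≤ δ * p := by
            have e2 : δ ^ 2 * p * N ≤ δ * p * N := by
              have : δ ^ 2 ≤ δ := by nlinarith
              gcongr
            have e3 : (N : ℝ) ≤ (N : ℝ) ^ 6 := le_self_pow₀ (by linarith) (by norm_num)
            rw [mul_one_div, div_le_iff₀ (by positivity)]
            calc (4 : ℝ) ≤ δ * p * N := by linarith
              _ ≤ _ := by gcongr
          calc _ ≤ δ * p * n ^ 2 := mul_le_mul_of_nonneg_right e1 (by positivity)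
            _ = δ * (p * n ^ 2) := by ring
            _ ≤ _ := mul_le_mul_of_nonneg_left hG hδ.le)
        hw hclose
    exact ⟨G', h1, P, hP, hle, h2, hPN⟩
  · right
    push Not at hclose
    set L := #P.parts * 4 ^ N ^ 12 with hL
    have hL0 : 0 < L := by positivity
    have hcm : #P₀.parts ≤ N := (Finpartition.card_mono hle).trans hPN
    have hsize : #P₀.parts * (L * N) ≤ growth N := by
      calc _ ≤ N * (N * 4 ^ N ^ 12 * N) :=
            Nat.mul_le_mul hcm (Nat.mul_le_mul_right _ (Nat.mul_le_mul_right _ hPN))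
        _ = _ := by unfold growth; ring
    -- With r = L * N at most n/N vertices are exceptional, so the potential lost is at most 2n²/N,
    -- within δ²F/32. The gain with l = δ/4 exceeds δ²F/8 - δ²F/16 = δ²F/16.
    obtain ⟨P', hP', hle', hcard, hbad⟩ := exists_equitable_refinement P₀ hP₀ hφ
      (r := L * N) (by positivity) (by rw [mul_comm]; exact hsize.trans hnN)
    refine ⟨P', hP', hle', hcard ▸ hsize, ?_⟩
    have hset : #{x | ∃ x', P'.part x' = P'.part x ∧ φ x' ≠ φ x}
        = #{x | ∃ x' ∈ P'.part x, φ x' ≠ φ x} := by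
      congr 1
      ext x
      simp only [Finset.mem_filter, Finset.mem_univ, true_and]
      refine exists_congr fun x' => and_congr_left fun _ => ?_
      exact (P'.mem_part_iff_part_eq_part (mem_univ x') (mem_univ x)).symm
    have h1 := sum_ent_ge_of_almost_finer (Φ := P'.part) (φ := φ) hf0 hf1
    rw [hset] at h1
    have h2 := sum_ent_fiberAvg_sub_ge (finer_pairLabel hφP) hf0 (l := δ / 4) (by positivity)
      (by linarith)
    have h3 : (#{x | ∃ x' ∈ P'.part x, φ x' ≠ φ x} : ℝ) * N ≤ n := by
      have e1 : #{x | ∃ x' ∈ P'.part x, φ x' ≠ φ x} * N ≤ Fintype.card V := by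
        refine Nat.le_of_mul_le_mul_left ?_ hL0
        calc _ = #{x | ∃ x' ∈ P'.part x, φ x' ≠ φ x} * (L * N) := by ring
          _ ≤ _ := hbad
      rw [hn]; exact_mod_cast e1
    have h4 : 2 * (#{x | ∃ x' ∈ P'.part x, φ x' ≠ φ x} : ℝ) * n ≤ δ ^ 2 / 32 * ∑ q, f q := by
      refine le_of_mul_le_mul_right ?_ hN0
      calc _ = 2 * ((#{x | ∃ x' ∈ P'.part x, φ x' ≠ φ x} : ℝ) * N) * n := by ring
        _ ≤ 2 * n * n := by gcongr
        _ = 64 / 32 * n ^ 2 := by ring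
        _ ≤ (δ ^ 2 * p * N) / 32 * n ^ 2 := by gcongr
        _ = δ ^ 2 / 32 * (p * n ^ 2) * N := by ring
        _ ≤ _ := by gcongr
    have h5 := mul_le_mul_of_nonneg_left hclose.le (by positivity : 0 ≤ δ / 4)
    nlinarith

/-- Here j counts the increments that the potential still allows before it would exceed 0. -/
theorem exists_approximation [Nonempty V] (G : SimpleGraph V)
    {P₀ : Finpartition (univ : Finset V)} (hP₀ : P₀.IsEquipartition) {ε δ p : ℝ} (hε : 0 < ε)
    (hε1 : ε ≤ 1) (hδ : 0 < δ) (hδ1 : δ ≤ 1) (hp : 0 < p)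
    (hG : p * (Fintype.card V : ℝ) ^ 2 ≤ ∑ q, adjPair G q) (j : ℕ) :
    ∀ (N : ℕ) (P : Finpartition (univ : Finset V)), P.IsEquipartition → P ≤ P₀ → 24 ≤ N →
      #P.parts ≤ N → 1 ≤ ε * N → 64 ≤ δ ^ 2 * p * N → growth^[j + 1] N ≤ Fintype.card V →
      -(j * (δ ^ 2 / 32 * ∑ q, adjPair G q))
        ≤ ∑ q, ent (fiberAvg (pairLabel P.part) (adjPair G) q) →
      HasApproximation G P₀ ε δ (growth^[j] N) := by
  have hF : 0 < δ ^ 2 / 32 * ∑ q, adjPair G q := by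
    have : (0 : ℝ) < Fintype.card V := by exact_mod_cast Fintype.card_pos
    have : 0 < p * (Fintype.card V : ℝ) ^ 2 := by positivity
    have := this.trans_le hG
    positivity
  have hneg : ∀ P : Finpartition (univ : Finset V),
      ∑ q, ent (fiberAvg (pairLabel P.part) (adjPair G) q) ≤ 0 := fun P =>
    Finset.sum_nonpos fun q _ => ent_nonpos (fiberAvg_nonneg _ (fun q => adj_nonneg _ _ _) q)
      (fiberAvg_le_one _ (fun q => adj_le_one _ _ _) q)
  induction j with
  | zero =>
    intro N P hP hle hN hPN hεN hδN hn hent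
    rcases approximation_or_increment G hP₀ hP hle hε hε1 hδ hδ1 hp hN hPN hεN hδN hn hG with
      h | ⟨P', -, -, -, h⟩
    · exact h
    · have := hneg P'
      simp only [Nat.cast_zero, zero_mul, neg_zero] at hent
      linarith
  | succ j ih =>
    intro N P hP hle hN hPN hεN hδN hn hent
    have hg : N ≤ growth N := le_growth (by omega)
    have hgr : (N : ℝ) ≤ growth N := by exact_mod_cast hg
    have hn' : growth N ≤ Fintype.card V := by
      rw [Function.iterate_succ_apply] at hn
      exact (le_growth_iterate (by omega) _).trans hn
    rcases approximation_or_increment G hP₀ hP hle hε hε1 hδ hδ1 hp hN hPN hεN hδN hn' hG with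
      ⟨G', h1, P', h2, h3, h4, h5⟩ | ⟨P', h1, h2, h3, h4⟩
    · exact ⟨G', h1, P', h2, h3, h4, h5.trans (le_growth_iterate (by omega) _)⟩
    · rw [Function.iterate_succ_apply]
      rw [Function.iterate_succ_apply] at hn
      refine ih (growth N) P' h1 h2 (hN.trans hg) h3
        (hεN.trans (mul_le_mul_of_nonneg_left hgr hε.le))
        (hδN.trans (mul_le_mul_of_nonneg_left hgr (by positivity))) hn ?_
      push_cast at hent
      linarith

theorem hasApproximation_bot (G : SimpleGraph V) (P₀ : Finpartition (univ : Finset V)) {ε δ : ℝ}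
    (hε : 0 < ε) (hδ : 0 ≤ δ) : HasApproximation G P₀ ε δ (Fintype.card V) := by
  refine ⟨G, ?_, ⊥, Finpartition.bot_isEquipartition _, bot_le, fun A hA B hB => ?_, ?_⟩
  · simpa [IsClose] using by positivity
  · obtain ⟨x, -, rfl⟩ := Finpartition.mem_bot_iff.1 hA
    obtain ⟨y, -, rfl⟩ := Finpartition.mem_bot_iff.1 hB
    exact isRegularPair_singleton hε x y
  · rw [Finpartition.card_bot, Finset.card_univ]

/-- The initial potential is at least -F log(1/p), so j increments of δ²F/32 exhaust it. Graphs too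
small for the iteration are handled by the partition into singletons. -/
theorem isGood_growth {ε δ p : ℝ} (hε : 0 < ε) (hε1 : ε ≤ 1) (hδ : 0 < δ) (hδ1 : δ ≤ 1)
    (hp : 0 < p) {N j : ℕ} (hN : 24 ≤ N) (hεN : 1 ≤ ε * N) (hδN : 64 ≤ δ ^ 2 * p * N)
    (hj : 32 * Real.log (1 / p) ≤ δ ^ 2 * j) : IsGood ε δ p (growth^[j + 1] N) := by
  intro V _ _ G hG P₀ hP₀ hcard
  suffices h : HasApproximation G P₀ ε δ (growth^[j + 1] N) by
    obtain ⟨G', h1, P, h2, h3, h4, h5⟩ := h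
    refine ⟨G', h1, P, h2, h3, ?_, h5⟩
    classical
    unfold IsRegularPartition
    rw [Finset.filter_false_of_mem]
    · simp only [Finset.card_empty, Nat.cast_zero]; positivity
    · intro q hq
      rw [Finset.mem_product] at hq
      exact not_not.2 (h4 _ hq.1 _ hq.2)
  rcases le_or_gt (Fintype.card V) (growth^[j + 1] N) with hn | hn
  · obtain ⟨G', h1, P, h2, h3, h4, h5⟩ := hasApproximation_bot G P₀ hε hδ.le
    exact ⟨G', h1, P, h2, h3, h4, h5.trans hn⟩
  have : Nonempty V := Fintype.card_pos_iff.1 (by omega)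
  have hn0 : (0 : ℝ) < Fintype.card V := by exact_mod_cast Fintype.card_pos
  have hG' : p * (Fintype.card V : ℝ) ^ 2 ≤ ∑ q, adjPair G q := by
    rw [density_eq, le_div_iff₀ (by positivity)] at hG
    rw [Fintype.sum_prod_type]; exact hG
  have hF0 : 0 ≤ ∑ q, adjPair G q := Finset.sum_nonneg fun q _ => adj_nonneg _ _ _
  obtain ⟨G', h1, P, h2, h3, h4, h5⟩ := exists_approximation G hP₀ hε hε1 hδ hδ1 hp hG' j N P₀ hP₀
    le_rfl hN (by
      have : (#P₀.parts : ℝ) ≤ N := hcard.trans (by rw [div_le_iff₀ hε]; linarith)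
      exact_mod_cast this) hεN hδN hn.le (by
      refine le_trans ?_ (sum_ent_fiberAvg_ge (pairLabel P₀.part) (f := adjPair G)
        (fun q => adj_nonneg _ _ _) hp (by
          rw [Fintype.card_prod]; push_cast; rw [← sq]; exact hG'))
      rw [one_div, Real.log_inv] at hj
      nlinarith)
  refine ⟨G', h1, P, h2, h3, h4, h5.trans ?_⟩
  rw [Function.iterate_succ_apply']
  exact le_growth ((by omega : 1 ≤ N).trans (le_growth_iterate (by omega) j))

end Iteration

/-! ### Tower estimates and the upper bound. -/

section Tower

theorem lt_tower (h : ℕ) : h < tower h := by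
  induction h with
  | zero => simp [tower]
  | succ h ih =>
    rw [tower]
    exact (Nat.succ_le_of_lt ih).trans_lt (Nat.lt_two_pow_self)

theorem two_pow_le_tower (h : ℕ) : 2 ^ h ≤ tower h := by
  cases h with
  | zero => simp [tower]
  | succ h => rw [tower]; exact Nat.pow_le_pow_right (by norm_num) (lt_tower h)

theorem tower_mono : Monotone tower :=
  monotone_nat_of_le_succ fun h => by rw [tower]; exact Nat.lt_two_pow_self.le

theorem growth_le_tower {N h : ℕ} (hN : 24 ≤ N) (hh : N ≤ tower h) :
    growth N ≤ tower (h + 3) := by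
  have h2 : N < 2 ^ N := Nat.lt_two_pow_self
  have h12 : N ^ 12 ≤ (2 ^ N) ^ 12 := Nat.pow_le_pow_left h2.le 12
  have h3 : 3 * N + 2 * N ^ 12 ≤ 2 ^ (3 + N * 12) := by
    have e1 : N ≤ N ^ 12 := Nat.le_self_pow (by norm_num) N
    rw [pow_add, pow_mul]
    omega
  have h4 : 3 + N * 12 ≤ 2 ^ N := by
    clear * - hN
    induction N, hN using Nat.le_induction with
    | base => norm_num
    | succ N _ ih => rw [pow_succ]; omega
  calc growth N = N ^ 3 * 2 ^ (2 * N ^ 12) := by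
        unfold growth; rw [pow_mul]; norm_num
    _ ≤ (2 ^ N) ^ 3 * 2 ^ (2 * N ^ 12) := Nat.mul_le_mul_right _ (Nat.pow_le_pow_left h2.le 3)
    _ = 2 ^ (3 * N + 2 * N ^ 12) := by rw [← pow_mul, ← pow_add, mul_comm N 3]
    _ ≤ 2 ^ 2 ^ 2 ^ N := Nat.pow_le_pow_right (by norm_num)
        (h3.trans (Nat.pow_le_pow_right (by norm_num) h4))
    _ ≤ tower (h + 3) := by
        simp only [tower]
        exact Nat.pow_le_pow_right (by norm_num) (Nat.pow_le_pow_right (by norm_num)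
          (Nat.pow_le_pow_right (by norm_num) hh))

theorem growth_iterate_le_tower (j : ℕ) : ∀ {N h : ℕ}, 24 ≤ N → N ≤ tower h →
    growth^[j] N ≤ tower (h + 3 * j) := by
  induction j with
  | zero => intro N h _ hh; simpa using hh
  | succ j ih =>
    intro N h hN hh
    rw [Function.iterate_succ_apply]
    have := ih (hN.trans (le_growth (by omega))) (growth_le_tower hN hh)
    rwa [show h + 3 + 3 * j = h + 3 * (j + 1) by ring] at this

theorem S_le_of_isGood {ε δ p : ℝ} {s : ℕ} (h : IsGood ε δ p s) : S ε δ p ≤ s :=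
  sInf_le ⟨s, h, rfl⟩

theorem half_le_log_one_div {p : ℝ} (hp : 0 < p) (hp2 : p ≤ 1 / 2) :
    1 / 2 ≤ Real.log (1 / p) := by
  have h1 : (2 : ℝ) ≤ 1 / p := by rw [le_div_iff₀ hp]; linarith
  have h2 := Real.log_le_log two_pos h1
  have := Real.log_two_gt_d9
  linarith

theorem exists_upper_bound {δ C : ℝ} (hδ : 0 < δ) (hδ1 : δ ≤ 1) (hC : 1 ≤ C) :
    ∃ c : ℝ, 0 < c ∧ ∀ p : ℝ, 0 < p → p ≤ 1 / 2 →
      S (p ^ C) δ p ≤ (twr (c * Real.log (1 / p)) : ℕ∞) := by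
  -- Because log(1/p) ≥ 1/2, the doubled logarithm absorbs the constant factor of the starting size
  -- into exp(B log(1/p)).
  set B : ℝ := C + 2 * Real.log (128 / δ ^ 2) with hB
  have hlog : 0 ≤ Real.log (128 / δ ^ 2) := by
    apply Real.log_nonneg
    rw [le_div_iff₀ (by positivity)]
    nlinarith
  have hB0 : 0 < B := by linarith
  -- The height is ⌈2Bx⌉ for the starting size plus 3 for each of the j + 1 rounds, where j =
  -- ⌈32x/δ²⌉. The rounding terms add up to at most 7 ≤ 14x.
  refine ⟨2 * B + 96 / δ ^ 2 + 14, by positivity, fun p hp hp2 => ?_⟩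
  set x := Real.log (1 / p) with hx
  have hx2 : 1 / 2 ≤ x := half_le_log_one_div hp hp2
  have hε : 0 < p ^ C := Real.rpow_pos_of_pos hp C
  have hεp : p ^ C ≤ p := by
    calc p ^ C ≤ p ^ (1 : ℝ) := Real.rpow_le_rpow_of_exponent_ge hp (by linarith) hC
      _ = p := Real.rpow_one p
  set y : ℝ := 64 / (δ ^ 2 * p ^ C) with hy
  have hy0 : 0 < δ ^ 2 * p ^ C := by positivity
  have hδ2 : δ ^ 2 ≤ 1 := by nlinarith
  have hy64 : 64 ≤ y := by
    rw [hy, le_div_iff₀ hy0]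
    nlinarith
  set N := ⌈y⌉₊ with hN
  have hyN : y ≤ N := Nat.le_ceil y
  have hNy : (N : ℝ) ≤ 2 * y := by
    have := Nat.ceil_lt_add_one (by linarith : 0 ≤ y)
    linarith
  have hδN : 64 ≤ δ ^ 2 * p ^ C * N := by
    calc (64 : ℝ) = δ ^ 2 * p ^ C * y := by rw [hy]; field_simp
      _ ≤ _ := mul_le_mul_of_nonneg_left hyN hy0.le
  set j := ⌈32 * x / δ ^ 2⌉₊ with hj
  have hN24 : 24 ≤ N := by
    have : (24 : ℝ) ≤ N := by linarith
    exact_mod_cast this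
  have hgood : IsGood (p ^ C) δ p (growth^[j + 1] N) := by
    refine isGood_growth hε (by linarith) hδ hδ1 hp hN24 ?_ ?_ ?_
    · have : δ ^ 2 * (p ^ C * N) ≤ 1 * (p ^ C * N) :=
        mul_le_mul_of_nonneg_right hδ2 (by positivity)
      linarith
    · refine hδN.trans ?_
      gcongr
    · have := Nat.le_ceil (32 * x / δ ^ 2)
      rw [div_le_iff₀ (by positivity)] at this
      linarith
  set h₀ := ⌈2 * B * x⌉₊ with hh₀
  have hNt : N ≤ tower h₀ := by
    have e1 : 2 * y ≤ Real.exp (B * x) := by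
      have e2 : 2 * y = Real.exp (Real.log (128 / δ ^ 2) + C * x) := by
        rw [Real.exp_add, Real.exp_log (by positivity), hx, one_div, Real.log_inv, hy,
          Real.rpow_def_of_pos hp, mul_neg, Real.exp_neg, mul_comm C]
        have := Real.exp_pos (Real.log p * C)
        field_simp; norm_num
      rw [e2]
      apply Real.exp_le_exp.2
      nlinarith
    have e3 : Real.exp (B * x) ≤ 2 ^ h₀ := by
      rw [← Real.rpow_natCast, Real.rpow_def_of_pos two_pos]
      apply Real.exp_le_exp.2
      have a1 := Nat.le_ceil (2 * B * x)
      have a2 := Real.log_two_gt_d9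
      have a3 : 0 < B * x := by positivity
      rw [← hh₀] at a1
      nlinarith
    have e4 : (N : ℝ) ≤ ((2 ^ h₀ : ℕ) : ℝ) := by push_cast; linarith
    exact (by exact_mod_cast e4 : N ≤ 2 ^ h₀).trans (two_pow_le_tower h₀)
  refine (S_le_of_isGood hgood).trans ?_
  refine Nat.cast_le.2 ((growth_iterate_le_tower (j + 1) hN24 hNt).trans (tower_mono ?_))
  apply Nat.le_floor
  push_cast
  have a1 := Nat.ceil_lt_add_one (by positivity : 0 ≤ 2 * B * x)
  have a2 := Nat.ceil_lt_add_one (by positivity : 0 ≤ 32 * x / δ ^ 2)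
  rw [← hh₀] at a1
  rw [← hj] at a2
  have a3 : (2 * B + 96 / δ ^ 2 + 14) * x = 2 * B * x + 3 * (32 * x / δ ^ 2) + 14 * x := by ring
  rw [a3]
  linarith

end Tower

/-! ### Balanced codes of exponential size. -/

section Codes

/-- Balanced binary codes with distant rows and weakly correlated columns. -/
structure IsCode {U T : Type*} [Fintype U] [Fintype T] (c : U → T → Bool) : Prop where
  row : ∀ u, 2 * #{t | c u t} = Fintype.card T
  col : ∀ t, 2 * #{u | c u t} = Fintype.card U
  pair : ∀ t t', t ≠ t' → 4 * #{u | c u t ∧ c u t'} ≤ Fintype.card U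
  dist : ∀ u u', u ≠ u' → 8 * #{t | c u t ∧ c u' t} ≤ 3 * Fintype.card T

theorem card_filter_equiv {α β : Type*} [Fintype α] [Fintype β] (e : α ≃ β) (p : β → Prop)
    [DecidablePred p] : #{a | p (e a)} = #{b | p b} :=
  Finset.card_equiv e fun a => by simp

theorem IsCode.comp_equiv {U T U' T' : Type*} [Fintype U] [Fintype T] [Fintype U'] [Fintype T']
    {c : U → T → Bool} (h : IsCode c) (e : U' ≃ U) (f : T' ≃ T) :
    IsCode fun u t => c (e u) (f t) where
  row u := by
    rw [card_filter_equiv f fun t => c (e u) t = true, h.row, Fintype.card_congr f]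
  col t := by
    rw [card_filter_equiv e fun u => c u (f t) = true, h.col, Fintype.card_congr e]
  pair t t' ht := by
    rw [card_filter_equiv e fun u => c u (f t) = true ∧ c u (f t') = true, Fintype.card_congr e]
    exact h.pair _ _ (f.injective.ne ht)
  dist u u' hu := by
    rw [card_filter_equiv f fun t => c (e u) t = true ∧ c (e u') t = true, Fintype.card_congr f]
    exact h.dist _ _ (e.injective.ne hu)

/-- Gilbert–Varshamov: while fewer than N elements are chosen, their translates of D do not cover
the group. -/
theorem exists_finset_pairwise_sub_notMem {Γ : Type*} [AddCommGroup Γ] [Fintype Γ] [DecidableEq Γ]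
    (D : Finset Γ) (h0 : 0 ∈ D) (hD : ∀ g ∈ D, -g ∈ D) {N : ℕ} (hN : N * #D < Fintype.card Γ) :
    ∃ s : Finset Γ, #s = N ∧ ∀ x ∈ s, ∀ y ∈ s, x ≠ y → x - y ∉ D := by
  have key : ∀ j ≤ N, ∃ s : Finset Γ, #s = j ∧ ∀ x ∈ s, ∀ y ∈ s, x ≠ y → x - y ∉ D := by
    intro j
    induction j with
    | zero => exact fun _ => ⟨∅, by simp⟩
    | succ j ih =>
      intro hj
      obtain ⟨s, hs, hsD⟩ := ih (by omega)
      have hlt : #(s.biUnion fun x => D.image fun d => d + x) < #(univ : Finset Γ) := by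
        refine lt_of_le_of_lt (Finset.card_biUnion_le_card_mul _ _ #D
          fun x _ => Finset.card_image_le) ?_
        rw [hs, Finset.card_univ]
        exact lt_of_le_of_lt (Nat.mul_le_mul_right _ (by omega)) hN
      obtain ⟨g, -, hg⟩ := Finset.exists_mem_notMem_of_card_lt_card hlt
      have hgs : ∀ x ∈ s, g - x ∉ D := fun x hx hd =>
        hg (Finset.mem_biUnion.2 ⟨x, hx, Finset.mem_image.2 ⟨g - x, hd, by abel⟩⟩)
      have hgn : g ∉ s := fun hm => hgs g hm (by rwa [sub_self])
      refine ⟨insert g s, by rw [Finset.card_insert_of_notMem hgn, hs], ?_⟩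
      intro x hx y hy hxy
      rcases Finset.mem_insert.1 hx with hx' | hx' <;> rcases Finset.mem_insert.1 hy with hy' | hy'
      · exact absurd (hx'.trans hy'.symm) hxy
      · rw [hx']; exact hgs y hy'
      · rw [hy']; exact fun hd => hgs x hx' (by simpa using hD _ hd)
      · exact hsD x hx' y hy' hxy
  exact key N le_rfl

theorem two_mul_card_dotProduct {ι : Type*} [Fintype ι] [DecidableEq ι] {w : ι → ZMod 2}
    (hw : w ≠ 0) (s : ZMod 2) : 2 * #{v : ι → ZMod 2 | v ⬝ᵥ w = s} = Fintype.card (ι → ZMod 2) := by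
  obtain ⟨j, hj⟩ := Function.ne_iff.1 hw
  have hj1 : w j = 1 := by
    have : ∀ z : ZMod 2, z ≠ 0 → z = 1 := by decide
    exact this _ hj
  have e1 : #{v : ι → ZMod 2 | v ⬝ᵥ w = s} = #{v : ι → ZMod 2 | ¬ v ⬝ᵥ w = s} := by
    rw [← card_filter_equiv (Equiv.addRight (Pi.single j (1 : ZMod 2)))]
    congr 1
    ext v
    simp only [Equiv.coe_addRight, add_dotProduct, single_dotProduct, hj1, Finset.mem_filter,
      Finset.mem_univ, true_and, mul_one]
    have : ∀ z s : ZMod 2, z + 1 = s ↔ ¬ z = s := by decide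
    exact this _ _
  have e2 := Finset.card_filter_add_card_filter_not (s := (univ : Finset (ι → ZMod 2)))
    (fun v => v ⬝ᵥ w = s)
  rw [Finset.card_univ] at e2
  omega

/-- Markov's inequality for 2 raised to the number of zeros, whose sum over all functions factorises
into a power of 2 + 1. -/
theorem card_mul_two_pow_zeros {X : Type*} [Fintype X] [DecidableEq X] {z : ℕ} :
    #{g : X → ZMod 2 | z ≤ #{t | g t = 0}} * 2 ^ z ≤ 3 ^ Fintype.card X := by
  have h1 : ∑ g : X → ZMod 2, 2 ^ #{t | g t = 0} = 3 ^ Fintype.card X := by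
    have h2 : ∀ g : X → ZMod 2, 2 ^ #{t | g t = 0} = ∏ t, if g t = 0 then 2 else 1 := by
      intro g
      rw [Finset.prod_ite]; simp
    have h3 := Finset.prod_univ_sum (fun _ : X => (univ : Finset (ZMod 2)))
      (fun _ z => if z = 0 then 2 else 1)
    rw [Finset.sum_congr rfl fun g _ => h2 g, ← Fintype.piFinset_univ, ← h3]
    have h4 : ∑ z : ZMod 2, (if z = 0 then 2 else 1) = 3 := by decide
    simp only [h4, Finset.prod_const, Finset.card_univ]
  rw [← h1, ← smul_eq_mul, ← Finset.sum_const]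
  calc _ ≤ ∑ g : X → ZMod 2 with z ≤ #{t | g t = 0}, 2 ^ #{t | g t = 0} :=
        Finset.sum_le_sum fun g hg =>
          Nat.pow_le_pow_right (by norm_num) (Finset.mem_filter.1 hg).2
    _ ≤ _ := Finset.sum_le_sum_of_subset (Finset.filter_subset _ _)

/-- Many functions on `𝔽₂ᵃ` which pairwise differ from each affine function in at least a quarter
of the places. -/
theorem exists_far_functions {a κ : ℕ} (ha : 3 ≤ a) (hκ : κ + a + 1 ≤ 2 ^ (a - 3)) :
    ∃ h : Fin (2 ^ κ) → (Fin a → ZMod 2) → ZMod 2, ∀ i j, i ≠ j → ∀ (v : Fin a → ZMod 2)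
      (e : ZMod 2), 4 * #{t | h i t - h j t = v ⬝ᵥ t + e} ≤ 3 * 2 ^ a := by
  let X := Fin a → ZMod 2
  have hX : Fintype.card X = 2 ^ a := by simp [X, ZMod.card]
  obtain ⟨m, hm⟩ : ∃ m, m = 2 ^ (a - 3) := ⟨_, rfl⟩
  have hm8 : 2 ^ a = 8 * m := by
    rw [hm, ← show 2 ^ 3 = 8 by norm_num, ← pow_add]; congr 1; omega
  let B : Finset (X → ZMod 2) := {g | 6 * m ≤ #{t | g t = 0}}
  have hB : #B * 2 ^ (6 * m) ≤ 3 ^ (8 * m) := by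
    have := card_mul_two_pow_zeros (X := X) (z := 6 * m)
    rwa [hX, hm8] at this
  -- The forbidden differences are those agreeing with some affine function in at least three
  -- quarters of the 8m places. The union bound over affine functions works because 2 * 3 ^ 8 < 2 ^
  -- 14.
  let D : Finset (X → ZMod 2) :=
    (univ : Finset (X × ZMod 2)).biUnion fun q => B.image fun g t => g t + (q.1 ⬝ᵥ t + q.2)
  have hDmem : ∀ g : X → ZMod 2,
      g ∈ D ↔ ∃ (v : X) (e : ZMod 2), 6 * m ≤ #{t | g t = v ⬝ᵥ t + e} := by
    intro g
    simp only [D, Finset.mem_biUnion, Finset.mem_univ, true_and, Prod.exists, Finset.mem_image]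
    refine exists_congr fun v => exists_congr fun e => ?_
    constructor
    · rintro ⟨g', hg', rfl⟩
      simpa [B] using hg'
    · intro hg
      refine ⟨fun t => g t - (v ⬝ᵥ t + e), ?_, by funext t; ring⟩
      simpa [B, sub_eq_zero] using hg
  have hDc : #D ≤ 2 ^ (a + 1) * #B := by
    refine (Finset.card_biUnion_le_card_mul _ _ #B fun q _ => Finset.card_image_le).trans ?_
    rw [Finset.card_univ, Fintype.card_prod, hX, ZMod.card, pow_succ]
  obtain ⟨s, hs, hsD⟩ := exists_finset_pairwise_sub_notMem D
    ((hDmem 0).2 ⟨0, 0, by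
      simp only [Pi.zero_apply, zero_dotProduct, add_zero, Finset.filter_true, Finset.card_univ]
      rw [hX]; omega⟩)
    (fun g hg => by
      have : -g = g := by
        funext t
        have : ∀ z : ZMod 2, -z = z := by decide
        exact this _
      rwa [this]) (N := 2 ^ κ) (by
      have hcard : Fintype.card (X → ZMod 2) = 2 ^ (8 * m) := by
        rw [Fintype.card_fun, ZMod.card, hX, hm8]
      rw [hcard]
      refine Nat.lt_of_mul_lt_mul_right (a := 2 ^ (6 * m)) ?_
      have hmpos : 0 < m := by rw [hm]; positivity
      calc 2 ^ κ * #D * 2 ^ (6 * m) ≤ 2 ^ κ * (2 ^ (a + 1) * #B) * 2 ^ (6 * m) := by gcongr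
        _ = 2 ^ (κ + a + 1) * (#B * 2 ^ (6 * m)) := by rw [add_assoc, pow_add]; ring
        _ ≤ 2 ^ m * 3 ^ (8 * m) :=
          Nat.mul_le_mul (Nat.pow_le_pow_right (by norm_num) (by omega)) hB
        _ = (2 * 3 ^ 8) ^ m := by rw [mul_pow, pow_mul]
        _ < (2 ^ 14) ^ m := Nat.pow_lt_pow_left (by norm_num) hmpos.ne'
        _ = _ := by rw [← pow_mul, ← pow_add]; congr 1; ring)
  let σ := (s.equivFinOfCardEq hs).symm
  refine ⟨fun i => (σ i : X → ZMod 2), fun i j hij v e => ?_⟩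
  have h1 := hsD (σ i) (σ i).2 (σ j) (σ j).2 fun h => hij (σ.injective (Subtype.ext h))
  rw [hDmem] at h1
  push Not at h1
  have h2 := h1 v e
  simp only [Pi.sub_apply] at h2
  rw [hm8]
  change 4 * #{t : X | (σ i : X → ZMod 2) t - (σ j : X → ZMod 2) t = v ⬝ᵥ t + e} ≤ _
  omega

theorem exists_isCode {k k' : ℕ} (hk : 4 ≤ k) (hkk : k ≤ k') (hk' : k' ≤ 2 ^ (k - 4)) :
    ∃ c : Fin (2 ^ k') → Fin (2 ^ k) → Bool, IsCode c := by
  obtain ⟨a, rfl⟩ : ∃ a, k = a + 1 := ⟨k - 1, by omega⟩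
  obtain ⟨κ, rfl⟩ : ∃ κ, k' = κ + a + 1 := ⟨k' - (a + 1), by omega⟩
  obtain ⟨h, hh⟩ := exists_far_functions (a := a) (κ := κ) (by omega)
    (by rwa [show a - 3 = a + 1 - 4 by omega])
  let X := Fin a → ZMod 2
  have hX : Fintype.card X = 2 ^ a := by simp [X, ZMod.card]
  let I := Fin (2 ^ κ)
  -- Adding all affine functions makes distinct columns uncorrelated, or disjoint when they differ
  -- only in the last bit, while the far functions `h` supply exponentially many rows. The extra bit
  -- in the column index balances every row.
  let f : I × X × ZMod 2 → X → ZMod 2 := fun u t => h u.1 t + u.2.1 ⬝ᵥ t + u.2.2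
  let c : I × X × ZMod 2 → X × ZMod 2 → Bool := fun u q => f u q.1 + q.2 = 1
  have hT : Fintype.card (X × ZMod 2) = 2 ^ (a + 1) := by
    rw [Fintype.card_prod, hX, ZMod.card, pow_succ]
  have hU : Fintype.card (I × X × ZMod 2) = 2 ^ (κ + a + 1) := by
    simp only [Fintype.card_prod, hX, ZMod.card, I, Fintype.card_fin]
    rw [pow_succ, pow_add]; ring
  have z1 : ∀ z : ZMod 2, #{b : ZMod 2 | z + b = 1} = 1 := by decide
  have z2 : ∀ y z : ZMod 2, #{b : ZMod 2 | y + b = 1 ∧ z + b = 1} = if y = z then 1 else 0 := by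
    decide
  have hdist : ∀ u u', #{q | c u q ∧ c u' q} = #{t : X | f u t = f u' t} := by
    intro u u'
    rw [Finset.card_filter, Fintype.sum_prod_type, Finset.card_filter]
    refine Finset.sum_congr rfl fun t _ => ?_
    rw [← Finset.card_filter]
    simp only [c, decide_eq_true_eq]
    exact z2 _ _
  have hc : IsCode c := by
    refine ⟨fun u => ?_, fun q => ?_, fun q q' hq => ?_, fun u u' hu => ?_⟩
    · rw [hT, pow_succ, mul_comm, ← hX]
      congr 1
      rw [Finset.card_filter, Fintype.sum_prod_type]
      simp_rw [← Finset.card_filter, c, decide_eq_true_eq, z1]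
      simp
    · have e1 : #{u | c u q} = 2 ^ κ * 2 ^ a := by
        rw [Finset.card_filter, Fintype.sum_prod_type]
        simp_rw [Fintype.sum_prod_type, ← Finset.card_filter]
        have : ∀ (i : I) (v : X), #{e : ZMod 2 | c (i, v, e) q} = 1 := by
          intro i v
          refine Eq.trans ?_ (z1 (h i q.1 + v ⬝ᵥ q.1 + q.2))
          congr 1; ext e
          simp only [c, f, decide_eq_true_eq, Finset.mem_filter, Finset.mem_univ, true_and]
          rw [show h i q.1 + v ⬝ᵥ q.1 + e + q.2 = h i q.1 + v ⬝ᵥ q.1 + q.2 + e by ring]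
        simp only [this, Finset.sum_const, Finset.card_univ, hX, smul_eq_mul, mul_one, I,
          Fintype.card_fin]
      rw [e1, hU]; ring
    · have e0 : ∀ (i : I) (v : X), #{e : ZMod 2 | c (i, v, e) q ∧ c (i, v, e) q'}
          = if v ⬝ᵥ (q.1 - q'.1) = h i q'.1 - h i q.1 + (q'.2 - q.2) then 1 else 0 := by
        intro i v
        have := z2 (h i q.1 + v ⬝ᵥ q.1 + q.2) (h i q'.1 + v ⬝ᵥ q'.1 + q'.2)
        have e3 : h i q.1 + v ⬝ᵥ q.1 + q.2 = h i q'.1 + v ⬝ᵥ q'.1 + q'.2 ↔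
            v ⬝ᵥ (q.1 - q'.1) = h i q'.1 - h i q.1 + (q'.2 - q.2) := by
          rw [dotProduct_sub]
          constructor <;> intro h' <;> linear_combination h'
        simp only [e3] at this
        rw [← this]
        congr 1; ext e
        simp only [c, f, decide_eq_true_eq, Finset.mem_filter, Finset.mem_univ, true_and]
        rw [show h i q.1 + v ⬝ᵥ q.1 + e + q.2 = h i q.1 + v ⬝ᵥ q.1 + q.2 + e by ring,
          show h i q'.1 + v ⬝ᵥ q'.1 + e + q'.2 = h i q'.1 + v ⬝ᵥ q'.1 + q'.2 + e by ring]
      have e1 : #{u | c u q ∧ c u q'} = ∑ i : I, #{v : X | v ⬝ᵥ (q.1 - q'.1)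
          = h i q'.1 - h i q.1 + (q'.2 - q.2)} := by
        rw [Finset.card_filter, Fintype.sum_prod_type]
        simp_rw [Fintype.sum_prod_type, ← Finset.card_filter, e0, ← Finset.card_filter]
      rw [e1, hU]
      by_cases ht : q.1 = q'.1
      · have h2 : q'.2 - q.2 ≠ 0 := fun h0 => hq (Prod.ext ht (sub_eq_zero.1 h0).symm)
        have : ∀ i : I, #{v : X | v ⬝ᵥ (q.1 - q'.1)
            = h i q'.1 - h i q.1 + (q'.2 - q.2)} = 0 := by
          intro i
          rw [Finset.card_eq_zero, Finset.filter_eq_empty_iff]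
          intro v _ hv
          rw [ht, sub_self, dotProduct_zero, sub_self, zero_add] at hv
          exact h2 hv.symm
        simp [this]
      · have : ∀ i : I, 2 * #{v : X | v ⬝ᵥ (q.1 - q'.1)
            = h i q'.1 - h i q.1 + (q'.2 - q.2)} = 2 ^ a := fun i => by
          rw [← hX]; exact two_mul_card_dotProduct (sub_ne_zero.2 ht) _
        rw [show 4 = 2 * 2 by norm_num, mul_assoc, Finset.mul_sum]
        simp only [this, Finset.sum_const, Finset.card_univ, smul_eq_mul, I, Fintype.card_fin]
        rw [pow_succ, pow_add]
        exact le_of_eq (by ring)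
    · rw [hdist, hT]
      by_cases hi : u.1 = u'.1
      · by_cases hv : u.2.1 = u'.2.1
        · have he : u.2.2 ≠ u'.2.2 := fun he => hu (Prod.ext hi (Prod.ext hv he))
          rw [Finset.filter_false_of_mem]
          · simp
          · intro t _ ht
            simp only [f, hi, hv] at ht
            exact he (add_left_cancel ht)
        · have e2 := two_mul_card_dotProduct (sub_ne_zero.2 hv) (u'.2.2 - u.2.2)
          have e3 : #{t : X | f u t = f u' t}
              = #{t : X | t ⬝ᵥ (u.2.1 - u'.2.1) = u'.2.2 - u.2.2} := by
            congr 1; ext t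
            simp only [f, hi, Finset.mem_filter, Finset.mem_univ, true_and]
            rw [dotProduct_comm t, sub_dotProduct]
            constructor <;> intro h' <;> linear_combination h'
          change 2 * #{t : X | _} = Fintype.card X at e2
          rw [hX] at e2
          rw [e3, pow_succ]
          omega
      · have e2 := hh _ _ hi (u'.2.1 - u.2.1) (u'.2.2 - u.2.2)
        have e3 : #{t : X | f u t = f u' t}
            = #{t : X | h u.1 t - h u'.1 t = (u'.2.1 - u.2.1) ⬝ᵥ t + (u'.2.2 - u.2.2)} := by
          congr 1; ext t
          simp only [f, Finset.mem_filter, Finset.mem_univ, true_and]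
          rw [sub_dotProduct]
          constructor <;> intro h' <;> linear_combination h'
        rw [e3, pow_succ]
        change 4 * #{t : X | _} ≤ _ at e2
        omega
  exact ⟨_, hc.comp_equiv (Fintype.equivFinOfCardEq hU).symm (Fintype.equivFinOfCardEq hT).symm⟩

end Codes

/-! ### The product relation and its mixing property. -/

section ProductRelation

variable {s : ℕ} {M : Fin (s + 1) → Type} [∀ i, Fintype (M i)] [∀ i, DecidableEq (M i)]

theorem card_filter_forall_castSucc (B : ∀ l : Fin s, Finset (M l.castSucc)) :
    #{y : ∀ i, M i | ∀ l : Fin s, y l.castSucc ∈ B l}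
      = (∏ l, #(B l)) * Fintype.card (M (Fin.last s)) := by
  let A : ∀ i, Finset (M i) := Fin.lastCases univ B
  have h : ({y : ∀ i, M i | ∀ l : Fin s, y l.castSucc ∈ B l} : Finset (∀ i, M i))
      = Fintype.piFinset A := by
    ext y
    simp [A, Fintype.mem_piFinset, Fin.forall_fin_succ']
  rw [h, Fintype.card_piFinset, Fin.prod_univ_castSucc]
  simp [A]

theorem card_filter_forall_succ (B : ∀ l : Fin s, Finset (M l.succ)) :
    #{x : ∀ i, M i | ∀ l : Fin s, x l.succ ∈ B l} = Fintype.card (M 0) * ∏ l, #(B l) := by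
  let A : ∀ i, Finset (M i) := Fin.cases univ B
  have h : ({x : ∀ i, M i | ∀ l : Fin s, x l.succ ∈ B l} : Finset (∀ i, M i))
      = Fintype.piFinset A := by
    ext y
    simp [A, Fintype.mem_piFinset, Fin.forall_fin_succ]
  rw [h, Fintype.card_piFinset, Fin.prod_univ_succ]
  simp [A]

theorem card_filter_zero_eq (a : M 0) :
    #{x : ∀ i, M i | x 0 = a} = ∏ l : Fin s, Fintype.card (M l.succ) := by
  let A : ∀ i, Finset (M i) := Fin.cases {a} fun _ => univ
  have h : ({x : ∀ i, M i | x 0 = a} : Finset (∀ i, M i)) = Fintype.piFinset A := by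
    ext y
    simp [A, Fintype.mem_piFinset, Fin.forall_fin_succ]
  rw [h, Fintype.card_piFinset, Fin.prod_univ_succ]
  simp [A]

/-- The relation on a product of alphabets that composes the codes between consecutive alphabets. -/
def codeRel (c : ∀ l : Fin s, M l.succ → M l.castSucc → Bool) (x y : ∀ i, M i) : Prop :=
  ∀ l, c l (x l.succ) (y l.castSucc)

instance (c : ∀ l : Fin s, M l.succ → M l.castSucc → Bool) : DecidableRel (codeRel c) :=
  fun _ _ => inferInstanceAs (Decidable (∀ _, _))

variable {c : ∀ l : Fin s, M l.succ → M l.castSucc → Bool}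

/-- The s conditions on y concern different letters, and each holds for half of the alphabet. -/
theorem card_codeRel_mul (hc : ∀ l, IsCode (c l)) (x : ∀ i, M i) :
    #{y | codeRel c x y} * 2 ^ s = Fintype.card (∀ i, M i) := by
  have h := card_filter_forall_castSucc fun l => ({t | c l (x l.succ) t} : Finset _)
  simp only [Finset.mem_filter, Finset.mem_univ, true_and] at h
  have h2 : ∏ l : Fin s, 2 * #{t | c l (x l.succ) t}
      = ∏ l : Fin s, Fintype.card (M l.castSucc) :=
    Finset.prod_congr rfl fun l _ => (hc l).row _
  rw [Finset.prod_mul_distrib, Finset.prod_const, Finset.card_univ, Fintype.card_fin] at h2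
  rw [Fintype.card_pi, Fin.prod_univ_castSucc, ← h2]
  change #{y : ∀ i, M i | ∀ l, c l (x l.succ) (y l.castSucc)} * 2 ^ s = _
  rw [h]; ring

/-- Only the letter y_l feels the extra condition. Two distinct rows share at most 3/8 of the
columns, which is 3/4 of the half allowed by one row. -/
theorem card_codeRel_and_le (hc : ∀ l, IsCode (c l)) {x x' : ∀ i, M i} {l : Fin s}
    (hl : x l.succ ≠ x' l.succ) :
    4 * #{y | codeRel c x y ∧ c l (x' l.succ) (y l.castSucc)} ≤ 3 * #{y | codeRel c x y} := by
  have h := card_filter_forall_castSucc fun l => ({t | c l (x l.succ) t} : Finset _)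
  have h' := card_filter_forall_castSucc fun l' => ({t | c l' (x l'.succ) t ∧
    (l' = l → c l' (x' l'.succ) t)} : Finset _)
  simp only [Finset.mem_filter, Finset.mem_univ, true_and] at h h'
  have e : ∀ y : ∀ i, M i, (codeRel c x y ∧ c l (x' l.succ) (y l.castSucc)) ↔
      ∀ l', c l' (x l'.succ) (y l'.castSucc) ∧ (l' = l → c l' (x' l'.succ) (y l'.castSucc)) := by
    intro y
    constructor
    · rintro ⟨h1, h2⟩ l'
      exact ⟨h1 l', by rintro rfl; exact h2⟩
    · exact fun h1 => ⟨fun l' => (h1 l').1, (h1 l).2 rfl⟩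
  simp only [e]
  change _ ≤ 3 * #{y : ∀ i, M i | ∀ l, c l (x l.succ) (y l.castSucc)}
  rw [h, h', ← Finset.mul_prod_erase univ _ (Finset.mem_univ l),
    ← Finset.mul_prod_erase univ (fun l => #{t | c l (x l.succ) t}) (Finset.mem_univ l)]
  have e2 : ∏ l' ∈ univ.erase l, #{t | c l' (x l'.succ) t ∧ (l' = l → c l' (x' l'.succ) t)}
      = ∏ l' ∈ univ.erase l, #{t | c l' (x l'.succ) t} := by
    refine Finset.prod_congr rfl fun l' hl' => ?_
    congr 1; ext t
    simp [Finset.ne_of_mem_erase hl']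
  have e3 : 4 * #{t | c l (x l.succ) t ∧ (l = l → c l (x' l.succ) t)}
      ≤ 3 * #{t | c l (x l.succ) t} := by
    have h1 := (hc l).row (x l.succ)
    have h2 := (hc l).dist _ _ hl
    simp only [forall_const]
    omega
  rw [e2, ← mul_assoc, ← mul_assoc, ← mul_assoc, ← mul_assoc]
  exact Nat.mul_le_mul_right _ (Nat.mul_le_mul_right _ e3)

theorem card_common_le (hc : ∀ l, IsCode (c l)) (y y' : ∀ i, M i) :
    4 ^ s * #{x | codeRel c x y ∧ codeRel c x y'}
      ≤ Fintype.card (∀ i, M i) * ∏ l : Fin s, if y l.castSucc = y' l.castSucc then 2 else 1 := by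
  have h := card_filter_forall_succ fun l =>
    ({u | c l u (y l.castSucc) ∧ c l u (y' l.castSucc)} : Finset _)
  simp only [Finset.mem_filter, Finset.mem_univ, true_and] at h
  have e : ∀ x : ∀ i, M i, (codeRel c x y ∧ codeRel c x y') ↔
      ∀ l, c l (x l.succ) (y l.castSucc) ∧ c l (x l.succ) (y' l.castSucc) :=
    fun x => forall_and.symm
  simp only [e]
  rw [h, Fintype.card_pi, Fin.prod_univ_succ]
  have h4 : ∏ l : Fin s, 4 * #{u | c l u (y l.castSucc) ∧ c l u (y' l.castSucc)}
      ≤ ∏ l : Fin s, Fintype.card (M l.succ) * (if y l.castSucc = y' l.castSucc then 2 else 1) := by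
    refine Finset.prod_le_prod' fun l _ => ?_
    split_ifs with hy
    · have := (hc l).col (y' l.castSucc)
      simp only [hy, and_self]; omega
    · rw [mul_one]; exact (hc l).pair _ _ hy
  rw [Finset.prod_mul_distrib, Finset.prod_mul_distrib, Finset.prod_const, Finset.card_univ,
    Fintype.card_fin] at h4
  calc _ = Fintype.card (M 0) * (4 ^ s * ∏ l : Fin s,
        #{u | c l u (y l.castSucc) ∧ c l u (y' l.castSucc)}) := by ring
    _ ≤ _ := Nat.mul_le_mul_left _ h4
    _ = _ := by ring

/-- The slack 1 - 2^{-s} makes the induction close, since the new factor exceeds 1 by at most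
2^{-22-s}. -/
theorem prod_one_add_le {s : ℕ} (m : Fin s → ℝ) (hm : ∀ l : Fin s, (2 : ℝ) ^ (22 + (l : ℕ)) ≤ m l) :
    ∏ l, (1 + 1 / m l) ≤ 1 + 1 / 2 ^ 20 * (1 - 1 / 2 ^ s) := by
  induction s with
  | zero => simp
  | succ s ih =>
    rw [Fin.prod_univ_castSucc]
    have h1 := ih (fun l => m l.castSucc) fun l => by simpa using hm l.castSucc
    have h2 : 1 / m (Fin.last s) ≤ 1 / 2 ^ 22 * (1 / 2 ^ s) := by
      rw [show 1 / (2 : ℝ) ^ 22 * (1 / 2 ^ s) = 1 / 2 ^ (22 + s) by rw [pow_add]; field_simp]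
      refine one_div_le_one_div_of_le (by positivity) ?_
      simpa using hm (Fin.last s)
    have h3 : 0 < 1 / (2 : ℝ) ^ s := by positivity
    have h4 : 1 / (2 : ℝ) ^ s ≤ 1 := by
      rw [div_le_one (by positivity)]; exact one_le_pow₀ (by norm_num)
    have h5 : 1 / (2 : ℝ) ^ (s + 1) = 1 / 2 ^ s / 2 := by rw [pow_succ]; field_simp
    have h6 : 0 ≤ 1 + 1 / m (Fin.last s) := by
      have := (by positivity : (0 : ℝ) < 2 ^ (22 + ((Fin.last s : Fin (s + 1)) : ℕ))).trans_le
        (hm (Fin.last s))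
      positivity
    rw [h5]
    refine (mul_le_mul_of_nonneg_right h1 h6).trans ?_
    set z := 1 / (2 : ℝ) ^ s
    have h7 : (1 + 1 / 2 ^ 20 * (1 - z)) * (1 + 1 / m (Fin.last s))
        ≤ (1 + 1 / 2 ^ 20 * (1 - z)) * (1 + 1 / 2 ^ 22 * z) := by
      refine mul_le_mul_of_nonneg_left (by linarith) ?_
      have : 0 ≤ 1 / (2 : ℝ) ^ 20 * (1 - z) := mul_nonneg (by positivity) (by linarith)
      linarith
    refine h7.trans ?_
    nlinarith

theorem sum_prod_ite_le (hM : ∀ l : Fin s, 2 ^ (22 + (l : ℕ)) ≤ Fintype.card (M l.castSucc))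
    (y : ∀ i, M i) :
    ∑ y' : ∀ i, M i, ∏ l : Fin s, (if y l.castSucc = y' l.castSucc then (2 : ℝ) else 1)
      ≤ Fintype.card (∀ i, M i) * (1 + 1 / 2 ^ 20) := by
  let g : ∀ i, M i → ℝ := Fin.lastCases (fun _ => 1)
    fun l t => if y l.castSucc = t then (2 : ℝ) else 1
  have h1 : ∀ y' : ∀ i, M i, ∏ l : Fin s, (if y l.castSucc = y' l.castSucc then (2 : ℝ) else 1)
      = ∏ i, g i (y' i) := by
    intro y'
    rw [Fin.prod_univ_castSucc]; simp [g]
  have hpos : ∀ l : Fin s, (0 : ℝ) < Fintype.card (M l.castSucc) := fun l => by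
    have := (by positivity : 0 < 2 ^ (22 + (l : ℕ))).trans_le (hM l)
    exact_mod_cast this
  have h2 : ∀ l : Fin s, ∑ t : M l.castSucc, g l.castSucc t
      = Fintype.card (M l.castSucc) * (1 + 1 / (Fintype.card (M l.castSucc) : ℝ)) := by
    intro l
    have : ∀ t, g l.castSucc t = 1 + if y l.castSucc = t then (1 : ℝ) else 0 := by
      intro t; simp only [g, Fin.lastCases_castSucc]; split_ifs <;> norm_num
    simp only [this, Finset.sum_add_distrib, Finset.sum_ite_eq, Finset.mem_univ, if_true]
    have := (hpos l).ne'
    field_simp; simp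
  have h3 : ∑ t : M (Fin.last s), g (Fin.last s) t = Fintype.card (M (Fin.last s)) := by
    simp [g]
  rw [Finset.sum_congr rfl fun y' _ => h1 y', ← Fintype.prod_sum, Fin.prod_univ_castSucc, h3,
    Finset.prod_congr rfl fun l _ => h2 l, Finset.prod_mul_distrib, Fintype.card_pi,
    Fin.prod_univ_castSucc]
  push_cast
  have h4 := prod_one_add_le (fun l : Fin s => (Fintype.card (M l.castSucc) : ℝ))
    fun l => by exact_mod_cast hM l
  have h5 : 1 + 1 / (2 : ℝ) ^ 20 * (1 - 1 / 2 ^ s) ≤ 1 + 1 / 2 ^ 20 := by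
    have : 0 < 1 / (2 : ℝ) ^ s := by positivity
    nlinarith
  calc _ = (∏ l : Fin s, (Fintype.card (M l.castSucc) : ℝ)) * Fintype.card (M (Fin.last s))
        * ∏ l : Fin s, (1 + 1 / (Fintype.card (M l.castSucc) : ℝ)) := by ring
    _ ≤ _ := mul_le_mul_of_nonneg_left (h4.trans h5) (by positivity)

/-- Few vertices have a neighbourhood in which a given sparse set is over-represented. -/
theorem card_overrepresented_le (hc : ∀ l, IsCode (c l))
    (hM : ∀ l : Fin s, 2 ^ (22 + (l : ℕ)) ≤ Fintype.card (M l.castSucc)) (Y : Finset (∀ i, M i))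
    (hY : 2 ^ 10 * #Y ≤ Fintype.card (∀ i, M i)) :
    2 ^ 11 * #{x | #{y | codeRel c x y} < 16 * #{y ∈ Y | codeRel c x y}}
      ≤ Fintype.card (∀ i, M i) := by
  set n := Fintype.card (∀ i, M i) with hn
  set X : Finset (∀ i, M i) := {x | #{y | codeRel c x y} < 16 * #{y ∈ Y | codeRel c x y}} with hX
  rcases Nat.eq_zero_or_pos n with h0 | h0
  · have : IsEmpty (∀ i, M i) := Fintype.card_eq_zero_iff.1 h0
    rw [Finset.eq_empty_of_isEmpty X]; simp
  have hn0 : (0 : ℝ) < n := by exact_mod_cast h0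
  have h1 : ∑ x, (#{y ∈ Y | codeRel c x y} : ℝ) ^ 2
      = ∑ y ∈ Y, ∑ y' ∈ Y, (#{x | codeRel c x y ∧ codeRel c x y'} : ℝ) := by
    have e1 : ∀ x, (#{y ∈ Y | codeRel c x y} : ℝ) ^ 2
        = ∑ y ∈ Y, ∑ y' ∈ Y, if codeRel c x y ∧ codeRel c x y' then (1 : ℝ) else 0 := by
      intro x
      rw [Finset.card_filter, sq]
      push_cast
      rw [Finset.sum_mul_sum]
      refine Finset.sum_congr rfl fun y _ => Finset.sum_congr rfl fun y' _ => ?_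
      by_cases a1 : codeRel c x y <;> by_cases a2 : codeRel c x y' <;> simp [a1, a2]
    rw [Finset.sum_congr rfl fun x _ => e1 x, Finset.sum_comm]
    refine Finset.sum_congr rfl fun y _ => ?_
    rw [Finset.sum_comm]
    refine Finset.sum_congr rfl fun y' _ => ?_
    rw [Finset.card_filter]; push_cast; rfl
  set w : (∀ i, M i) → (∀ i, M i) → ℝ := fun y y' =>
    ∏ l : Fin s, (if y l.castSucc = y' l.castSucc then (2 : ℝ) else 1) with hw
  have hw1 : ∀ y y', 1 ≤ w y y' := by
    intro y y'
    simp only [hw]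
    exact Finset.prod_induction _ (fun z : ℝ => 1 ≤ z)
      (fun a b ha hb => one_le_mul_of_one_le_of_one_le ha hb) le_rfl fun l _ => by split_ifs <;> norm_num
  have h2 : (4 : ℝ) ^ s * ∑ x, (#{y ∈ Y | codeRel c x y} : ℝ) ^ 2
      ≤ n * ∑ y ∈ Y, ∑ y' ∈ Y, w y y' := by
    rw [h1, Finset.mul_sum, Finset.mul_sum]
    refine Finset.sum_le_sum fun y _ => ?_
    rw [Finset.mul_sum, Finset.mul_sum]
    refine Finset.sum_le_sum fun y' _ => ?_
    have := card_common_le hc y y'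
    have h3 : ((4 ^ s * #{x | codeRel c x y ∧ codeRel c x y'} : ℕ) : ℝ)
        ≤ ((n * ∏ l : Fin s, if y l.castSucc = y' l.castSucc then 2 else 1 : ℕ) : ℝ) := by
      exact_mod_cast this
    push_cast at h3
    exact h3
  -- The excess of w over 1 is nonnegative, so it may be summed over all pairs instead of Y × Y;
  -- there it is small because random words rarely share a letter.
  have h3 : ∑ y ∈ Y, ∑ y' ∈ Y, (w y y' - 1) ≤ n * (n * (1 / 2 ^ 20)) := by
    calc _ ≤ ∑ y ∈ Y, ∑ y', (w y y' - 1) := by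
          refine Finset.sum_le_sum fun y _ => Finset.sum_le_sum_of_subset_of_nonneg
            (Finset.subset_univ _) fun y' _ _ => sub_nonneg.2 (hw1 y y')
      _ ≤ ∑ y, ∑ y', (w y y' - 1) := by
          refine Finset.sum_le_sum_of_subset_of_nonneg (Finset.subset_univ _)
            fun y _ _ => Finset.sum_nonneg fun y' _ => sub_nonneg.2 (hw1 y y')
      _ ≤ ∑ y : ∀ i, M i, (n : ℝ) * (1 / 2 ^ 20) := by
          refine Finset.sum_le_sum fun y _ => ?_
          have := sum_prod_ite_le hM y
          rw [Finset.sum_sub_distrib]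
          simp only [Finset.sum_const, Finset.card_univ, nsmul_eq_mul, mul_one]
          rw [← hn] at this ⊢
          linarith
      _ = _ := by simp [hn]
  have h4 : ∑ y ∈ Y, ∑ y' ∈ Y, w y y' ≤ (#Y : ℝ) ^ 2 + n * (n * (1 / 2 ^ 20)) := by
    simp only [Finset.sum_sub_distrib, Finset.sum_const, nsmul_eq_mul, mul_one] at h3
    nlinarith
  have hYr : (2 : ℝ) ^ 10 * #Y ≤ n := by exact_mod_cast hY
  have h5 : (#Y : ℝ) ^ 2 ≤ n * (n * (1 / 2 ^ 20)) := by
    have := pow_le_pow_left₀ (by positivity) hYr 2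
    rw [mul_pow] at this
    nlinarith
  have h6 : ∀ x ∈ X, (n : ℝ) ^ 2 ≤ 256 * (4 ^ s * (#{y ∈ Y | codeRel c x y} : ℝ) ^ 2) := by
    intro x hx
    have a1 := (Finset.mem_filter.1 hx).2
    have a2 := card_codeRel_mul hc x
    have a3 : n ≤ 16 * #{y ∈ Y | codeRel c x y} * 2 ^ s := by
      rw [hn, ← a2]; exact Nat.mul_le_mul_right _ a1.le
    have a4 : (n : ℝ) ≤ 16 * #{y ∈ Y | codeRel c x y} * 2 ^ s := by exact_mod_cast a3
    have a5 := pow_le_pow_left₀ hn0.le a4 2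
    have a6 : (4 : ℝ) ^ s = (2 ^ s) ^ 2 := by rw [← pow_mul, mul_comm, pow_mul]; norm_num
    rw [a6]; nlinarith
  -- Second-moment method: the average degree is n/2^s, so an overrepresented vertex contributes at
  -- least n²/256 to the normalised second moment, which is at most 2n³/2^20. Hence #X ≤ n/2^11.
  have h7 : (#X : ℝ) * (n : ℝ) ^ 2 ≤ 256 * (n * (2 * (n * (n * (1 / 2 ^ 20))))) := by
    calc (#X : ℝ) * (n : ℝ) ^ 2 = ∑ x ∈ X, (n : ℝ) ^ 2 := by simp
      _ ≤ ∑ x ∈ X, 256 * (4 ^ s * (#{y ∈ Y | codeRel c x y} : ℝ) ^ 2) := Finset.sum_le_sum h6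
      _ ≤ ∑ x, 256 * (4 ^ s * (#{y ∈ Y | codeRel c x y} : ℝ) ^ 2) :=
        Finset.sum_le_sum_of_subset_of_nonneg (Finset.subset_univ _) fun _ _ _ => by positivity
      _ = 256 * (4 ^ s * ∑ x, (#{y ∈ Y | codeRel c x y} : ℝ) ^ 2) := by
        rw [← Finset.mul_sum, ← Finset.mul_sum]
      _ ≤ 256 * (n * ∑ y ∈ Y, ∑ y' ∈ Y, w y y') := by linarith
      _ ≤ _ := by
        have : n * ∑ y ∈ Y, ∑ y' ∈ Y, w y y' ≤ n * (2 * (n * (n * (1 / 2 ^ 20)))) :=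
          mul_le_mul_of_nonneg_left (by linarith) hn0.le
        linarith
  have h8 : (2 : ℝ) ^ 11 * #X ≤ n := by
    have hn2 : (0 : ℝ) < (n : ℝ) ^ 2 := by positivity
    refine le_of_mul_le_mul_right ?_ hn2
    nlinarith
  exact_mod_cast h8

end ProductRelation

/-! ### Pairs of parts with a large empty sub-pair. -/

section Split

variable {X : Type}

/-- The pair `(A, B)` contains a large sub-pair without edges of `G`. -/
def Split (G : SimpleGraph X) (θ : ℝ) (A B : Finset X) : Prop :=
  ∃ A' ⊆ A, ∃ B' ⊆ B, θ * (#A : ℝ) ≤ #A' ∧ θ * (#B : ℝ) ≤ #B' ∧ ∀ a ∈ A', ∀ b ∈ B', ¬ G.Adj a b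

theorem sum_adj_le_card (G : SimpleGraph X) (A B : Finset X) :
    ∑ a ∈ A, ∑ b ∈ B, adj G a b ≤ #A * #B := by
  calc _ ≤ ∑ a ∈ A, ∑ b ∈ B, (1 : ℝ) :=
        Finset.sum_le_sum fun a _ => Finset.sum_le_sum fun b _ => adj_le_one G a b
    _ = _ := by simp

/-- All edges of G' in the empty sub-pair are edits. Regularity carries this low density over to the
whole pair, so G has few edges there or the pair was heavily edited. -/
theorem sum_adj_le_of_split_of_regular {G G' : SimpleGraph X} {ε θ : ℝ} (hθ : 0 < θ)
    (hεθ : ε ≤ θ) {A B : Finset X} (hA : A.Nonempty) (hB : B.Nonempty) (hs : Split G θ A B)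
    (hr : IsRegularPair G' ε A B) :
    ∑ a ∈ A, ∑ b ∈ B, adj G a b
      ≤ ε * (#A * #B) + (1 + 1 / θ ^ 2) * ∑ a ∈ A, ∑ b ∈ B, |adj G' a b - adj G a b| := by
  classical
  obtain ⟨A', hA', B', hB', hcA, hcB, hno⟩ := hs
  have hA0 : (0 : ℝ) < #A := by exact_mod_cast Finset.card_pos.2 hA
  have hB0 : (0 : ℝ) < #B := by exact_mod_cast Finset.card_pos.2 hB
  have hA'0 : (0 : ℝ) < #A' := (mul_pos hθ hA0).trans_le hcA
  have hB'0 : (0 : ℝ) < #B' := (mul_pos hθ hB0).trans_le hcB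
  set Δ := ∑ a ∈ A, ∑ b ∈ B, |adj G' a b - adj G a b| with hΔ
  have h1 := (abs_le.1 (hr A' hA' B' hB' ((mul_le_mul_of_nonneg_right hεθ hA0.le).trans hcA)
    ((mul_le_mul_of_nonneg_right hεθ hB0.le).trans hcB))).2
  rw [edgeDensity_eq_sum, edgeDensity_eq_sum] at h1
  have h2 : ∑ a ∈ A', ∑ b ∈ B', adj G' a b ≤ Δ := by
    calc _ ≤ ∑ a ∈ A', ∑ b ∈ B', |adj G' a b - adj G a b| := by
          refine Finset.sum_le_sum fun a ha => Finset.sum_le_sum fun b hb => ?_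
          have : adj G a b = 0 := if_neg (hno a ha b hb)
          rw [this, sub_zero]; exact le_abs_self _
      _ ≤ ∑ a ∈ A', ∑ b ∈ B, |adj G' a b - adj G a b| :=
          Finset.sum_le_sum fun a _ => Finset.sum_le_sum_of_subset_of_nonneg hB'
            fun _ _ _ => abs_nonneg _
      _ ≤ _ := Finset.sum_le_sum_of_subset_of_nonneg hA'
            fun _ _ _ => Finset.sum_nonneg fun _ _ => abs_nonneg _
  have hΔ0 : 0 ≤ Δ := Finset.sum_nonneg fun _ _ => Finset.sum_nonneg fun _ _ => abs_nonneg _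
  have h3 : ∑ a ∈ A, ∑ b ∈ B, adj G a b ≤ ∑ a ∈ A, ∑ b ∈ B, adj G' a b + Δ := by
    rw [hΔ, ← Finset.sum_add_distrib]
    refine Finset.sum_le_sum fun a _ => ?_
    rw [← Finset.sum_add_distrib]
    refine Finset.sum_le_sum fun b _ => ?_
    have := neg_abs_le (adj G' a b - adj G a b)
    linarith
  have h4 : (∑ a ∈ A', ∑ b ∈ B', adj G' a b) / (#A' * #B') ≤ Δ / (θ ^ 2 * (#A * #B)) := by
    refine div_le_div₀ hΔ0 h2 (by positivity) ?_
    calc θ ^ 2 * (#A * #B) = (θ * #A) * (θ * #B) := by ring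
      _ ≤ _ := mul_le_mul hcA hcB (by positivity) hA'0.le
  have h5 : (∑ a ∈ A, ∑ b ∈ B, adj G' a b) / (#A * #B) ≤ ε + Δ / (θ ^ 2 * (#A * #B)) := by
    linarith
  rw [div_le_iff₀ (by positivity)] at h5
  have h6 : (ε + Δ / (θ ^ 2 * (#A * #B))) * (#A * #B) = ε * (#A * #B) + 1 / θ ^ 2 * Δ := by
    field_simp
  linarith

variable [Fintype X] [DecidableEq X]

theorem sum_parts_eq (P : Finpartition (univ : Finset X)) (F : Finset X → X → ℝ) :
    ∑ A ∈ P.parts, ∑ a ∈ A, F A a = ∑ a, F (P.part a) a := by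
  rw [← Finset.sum_fiberwise_of_maps_to (s := univ) (t := P.parts) (g := P.part)
    fun a _ => P.part_mem.2 (mem_univ a)]
  refine Finset.sum_congr rfl fun A hA => ?_
  have : A = Finset.filter (fun a => P.part a = A) univ := by
    ext a; simp [P.part_eq_iff_mem hA]
  exact Finset.sum_congr this fun a ha => by rw [(Finset.mem_filter.1 ha).2]

theorem sum_parts_product_eq (P : Finpartition (univ : Finset X))
    (F : Finset X → Finset X → X → X → ℝ) :
    ∑ q ∈ P.parts ×ˢ P.parts, ∑ a ∈ q.1, ∑ b ∈ q.2, F q.1 q.2 a b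
      = ∑ a, ∑ b, F (P.part a) (P.part b) a b := by
  rw [Finset.sum_product]
  have h : ∀ A ∈ P.parts, ∑ B ∈ P.parts, ∑ a ∈ A, ∑ b ∈ B, F A B a b
      = ∑ a ∈ A, ∑ b, F A (P.part b) a b := by
    intro A _
    rw [Finset.sum_comm]
    exact Finset.sum_congr rfl fun a _ => sum_parts_eq P fun B b => F A B a b
  rw [Finset.sum_congr rfl h]
  exact sum_parts_eq P fun A a => ∑ b, F A (P.part b) a b

theorem card_part_le_two_mul_div {P : Finpartition (univ : Finset X)} (hP : P.IsEquipartition)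
    {A : Finset X} (hA : A ∈ P.parts) : (#A : ℝ) ≤ 2 * (Fintype.card X / #P.parts) := by
  have h1 := hP.card_part_le_average_add_one hA
  have hk : 0 < #P.parts := Finset.card_pos.2 ⟨A, hA⟩
  have h2 := P.card_parts_le_card
  rw [Finset.card_univ] at h1 h2
  have h3 : (((Fintype.card X / #P.parts : ℕ)) : ℝ) ≤ Fintype.card X / #P.parts := Nat.cast_div_le
  have h4 : (1 : ℝ) ≤ Fintype.card X / #P.parts := by
    rw [le_div_iff₀ (by exact_mod_cast hk), one_mul]; exact_mod_cast h2
  have h5 : (#A : ℝ) ≤ ((Fintype.card X / #P.parts : ℕ) : ℝ) + 1 := by exact_mod_cast h1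
  linarith

open Classical in
/-- If `G` is close to `G'`, which has a regular partition, then few edges of `G` lie in split pairs
of parts. -/
theorem sum_split_le {G G' : SimpleGraph X} {ε θ δ : ℝ} (hε : 0 < ε) (hθ : 0 < θ)
    (hεθ : ε ≤ θ) (hclose : IsClose δ G G') {P : Finpartition (univ : Finset X)}
    (hP : P.IsEquipartition) (hreg : IsRegularPartition G' ε P) :
    ∑ a, ∑ b, (if Split G θ (P.part a) (P.part b) then adj G a b else 0)
      ≤ 5 * ε * (Fintype.card X : ℝ) ^ 2 + (1 + 1 / θ ^ 2) * (δ * ∑ a, ∑ b, adj G a b) := by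
  rw [← sum_parts_product_eq P fun A B a b => if Split G θ A B then adj G a b else 0]
  set n : ℝ := (Fintype.card X : ℝ) with hn
  have hq : ∀ q ∈ P.parts ×ˢ P.parts,
      ∑ a ∈ q.1, ∑ b ∈ q.2, (if Split G θ q.1 q.2 then adj G a b else 0)
      ≤ (if ¬ IsRegularPair G' ε q.1 q.2 then 4 * (n / #P.parts) ^ 2 else 0)
        + (∑ a ∈ q.1, ∑ b ∈ q.2, (ε + (1 + 1 / θ ^ 2) * |adj G' a b - adj G a b|)) := by
    intro q hq
    rw [Finset.mem_product] at hq
    have hA := P.nonempty_of_mem_parts hq.1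
    have hB := P.nonempty_of_mem_parts hq.2
    have e1 : ∑ a ∈ q.1, ∑ b ∈ q.2, (ε + (1 + 1 / θ ^ 2) * |adj G' a b - adj G a b|)
        = ε * (#q.1 * #q.2)
          + (1 + 1 / θ ^ 2) * ∑ a ∈ q.1, ∑ b ∈ q.2, |adj G' a b - adj G a b| := by
      simp only [Finset.sum_add_distrib, Finset.sum_const, nsmul_eq_mul, ← Finset.mul_sum]
      ring
    have hpos : 0 ≤ ∑ a ∈ q.1, ∑ b ∈ q.2, (ε + (1 + 1 / θ ^ 2) * |adj G' a b - adj G a b|) :=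
      Finset.sum_nonneg fun _ _ => Finset.sum_nonneg fun _ _ => by positivity
    by_cases hr : IsRegularPair G' ε q.1 q.2
    · rw [if_neg (not_not.2 hr), zero_add]
      by_cases hs : Split G θ q.1 q.2
      · simp only [hs, if_true]
        rw [e1]
        exact sum_adj_le_of_split_of_regular hθ hεθ hA hB hs hr
      · simpa only [hs, if_false, Finset.sum_const_zero] using hpos
    · rw [if_pos hr]
      have h1 : ∑ a ∈ q.1, ∑ b ∈ q.2, (if Split G θ q.1 q.2 then adj G a b else 0)
          ≤ #q.1 * #q.2 := by
        refine le_trans ?_ (sum_adj_le_card G q.1 q.2)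
        refine Finset.sum_le_sum fun a _ => Finset.sum_le_sum fun b _ => ?_
        split_ifs
        · exact le_rfl
        · exact adj_nonneg _ _ _
      have h2 := mul_le_mul (card_part_le_two_mul_div hP hq.1) (card_part_le_two_mul_div hP hq.2)
        (Nat.cast_nonneg _) (by positivity)
      rw [← hn] at h2
      nlinarith
  refine (Finset.sum_le_sum hq).trans ?_
  rw [Finset.sum_add_distrib, sum_parts_product_eq P fun _ _ a b =>
    (ε + (1 + 1 / θ ^ 2) * |adj G' a b - adj G a b|)]
  -- Parts have at most 2n/k vertices, k being the order of P, so the at most εk² irregular pairs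
  -- contain at most 4εn² ordered adjacencies; regular pairs add the fifth εn².
  have h1 : ∑ q ∈ P.parts ×ˢ P.parts,
      (if ¬ IsRegularPair G' ε q.1 q.2 then 4 * (n / #P.parts) ^ 2 else 0) ≤ 4 * ε * n ^ 2 := by
    rw [← Finset.sum_filter, Finset.sum_const, nsmul_eq_mul]
    have h2 := hreg
    unfold IsRegularPartition at h2
    calc _ ≤ ε * (#P.parts : ℝ) ^ 2 * (4 * (n / #P.parts) ^ 2) :=
          mul_le_mul_of_nonneg_right (by convert h2) (by positivity)
      _ ≤ _ := by
        rcases Nat.eq_zero_or_pos #P.parts with h0 | h0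
        · rw [h0]; simp only [Nat.cast_zero]; ring_nf; positivity
        · have : (0 : ℝ) < #P.parts := by exact_mod_cast h0
          rw [div_pow]; field_simp; exact le_rfl
  have h3 : ∑ a, ∑ b, (ε + (1 + 1 / θ ^ 2) * |adj G' a b - adj G a b|)
      = ε * n ^ 2 + (1 + 1 / θ ^ 2) * ∑ a, ∑ b, |adj G' a b - adj G a b| := by
    simp only [Finset.sum_add_distrib, Finset.sum_const, nsmul_eq_mul, ← Finset.mul_sum,
      Finset.card_univ, ← hn]
    ring
  have h4 : ∑ a, ∑ b, |adj G' a b - adj G a b| ≤ δ * ∑ a, ∑ b, adj G a b := by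
    rw [← two_mul_ncard_symmDiff, ← two_mul_ncard_edgeSet]
    unfold IsClose at hclose
    linarith
  have h5 := mul_le_mul_of_nonneg_left h4 (by positivity : 0 ≤ 1 + 1 / θ ^ 2)
  rw [h3]
  linarith

end Split

/-! ### The cyclic graph and the propagation of refinement. -/

section CyclicGraph

variable {V : Type} {R : V → V → Prop}

/-- Three copies of `V`, each related to the next one by `R`. -/
def cyclicGraph (R : V → V → Prop) : SimpleGraph (Fin 3 × V) where
  Adj a b := (b.1 = a.1 + 1 ∧ R a.2 b.2) ∨ (a.1 = b.1 + 1 ∧ R b.2 a.2)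
  symm := ⟨fun _ _ h => h.symm⟩
  loopless := ⟨fun a h => by
    have : ∀ j : Fin 3, ¬ j = j + 1 := by decide
    rcases h with h | h <;> exact this _ h.1⟩

/-- Three copies are needed here: with two, the successor would also be the predecessor and the
reversed relation would interfere. -/
theorem cyclicGraph_adj_succ {j : Fin 3} {x y : V} :
    (cyclicGraph R).Adj (j, x) (j + 1, y) ↔ R x y := by
  have : ∀ j : Fin 3, ¬ j = j + 1 + 1 := by decide
  simp [cyclicGraph, this j]

variable [Fintype V]

theorem sum_adj_cyclicGraph [DecidableRel R] {d : ℕ} (hd : ∀ x, #{y | R x y} = d) :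
    ∑ a, ∑ b, adj (cyclicGraph R) a b = 6 * (Fintype.card V * d) := by
  classical
  have h1 : ∀ a b : Fin 3 × V, adj (cyclicGraph R) a b
      = (if b.1 = a.1 + 1 then (if R a.2 b.2 then (1 : ℝ) else 0) else 0)
        + (if a.1 = b.1 + 1 then (if R b.2 a.2 then (1 : ℝ) else 0) else 0) := by
    intro a b
    have h3 : ∀ j : Fin 3, ¬ j = j + 1 + 1 := by decide
    by_cases c1 : b.1 = a.1 + 1
    · simp [adj, cyclicGraph, c1, h3]
    · simp only [adj, cyclicGraph, c1, false_and, false_or, if_false, zero_add, ite_and]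
  have h2 : ∀ a : Fin 3 × V,
      ∑ b : Fin 3 × V, (if b.1 = a.1 + 1 then (if R a.2 b.2 then (1 : ℝ) else 0) else 0) = d := by
    intro a
    rw [Fintype.sum_prod_type, Finset.sum_eq_single (a.1 + 1)]
    · simp [← hd a.2]
    · intro j _ hj; simp [hj]
    · simp
  simp only [h1, Finset.sum_add_distrib]
  rw [Finset.sum_comm (f := fun a b : Fin 3 × V =>
    if a.1 = b.1 + 1 then (if R b.2 a.2 then (1 : ℝ) else 0) else 0)]
  simp only [h2, Finset.sum_const, Finset.card_univ, Fintype.card_prod, Fintype.card_fin,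
    nsmul_eq_mul]
  push_cast; ring

variable [DecidableEq V]

/-- The vertices of the `j`-th copy whose class under `E` is less than `63/64` of their part. -/
def badSet (P : Finpartition (univ : Finset (Fin 3 × V))) (E : V → V → Prop) [DecidableRel E]
    (j : Fin 3) : Finset V :=
  {x | 64 * #{a ∈ P.part (j, x) | E x a.2} < 63 * #(P.part (j, x))}

/-- Double counting: a quarter of S × N is related, and the elements of N related to less than an
eighth of S account for at most half of that. -/
theorem card_frequent_ge {α β : Type*} (S : Finset α) (N : Finset β) (r : α → β → Prop)
    [∀ a b, Decidable (r a b)] (hS : 0 < #S) (h : ∀ a ∈ S, 4 * #{y ∈ N | ¬ r a y} ≤ 3 * #N) :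
    #N ≤ 8 * #{y ∈ N | #S ≤ 8 * #{a ∈ S | r a y}} := by
  have h1 : ∑ a ∈ S, #{y ∈ N | r a y} = ∑ y ∈ N, #{a ∈ S | r a y} := by
    simp only [Finset.card_filter]; exact Finset.sum_comm
  have h2 : #S * #N ≤ 4 * ∑ a ∈ S, #{y ∈ N | r a y} := by
    rw [Finset.mul_sum, ← smul_eq_mul, ← Finset.sum_const]
    refine Finset.sum_le_sum fun a ha => ?_
    have := h a ha
    have := Finset.card_filter_add_card_filter_not (s := N) (fun y => r a y)
    omega
  set T : Finset β := {y ∈ N | #S ≤ 8 * #{a ∈ S | r a y}} with hT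
  have h3 : 8 * ∑ y ∈ N, #{a ∈ S | r a y} ≤ #T * (8 * #S) + #N * #S := by
    rw [Finset.mul_sum, ← Finset.sum_filter_add_sum_filter_not N
      (fun y => #S ≤ 8 * #{a ∈ S | r a y})]
    refine add_le_add ?_ ?_
    · rw [← hT, ← smul_eq_mul (#T), ← Finset.sum_const]
      exact Finset.sum_le_sum fun y _ => Nat.mul_le_mul_left _
        (Finset.card_le_card (Finset.filter_subset _ _))
    · calc _ ≤ ∑ y ∈ N with ¬ #S ≤ 8 * #{a ∈ S | r a y}, #S :=
            Finset.sum_le_sum fun y hy => (not_le.1 (Finset.mem_filter.1 hy).2).le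
        _ ≤ ∑ y ∈ N, #S := Finset.sum_le_sum_of_subset (Finset.filter_subset _ _)
        _ = _ := by simp
  have h4 : #N * #S ≤ 8 * #T * #S := by
    rw [h1] at h2; nlinarith
  exact Nat.le_of_mul_le_mul_right h4 hS

/-- The inductive step: concentration of the parts on E-classes in copy j+1 yields concentration on
E'-classes in copy j. The relation `perp` certifies non-adjacency using only the E-class of y, so a
certificate for y extends to most of the part of y. -/
theorem card_badSet_le [DecidableRel R] {d D : ℕ} (hd : ∀ x, #{y | R x y} = d)
    (hdD : d * D = Fintype.card V) {E E' perp : V → V → Prop} [DecidableRel E] [DecidableRel E']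
    [DecidableRel perp]
    (hperp : ∀ x y, perp x y → ¬ R x y) (hcongr : ∀ x y y', E y y' → perp x y → perp x y')
    {P : Finpartition (univ : Finset (Fin 3 × V))} (hP : P.IsEquipartition)
    (hcopy : ∀ a, ∀ b ∈ P.part a, b.1 = a.1)
    (hsep : ∀ j x, ∀ a ∈ P.part (j, x), ¬ E' x a.2 →
      4 * #{y | R x y ∧ ¬ perp a.2 y} ≤ 3 * #{y | R x y})
    (hmix : ∀ Y : Finset V, 2 ^ 10 * #Y ≤ Fintype.card V →
      2 ^ 11 * #{x | #{y | R x y} < 16 * #{y ∈ Y | R x y}} ≤ Fintype.card V)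
    {G' : SimpleGraph (Fin 3 × V)} {ε δ : ℝ} (hε : 0 < ε) (hε1 : ε ≤ 1 / 512)
    (hδ : δ ≤ 1 / 2 ^ 38) (hεD : ε * D ≤ 1 / 2 ^ 22)
    (hclose : IsClose δ (cyclicGraph R) G') (hreg : IsRegularPartition G' ε P) (j : Fin 3)
    (hbad : 2 ^ 10 * #(badSet P E (j + 1)) ≤ Fintype.card V) :
    2 ^ 10 * #(badSet P E' j) ≤ Fintype.card V := by
  classical
  set n := Fintype.card V with hn
  set Y := badSet P E (j + 1) with hY
  set O : Finset V := {x | #{y | R x y} < 16 * #{y ∈ Y | R x y}} with hO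
  have hOn : 2 ^ 11 * #O ≤ n := hmix Y hbad
  rcases Nat.eq_zero_or_pos n with h0 | h0
  · have : IsEmpty V := Fintype.card_eq_zero_iff.1 h0
    rw [Finset.eq_empty_of_isEmpty (badSet P E' j)]; simp
  have hmem : ∀ a, a ∈ P.part a := fun a => P.mem_part_self.2 (mem_univ a)
  -- More than 1/64 of the part of x leaves its E'-class. At least d/8 neighbours y are certified
  -- non-adjacent to an eighth of these vertices, and at most d/16 of such y are bad; for the rest
  -- the pair of parts is split with constant 1/512.
  have hsplit : ∀ x ∈ badSet P E' j \ O, d ≤ 16 * #{y | R x y ∧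
      Split (cyclicGraph R) (1 / 512) (P.part (j, x)) (P.part (j + 1, y))} := by
    intro x hx
    obtain ⟨hx1, hx2⟩ := Finset.mem_sdiff.1 hx
    have hx1' := (Finset.mem_filter.1 hx1).2
    have hx2' : 16 * #{y ∈ Y | R x y} ≤ #{y | R x y} := by
      by_contra hc
      exact hx2 (Finset.mem_filter.2 ⟨mem_univ x, not_le.1 hc⟩)
    set Z := P.part (j, x) with hZ
    set Z₁ : Finset (Fin 3 × V) := {a ∈ Z | ¬ E' x a.2} with hZ₁
    have hZ₁c : #Z < 64 * #Z₁ := by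
      have : #{a ∈ Z | E' x a.2} + #Z₁ = #Z :=
        Finset.card_filter_add_card_filter_not (s := Z) (fun a => E' x a.2)
      omega
    set N : Finset V := {y | R x y} with hN
    have h1 := card_frequent_ge Z₁ N (fun a y => perp a.2 y) (by omega) (fun a ha => by
      have := hsep j x a (Finset.mem_filter.1 ha).1 (Finset.mem_filter.1 ha).2
      rw [hN, Finset.filter_filter]; exact this)
    set F : Finset V := {y ∈ N | #Z₁ ≤ 8 * #{a ∈ Z₁ | perp a.2 y}} with hF
    have h2 : F ⊆ Y.filter (fun y => R x y) ∪ univ.filter fun y => R x y ∧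
        Split (cyclicGraph R) (1 / 512) Z (P.part (j + 1, y)) := by
      intro y hy
      obtain ⟨hyN, hyF⟩ := Finset.mem_filter.1 hy
      have hRxy : R x y := (Finset.mem_filter.1 hyN).2
      by_cases hyY : y ∈ Y
      · exact Finset.mem_union_left _ (Finset.mem_filter.2 ⟨hyY, hRxy⟩)
      · refine Finset.mem_union_right _ (Finset.mem_filter.2 ⟨mem_univ y, hRxy, ?_⟩)
        set W := P.part (j + 1, y) with hW
        have hyW : 63 * #W ≤ 64 * #{b ∈ W | E y b.2} := by
          by_contra hc
          exact hyY (Finset.mem_filter.2 ⟨mem_univ y, not_le.1 hc⟩)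
        refine ⟨{a ∈ Z₁ | perp a.2 y},
          (Finset.filter_subset _ _).trans (Finset.filter_subset _ _), {b ∈ W | E y b.2},
          Finset.filter_subset _ _, ?_, ?_, ?_⟩
        · have : #Z ≤ 512 * #{a ∈ Z₁ | perp a.2 y} := by omega
          have h3 : (#Z : ℝ) ≤ 512 * #{a ∈ Z₁ | perp a.2 y} := by exact_mod_cast this
          linarith
        · have : #W ≤ 512 * #{b ∈ W | E y b.2} := by omega
          have h3 : (#W : ℝ) ≤ 512 * #{b ∈ W | E y b.2} := by exact_mod_cast this
          linarith
        · intro a ha b hb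
          obtain ⟨ha1, ha2⟩ := Finset.mem_filter.1 ha
          obtain ⟨hb1, hb2⟩ := Finset.mem_filter.1 hb
          have e1 : a = (j, a.2) := Prod.ext (hcopy (j, x) a (Finset.mem_filter.1 ha1).1) rfl
          have e2 : b = (j + 1, b.2) := Prod.ext (hcopy (j + 1, y) b hb1) rfl
          rw [e1, e2, cyclicGraph_adj_succ]
          exact hperp _ _ (hcongr _ _ _ hb2 ha2)
    have h3 := (Finset.card_le_card h2).trans (Finset.card_union_le _ _)
    have hNd : #N = d := hd x
    omega
  have hlow : (#(badSet P E' j \ O) : ℝ) * d ≤ 16 * ∑ a, ∑ b,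
      (if Split (cyclicGraph R) (1 / 512) (P.part a) (P.part b) then adj (cyclicGraph R) a b
        else 0) := by
    have hnn : ∀ a b : Fin 3 × V, 0 ≤ (if Split (cyclicGraph R) (1 / 512) (P.part a) (P.part b)
        then adj (cyclicGraph R) a b else 0) := fun a b => by
      split_ifs
      · exact adj_nonneg _ _ _
      · exact le_rfl
    have e1 : ∑ x ∈ badSet P E' j \ O, ∑ y, (if Split (cyclicGraph R) (1 / 512) (P.part (j, x))
        (P.part (j + 1, y)) then adj (cyclicGraph R) (j, x) (j + 1, y) else 0)
        ≤ ∑ a, ∑ b, (if Split (cyclicGraph R) (1 / 512) (P.part a) (P.part b)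
          then adj (cyclicGraph R) a b else 0) := by
      rw [Fintype.sum_prod_type]
      refine le_trans ?_ (Finset.single_le_sum (f := fun i => ∑ x, ∑ b,
        (if Split (cyclicGraph R) (1 / 512) (P.part (i, x)) (P.part b)
          then adj (cyclicGraph R) (i, x) b else 0))
        (fun i _ => Finset.sum_nonneg fun x _ => Finset.sum_nonneg fun b _ => hnn _ _)
        (mem_univ j))
      refine le_trans ?_ (Finset.sum_le_sum_of_subset_of_nonneg
        (Finset.subset_univ (badSet P E' j \ O))
        fun x _ _ => Finset.sum_nonneg fun b _ => hnn _ _)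
      refine Finset.sum_le_sum fun x _ => ?_
      rw [Fintype.sum_prod_type]
      exact Finset.single_le_sum (f := fun i => ∑ y,
        (if Split (cyclicGraph R) (1 / 512) (P.part (j, x)) (P.part (i, y))
          then adj (cyclicGraph R) (j, x) (i, y) else 0))
        (fun i _ => Finset.sum_nonneg fun y _ => hnn _ _) (mem_univ (j + 1))
    refine le_trans ?_ (mul_le_mul_of_nonneg_left e1 (by norm_num))
    rw [Finset.mul_sum, ← nsmul_eq_mul, ← Finset.sum_const]
    refine Finset.sum_le_sum fun x hx => ?_
    have e2 : ∑ y, (if Split (cyclicGraph R) (1 / 512) (P.part (j, x)) (P.part (j + 1, y))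
        then adj (cyclicGraph R) (j, x) (j + 1, y) else 0)
        = (#{y | R x y ∧ Split (cyclicGraph R) (1 / 512) (P.part (j, x)) (P.part (j + 1, y))} : ℝ)
        := by
      rw [Finset.card_filter]; push_cast
      refine Finset.sum_congr rfl fun y _ => ?_
      by_cases c1 : R x y <;>
        by_cases c2 : Split (cyclicGraph R) (1 / 512) (P.part (j, x)) (P.part (j + 1, y)) <;>
        simp [adj, cyclicGraph_adj_succ, c1, c2]
    rw [e2]
    exact_mod_cast hsplit x hx
  have hup := sum_split_le hε (by norm_num : (0 : ℝ) < 1 / 512) hε1 hclose hP hreg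
  rw [sum_adj_cyclicGraph hd, Fintype.card_prod, Fintype.card_fin] at hup
  push_cast at hup
  rw [← hn] at hup
  have hn0 : (0 : ℝ) < n := by exact_mod_cast h0
  have hdDr : (d : ℝ) * D = n := by exact_mod_cast hdD
  have hd0 : (0 : ℝ) < d := by
    have : 0 < d := Nat.pos_of_ne_zero fun h => by rw [h, zero_mul] at hdD; omega
    exact_mod_cast this
  have hεn : ε * n ≤ 1 / 2 ^ 22 * d := by
    calc ε * n = ε * D * d := by rw [← hdDr]; ring
      _ ≤ _ := mul_le_mul_of_nonneg_right hεD hd0.le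
  -- The factor 1 + 1/θ² is about 2^18, so δ ≤ 2^{-38} keeps the edit term below budget; `hεD` makes
  -- εn² small against the number nd of related pairs. Together with #O ≤ n/2^11 this restores the
  -- proportion 2^{-10}.
  have h5 : (#(badSet P E' j \ O) : ℝ) * d ≤ 1 / 2 ^ 11 * n * d := by
    refine (hlow.trans (mul_le_mul_of_nonneg_left hup (by norm_num))).trans ?_
    have e1 : δ * (6 * (n * d)) ≤ 1 / 2 ^ 38 * (6 * (n * d)) :=
      mul_le_mul_of_nonneg_right hδ (by positivity)
    have e2 : ε * n * n ≤ 1 / 2 ^ 22 * d * n := mul_le_mul_of_nonneg_right hεn hn0.le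
    have e3 : (0 : ℝ) < n * d := by positivity
    norm_num at e1 e2 ⊢
    nlinarith
  have h6 := le_of_mul_le_mul_right h5 hd0
  have h7 : #(badSet P E' j) ≤ #(badSet P E' j \ O) + #O := by
    rw [← Finset.card_sdiff_add_card_inter (badSet P E' j) O]
    exact Nat.add_le_add_left (Finset.card_le_card Finset.inter_subset_right) _
  have h8 : (#(badSet P E' j) : ℝ) ≤ #(badSet P E' j \ O) + #O := by exact_mod_cast h7
  have h9 : (2 : ℝ) ^ 11 * #O ≤ n := by exact_mod_cast hOn
  have h10 : (2 : ℝ) ^ 10 * #(badSet P E' j) ≤ n := by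
    norm_num at h6 h9 ⊢; linarith
  exact_mod_cast h10

end CyclicGraph

/-! ### The tower construction and the lower bound. -/

section LowerBound

/-- The binary logarithm of the size of the `i`-th alphabet. -/
def logSize (i : ℕ) : ℕ := tower (i + 3) + 10

theorem add_sixteen_le_tower (i : ℕ) : i + 16 ≤ tower (i + 3) := by
  induction i with
  | zero => norm_num [tower]
  | succ i ih =>
    have : tower (i + 3) < tower (i + 1 + 3) := by
      rw [show i + 1 + 3 = (i + 3) + 1 by ring, tower]; exact Nat.lt_two_pow_self
    omega

theorem logSize_zero : logSize 0 = 26 := by norm_num [logSize, tower]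

theorem logSize_succ_le (i : ℕ) : logSize (i + 1) ≤ 2 ^ (logSize i - 4) := by
  have h : 1 ≤ 2 ^ tower (i + 3) := Nat.one_le_two_pow
  -- The summand 10 in `logSize` leaves 2^6 to spare after the loss of 4 in `exists_isCode`.
  have h2 : logSize i - 4 = tower (i + 3) + 6 := by unfold logSize; omega
  rw [h2, pow_add, logSize, show i + 1 + 3 = (i + 3) + 1 by ring, tower]
  omega

theorem logSize_le_succ (i : ℕ) : logSize i ≤ logSize (i + 1) := by
  unfold logSize
  have : tower (i + 3) ≤ tower (i + 1 + 3) := tower_mono (by omega)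
  omega

section InitialPartition

variable {s : ℕ} {M : Fin (s + 1) → Type} [∀ i, Fintype (M i)] [∀ i, DecidableEq (M i)]

/-- The copy and the first coordinate of a vertex. -/
def copyAndHead (a : Fin 3 × ∀ i, M i) : Fin 3 × M 0 := (a.1, a.2 0)

theorem exists_initial_partition : ∃ P₀ : Finpartition (univ : Finset (Fin 3 × ∀ i, M i)),
    P₀.IsEquipartition ∧ #P₀.parts ≤ 3 * Fintype.card (M 0) ∧
      ∀ a b, P₀.part a = P₀.part b → copyAndHead a = copyAndHead b := by
  classical
  let P₀ : Finpartition (univ : Finset (Fin 3 × ∀ i, M i)) :=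
    Finpartition.ofSetoid (Setoid.ker copyAndHead)
  have hparts : ∀ A ∈ P₀.parts, ∃ q : Fin 3 × M 0, A = univ.filter fun b => copyAndHead b = q := by
    intro A hA
    simp only [P₀, Finpartition.ofSetoid, Finpartition.ofSetSetoid, Finset.mem_image] at hA
    obtain ⟨a, -, rfl⟩ := hA
    exact ⟨copyAndHead a, Finset.filter_congr fun b _ => ⟨fun h => h.symm, fun h => h.symm⟩⟩
  refine ⟨P₀, ?_, ?_, ?_⟩
  · refine Set.equitableOn_iff_exists_eq_eq_add_one.2
      ⟨∏ l : Fin s, Fintype.card (M l.succ), fun A hA => Or.inl ?_⟩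
    obtain ⟨q, rfl⟩ := hparts A hA
    have : (univ.filter fun b : Fin 3 × ∀ i, M i => copyAndHead b = q)
        = {q.1} ×ˢ univ.filter fun x : ∀ i, M i => x 0 = q.2 := by
      ext b
      simp only [copyAndHead, Prod.ext_iff, mem_filter, mem_univ, true_and, mem_product,
        mem_singleton]
    rw [this, Finset.card_product, Finset.card_singleton, one_mul, card_filter_zero_eq]
  · have : P₀.parts ⊆ univ.image fun q : Fin 3 × M 0 =>
        univ.filter fun b : Fin 3 × ∀ i, M i => copyAndHead b = q := by
      intro A hA
      obtain ⟨q, rfl⟩ := hparts A hA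
      exact Finset.mem_image_of_mem _ (mem_univ q)
    refine (Finset.card_le_card this).trans (Finset.card_image_le.trans ?_)
    rw [Finset.card_univ, Fintype.card_prod, Fintype.card_fin]
  · intro a b hab
    have hb : b ∈ P₀.part a := by rw [hab]; exact P₀.mem_part_self.2 (mem_univ b)
    exact Finpartition.mem_part_ofSetoid_iff_rel.1 hb

end InitialPartition

section Refinement

variable {s : ℕ} {M : Fin (s + 1) → Type} [∀ i, DecidableEq (M i)]

/-- The points agree in the coordinates up to `i`. -/
def Agree (i : ℕ) (x x' : ∀ i, M i) : Prop := ∀ j : Fin (s + 1), (j : ℕ) ≤ i → x j = x' j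

instance (i : ℕ) : DecidableRel (Agree (M := M) i) :=
  fun _ _ => inferInstanceAs (Decidable (∀ _, _))

/-- One of the codes up to `i` shows that `x` and `y` are not related. -/
def Excluded (c : ∀ l : Fin s, M l.succ → M l.castSucc → Bool) (i : ℕ) (x y : ∀ i, M i) : Prop :=
  ∃ l : Fin s, (l : ℕ) ≤ i ∧ ¬ c l (x l.succ) (y l.castSucc)

instance (c : ∀ l : Fin s, M l.succ → M l.castSucc → Bool) (i : ℕ) :
    DecidableRel (Excluded c i) :=
  fun _ _ => inferInstanceAs (Decidable (∃ _, _))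

variable [∀ i, Fintype (M i)] {c : ∀ l : Fin s, M l.succ → M l.castSucc → Bool}

/-- Induction on the number of known letters, for all three copies at once. Knowing y up to letter i
decides the codes up to i, and these separate words x that differ by letter i+1. -/
theorem card_badSet_agree_le (hc : ∀ l, IsCode (c l))
    (hM : ∀ l : Fin s, 2 ^ (22 + (l : ℕ)) ≤ Fintype.card (M l.castSucc)) {d : ℕ}
    (hd : ∀ x, #{y | codeRel c x y} = d) {P : Finpartition (univ : Finset (Fin 3 × ∀ i, M i))}
    (hP : P.IsEquipartition)
    (hhead : ∀ a b, P.part a = P.part b → copyAndHead a = copyAndHead b)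
    {G' : SimpleGraph (Fin 3 × ∀ i, M i)} {ε δ : ℝ} (hε : 0 < ε) (hε1 : ε ≤ 1 / 512)
    (hδ : δ ≤ 1 / 2 ^ 38) (hεs : ε * 2 ^ s ≤ 1 / 2 ^ 22)
    (hclose : IsClose δ (cyclicGraph (codeRel c)) G') (hreg : IsRegularPartition G' ε P) (i : ℕ) :
    ∀ j, 2 ^ 10 * #(badSet P (Agree i) j) ≤ Fintype.card (∀ i, M i) := by
  have hmem : ∀ a b, b ∈ P.part a → copyAndHead b = copyAndHead a := fun a b hb =>
    hhead _ _ ((P.mem_part_iff_part_eq_part (mem_univ b) (mem_univ a)).1 hb)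
  induction i with
  | zero =>
    intro j
    have : badSet P (Agree (M := M) 0) j = ∅ := by
      refine Finset.filter_false_of_mem fun x _ => ?_
      rw [Finset.filter_true_of_mem]
      · omega
      · intro a ha j' hj'
        have h0 : j' = 0 := Fin.ext (by simpa using hj')
        subst h0
        exact (Prod.mk.inj (hmem _ _ ha)).2.symm
    rw [this]; simp
  | succ i ih =>
    intro j
    rcases isEmpty_or_nonempty (∀ i, M i) with he | ⟨⟨x₀⟩⟩
    · rw [Finset.eq_empty_of_isEmpty (badSet P (Agree (i + 1)) j)]; simp
    refine card_badSet_le (D := 2 ^ s) (perp := Excluded c i) (E := Agree i) hd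
      (by rw [← hd x₀]; exact card_codeRel_mul hc x₀) ?_ ?_ hP
      (fun a b hb => (Prod.mk.inj (hmem a b hb)).1) ?_
      (fun Y hY => card_overrepresented_le hc hM Y hY) hε hε1 hδ (by push_cast; exact hεs)
      hclose hreg j (ih (j + 1))
    · rintro x y ⟨l, -, hl⟩ hR
      exact hl (hR l)
    · rintro x y y' hyy ⟨l, hli, hl⟩
      exact ⟨l, hli, by rwa [← hyy l.castSucc (by simpa using hli)]⟩
    · intro j' x a ha hne
      simp only [Agree, not_forall] at hne
      obtain ⟨t, hti, ht⟩ := hne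
      rcases Fin.eq_zero_or_eq_succ t with rfl | ⟨l, rfl⟩
      · exact absurd (Prod.mk.inj (hmem _ _ ha)).2.symm ht
      · refine le_trans (Nat.mul_le_mul_left 4 (Finset.card_le_card ?_))
          (card_codeRel_and_le hc ht)
        intro y hy
        obtain ⟨hR, hE⟩ := (Finset.mem_filter.1 hy).2
        refine Finset.mem_filter.2 ⟨mem_univ y, hR, ?_⟩
        by_contra hl
        exact hE ⟨l, by simpa using hti, hl⟩

/-- Agreement in all letters leaves one vertex, and a part with at least 63/64 of its vertices in a
single point is a singleton. -/
theorem card_le_two_mul_card_parts {P : Finpartition (univ : Finset (Fin 3 × ∀ i, M i))}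
    (hhead : ∀ a b, P.part a = P.part b → copyAndHead a = copyAndHead b)
    (hbad : 2 ^ 10 * #(badSet P (Agree s) 0) ≤ Fintype.card (∀ i, M i)) :
    Fintype.card (∀ i, M i) ≤ 2 * #P.parts := by
  have hsing : ∀ x ∉ badSet P (Agree s) 0, ∀ x', P.part (0, x) = P.part (0, x') → x = x' := by
    intro x hx x' hxx
    have h1 : 63 * #(P.part (0, x)) ≤ 64 * #{a ∈ P.part (0, x) | Agree s x a.2} := by
      by_contra hc
      exact hx (Finset.mem_filter.2 ⟨mem_univ x, not_le.1 hc⟩)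
    have h2 : #{a ∈ P.part (0, x) | Agree s x a.2} ≤ 1 := by
      have : Nonempty (Fin 3 × ∀ i, M i) := ⟨(0, x)⟩
      rw [Finset.card_le_one_iff_subset_singleton]
      refine ⟨(0, x), fun a ha => ?_⟩
      obtain ⟨ha1, ha2⟩ := Finset.mem_filter.1 ha
      have e1 := hhead _ _ ((P.mem_part_iff_part_eq_part (mem_univ a) (mem_univ _)).1 ha1)
      rw [Finset.mem_singleton]
      refine Prod.ext (Prod.mk.inj e1).1 (funext fun j => (ha2 j ?_).symm)
      exact Nat.lt_succ_iff.1 j.2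
    have h3 : #(P.part (0, x)) ≤ 1 := by omega
    have h4 := Finset.card_le_one.1 h3 (0, x) (P.mem_part_self.2 (mem_univ _)) (0, x')
      (by rw [hxx]; exact P.mem_part_self.2 (mem_univ _))
    exact (Prod.mk.inj h4).2
  have h1 : #(univ \ badSet P (Agree s) 0) ≤ #P.parts := by
    refine Finset.card_le_card_of_injOn (fun x => P.part (0, x))
      (fun x _ => P.part_mem.2 (mem_univ _)) ?_
    intro x hx x' _ hxx
    exact hsing x (Finset.mem_sdiff.1 hx).2 x' hxx
  have h2 := Finset.card_sdiff_add_card_inter univ (badSet P (Agree s) 0)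
  rw [Finset.univ_inter, Finset.card_univ] at h2
  omega

end Refinement

theorem tower_le_of_isGood {ε δ p : ℝ} {s t : ℕ} (hε : 0 < ε) (hε1 : ε ≤ 1 / 2 ^ 28)
    (hδ : δ ≤ 1 / 2 ^ 38) (hεs : ε * 2 ^ s ≤ 1 / 2 ^ 22) (hp : p * 2 ^ s ≤ 1 / 2)
    (h : IsGood ε δ p t) : tower s ≤ t := by
  let M : Fin (s + 1) → Type := fun i => Fin (2 ^ logSize i)
  have hMcard : ∀ i, Fintype.card (M i) = 2 ^ logSize i := fun i => Fintype.card_fin _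
  have hcode : ∀ l : Fin s, ∃ c : M l.succ → M l.castSucc → Bool, IsCode c := fun l => by
    have h1 := logSize_le_succ l
    have h2 := logSize_succ_le l
    exact exists_isCode (k := logSize l.castSucc) (k' := logSize l.succ)
      (by unfold logSize; omega) (by simpa using h1) (by simpa using h2)
  choose c hc using hcode
  have hpos : ∀ i, 0 < Fintype.card (M i) := fun i => by rw [hMcard]; positivity
  have hV : 2 ^ logSize s ≤ Fintype.card (∀ i, M i) := by
    rw [Fintype.card_pi, Fin.prod_univ_castSucc, hMcard (Fin.last s), Fin.val_last]
    exact Nat.le_mul_of_pos_left _ (Finset.prod_pos fun l _ => hpos _)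
  have hV0 : 0 < Fintype.card (∀ i, M i) := (by positivity : 0 < 2 ^ logSize s).trans_le hV
  obtain ⟨x₀⟩ := Fintype.card_pos_iff.1 hV0
  set d := #{y | codeRel c x₀ y} with hd
  have hdn : d * 2 ^ s = Fintype.card (∀ i, M i) := card_codeRel_mul hc x₀
  have hd' : ∀ x, #{y | codeRel c x y} = d := fun x =>
    Nat.eq_of_mul_eq_mul_right (by positivity) ((card_codeRel_mul hc x).trans hdn.symm)
  have hdens : p ≤ density (cyclicGraph (codeRel c)) := by
    rw [density_eq, sum_adj_cyclicGraph hd', Fintype.card_prod, Fintype.card_fin]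
    have hn : (0 : ℝ) < Fintype.card (∀ i, M i) := by exact_mod_cast hV0
    have hdnr : (d : ℝ) * 2 ^ s = Fintype.card (∀ i, M i) := by exact_mod_cast hdn
    have hd0 : (0 : ℝ) ≤ d := Nat.cast_nonneg d
    push_cast
    rw [le_div_iff₀ (by positivity)]
    have e1 : p * Fintype.card (∀ i, M i) ≤ d := by
      rw [← hdnr]
      nlinarith
    have e2 : p * Fintype.card (∀ i, M i) ≤ 2 / 3 * d := by
      rw [← hdnr]
      nlinarith
    nlinarith
  obtain ⟨P₀, hP₀, hP₀c, hP₀h⟩ := exists_initial_partition (M := M)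
  obtain ⟨G', hclose, P, hP, hle, hreg, hcard⟩ := h _ (cyclicGraph (codeRel c)) hdens P₀ hP₀ (by
    have e1 : #P₀.parts ≤ 2 ^ 28 := by
      -- There are at most 3 * 2 ^ 26 pairs of a copy and a first letter.
      refine hP₀c.trans ?_
      rw [hMcard, Fin.val_zero, logSize_zero]; norm_num
    have e2 : (#P₀.parts : ℝ) ≤ 2 ^ 28 := by exact_mod_cast e1
    refine e2.trans ?_
    rw [le_div_iff₀ hε]
    rw [le_div_iff₀ (by positivity)] at hε1
    linarith)
  have hhead : ∀ a b, P.part a = P.part b → copyAndHead a = copyAndHead b := fun a b e =>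
    hP₀h a b (finer_part_of_le hle a b e)
  have hbad := card_badSet_agree_le hc (fun l => by
      rw [hMcard]
      refine Nat.pow_le_pow_right (by norm_num) ?_
      have := add_sixteen_le_tower l
      simp only [logSize, Fin.val_castSucc]; omega) hd' hP hhead hε
    (hε1.trans (by norm_num)) hδ hεs hclose hreg s 0
  have hfin := card_le_two_mul_card_parts hhead hbad
  have h2 : 2 * tower s ≤ 2 ^ logSize s := by
    have e1 : tower s ≤ tower (s + 3) := tower_mono (by omega)
    have e2 : tower (s + 3) < 2 ^ tower (s + 3) := Nat.lt_two_pow_self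
    rw [logSize, pow_add]; omega
  omega

theorem pos_of_isGood {ε δ p : ℝ} {t : ℕ} (hε : 0 < ε) (hε1 : ε ≤ 1) (hp : p ≤ 1 / 2)
    (h : IsGood ε δ p t) : 1 ≤ t := by
  have hdens : p ≤ density (⊤ : SimpleGraph (Fin 2)) := by
    rw [density_eq]
    simp [adj, Fin.sum_univ_two]
    linarith
  have hne : (univ : Finset (Fin 2)) ≠ ∅ := Finset.univ_nonempty.ne_empty
  obtain ⟨-, -, P, -, -, -, hcard⟩ := h (Fin 2) ⊤ hdens (Finpartition.indiscrete hne)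
    (Finpartition.indiscrete_isEquipartition _) (by
      simp only [Finpartition.indiscrete_parts, Finset.card_singleton, Nat.cast_one]
      rw [le_div_iff₀ hε]; linarith)
  exact (Finset.card_pos.2 (P.parts_nonempty hne)).trans_le hcard

/-- For p ≤ 1/64 take s about log₂(1/p) - 1. Then C ≥ 5 gives ε2^s ≤ p⁴(p2^s), small enough for the
construction. For larger p the factor 1/10 makes the height 0, and any good integer is at least 1.
-/
theorem twr_le_of_isGood {δ C p : ℝ} {t : ℕ} (hδ : δ ≤ 1 / 2 ^ 38) (hC : 5 ≤ C) (hp : 0 < p)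
    (hp2 : p ≤ 1 / 2) (h : IsGood (p ^ C) δ p t) : twr (1 / 10 * Real.log (1 / p)) ≤ t := by
  have hε : 0 < p ^ C := Real.rpow_pos_of_pos hp C
  have hεp : p ^ C ≤ p ^ 5 := by
    rw [← Real.rpow_natCast]
    exact Real.rpow_le_rpow_of_exponent_ge hp (by linarith) (by exact_mod_cast hC)
  set x := Real.log (1 / p) with hx
  have hexp : Real.exp x = 1 / p := Real.exp_log (by positivity)
  have hl1 := Real.log_two_gt_d9
  have hl2 := Real.log_two_lt_d9
  have hlog64 : Real.log 64 = 6 * Real.log 2 := by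
    rw [show (64 : ℝ) = 2 ^ 6 by norm_num, Real.log_pow]; norm_num
  rcases le_or_gt p (1 / 64) with hp64 | hp64
  · have hx64 : 6 * Real.log 2 ≤ x := by
      rw [← hlog64]
      exact Real.log_le_log (by norm_num) (by rw [le_div_iff₀ hp]; linarith)
    set s := ⌊x / Real.log 2 - 1⌋₊ with hs
    have hxl : x ≤ x / Real.log 2 := by
      rw [le_div_iff₀ (by linarith)]; nlinarith
    have hs1 : (s : ℝ) ≤ x / Real.log 2 - 1 := Nat.floor_le (by linarith)
    have hs2 : x / Real.log 2 - 1 < s + 1 := Nat.lt_floor_add_one _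
    have h2s : p * 2 ^ s ≤ 1 / 2 := by
      have e1 : (2 : ℝ) ^ s ≤ 1 / p / 2 := by
        rw [← Real.rpow_natCast, Real.rpow_def_of_pos two_pos, ← hexp,
          show Real.exp x / 2 = Real.exp (x - Real.log 2) by
            rw [Real.exp_sub, Real.exp_log two_pos]]
        apply Real.exp_le_exp.2
        have := mul_le_mul_of_nonneg_left hs1 (by linarith : 0 ≤ Real.log 2)
        rw [mul_sub, mul_div_cancel₀ _ (by linarith : Real.log 2 ≠ 0)] at this
        linarith
      calc p * 2 ^ s ≤ p * (1 / p / 2) := mul_le_mul_of_nonneg_left e1 hp.le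
        _ = 1 / 2 := by field_simp
    have hp4 : p ^ 4 ≤ 1 / 2 ^ 24 := by
      calc p ^ 4 ≤ (1 / 64) ^ 4 := pow_le_pow_left₀ hp.le hp64 4
        _ = _ := by norm_num
    have key : tower s ≤ t := by
      refine tower_le_of_isGood hε ?_ hδ ?_ h2s h
      · calc p ^ C ≤ p ^ 5 := hεp
          _ ≤ (1 / 64) ^ 5 := pow_le_pow_left₀ hp.le hp64 5
          _ ≤ _ := by norm_num
      · calc p ^ C * 2 ^ s ≤ p ^ 5 * 2 ^ s := by gcongr
          _ = p ^ 4 * (p * 2 ^ s) := by ring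
          _ ≤ 1 / 2 ^ 24 * (1 / 2) := mul_le_mul hp4 h2s (by positivity) (by norm_num)
          _ ≤ _ := by norm_num
    refine (tower_mono (Nat.floor_le_of_le ?_)).trans key
    linarith
  · have hx10 : x < 10 := by
      have : x ≤ Real.log 64 :=
        Real.log_le_log (by positivity) (by rw [div_le_iff₀ hp]; linarith)
      linarith
    have h0 : ⌊1 / 10 * x⌋₊ = 0 := Nat.floor_eq_zero.2 (by linarith)
    have hε1 : p ^ C ≤ 1 := hεp.trans (pow_le_one₀ hp.le (by linarith))
    rw [twr, h0]
    exact pos_of_isGood hε hε1 hp2 h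

end LowerBound

end SRAL

theorem mainTheorem8 :
    ∃ δ₀ : ℝ, 0 < δ₀ ∧
      ∀ δ : ℝ, 0 < δ → δ ≤ δ₀ → ∀ C : ℝ, 5 ≤ C →
        ∃ c₁ c₂ : ℝ, 0 < c₁ ∧ 0 < c₂ ∧
          ∀ p : ℝ, 0 < p → p ≤ 1 / 2 →
            (SRAL.twr (c₁ * Real.log (1 / p)) : ℕ∞) ≤ SRAL.S (p ^ C) δ p ∧
              SRAL.S (p ^ C) δ p ≤ (SRAL.twr (c₂ * Real.log (1 / p)) : ℕ∞) := by
  refine ⟨1 / 2 ^ 38, by positivity, fun δ hδ hδ0 C hC => ?_⟩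
  obtain ⟨c₂, hc₂, hup⟩ := SRAL.exists_upper_bound hδ (hδ0.trans (by norm_num))
    (by linarith : (1 : ℝ) ≤ C)
  refine ⟨1 / 10, c₂, by norm_num, hc₂, fun p hp hp2 => ⟨?_, hup p hp hp2⟩⟩
  refine le_sInf ?_
  rintro _ ⟨t, ht, rfl⟩
  exact Nat.cast_le.2 (SRAL.twr_le_of_isGood hδ0 hC hp hp2 ht)
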